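/- Let $\Bbbk$ be a field and $R$ a finite dimensional unital associative $\Bbbk$-algebra with Jacobson radical $\mathcal J$; let $n$ be the smallest positive integer with $\mathcal J^n=0$, and let $\Lambda^0$ index the isomorphism classes of simple right $R$-modules. Call $R$ \emph{Wedderburn} if it has a semisimple subalgebra $S$ with $R=S\oplus\mathcal J$ as vector spaces. If $\Bbbk$ is perfect, then every such $R$ is Wedderburn. Assume that $R$ is Wedderburn and fix such an $S$. There are idempotents $c_\lambda\in S$ ($\lambda\in\Lambda^0$), central in $S$ and mutually orthogonal, with $1_R=\sum_\lambda c_\lambda$ and such that $c_\lambda\neq 0$ and the top of the right module $c_\lambda R$ is a direct sum of copies of the simple module of type $\lambda$. Let $\ell(\lambda)$ be the Loewy length of $c_\lambda R$, let $c_{\ge i}$ be the sum of all $c_\lambda$ with $\ell(\lambda)\ge i$, and put $M^i:=c_{\ge i}R/c_{\ge i}\mathcal J^i$. Then for each $i\ge1$, $M^i$ is the largest direct summand of the right $R$-module $R/\mathcal J^i$ such that no nonzero direct summand of $M^i$ is isomorphic to a direct summand of some $M^j$ with $1\le j<i$. The \emph{Auslander--Dlab--Ringel algebra} of $R$ is $A=A(R):=\operatorname{End}_R\bigl(\bigoplus_{i=1}^nM^i\bigr)$;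 let $e_i\in A$ be the projection onto $M^i$. Then the following hold. (1) The simple left $A$-modules are labelled, without repetition up to isomorphism, by the set $\Lambda=\{(i,\lambda)\mid\lambda\in\Lambda^0,\ 1\le i\le\ell(\lambda)\}$; here an idempotent of $A$ whose image is isomorphic to $c_\lambda R/c_\lambda\mathcal J^i$ acts nontrivially on $L(i,\lambda)$ and as zero on all other $L(j,\mu)$. The least $j$ for which $e_jAe_j$ contains an idempotent equivalent to a primitive idempotent belonging to $L(i,\lambda)$ is $j=i$. (2) Let $\le$ be the idempotent partial order on $\Lambda$, in which $(i,\lambda)<(j,\mu)$ if and only if $i>j$. Then $(A,\le)$ is quasi-hereditary: there are modules $\Delta(x)$, $x\in\Lambda$ (the standard modules), with $[\Delta(x):L(x)]=1$ and $[\Delta(x):L(y)]=0$ unless $y\le x$, and a surjection from the projective cover of $L(x)$ onto $\Delta(x)$ whose kernel has a finite filtration with sections isomorphic to modules $\Delta(y)$ with $y>x$. (3) Let $B\subset A$ be the set of those $\alpha$ all of whose components $e_i\alpha e_j\colon M^j\to M^i$ map the class of $c_{\ge j}$ into the image of $c_{\ge i}S$. Then $B$ is a subalgebra of $A$. With respect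 to the grading $A_d=\bigoplus_ie_iAe_{i+d}$ ($d\in\mathbb Z$) it is a graded pre-Borelic subalgebra: it contains the $e_i$, is graded with $B_d=0$ for $d<0$, satisfies $A=B\oplus A_-B$ with $A_-=\bigoplus_{d<0}A_d$, is projective as a left $B_0$-module, and $A$ is projective as a right $B$-module. (4) $B$ is an exact Borel subalgebra of $(A,\le)$: the simple $B$-modules are labelled, without repetition, as $L^0(x)$, $x\in\Lambda$, such that all composition factors of the radical of the projective cover of $L^0(x)$ are of the form $L^0(y)$ with $y>x$; the functor $A\otimes_B-$ is exact; and $A\otimes_BL^0(x)\cong\Delta(x)$ for every $x\in\Lambda$. -/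

import Mathlib

open scoped TensorProduct

universe u v w

noncomputable section

namespace ADR

/-! ## Modules, idempotents, multiplicities -/

section General

variable (A : Type u) [Ring A]

/-- `L` is a complete irredundant list of the simple left `A`-modules up to isomorphism. -/
structure IsSimpleLabelling {Λ : Type w} (L : Λ → ModuleCat.{u} A) : Prop where
  simple : ∀ x, IsSimpleModule A (L x)
  irredundant : ∀ x y, Nonempty (L x ≃ₗ[A] L y) → x = y
  complete : ∀ X : ModuleCat.{u} A, IsSimpleModule A X → ∃ x, Nonempty (X ≃ₗ[A] L x)

variable {A}

/-- The idempotent `e` is primitive: the left module `Ae` is indecomposable. -/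
structure IsPrimitiveIdempotent (e : A) : Prop where
  idem : IsIdempotentElem e
  ne_zero : e ≠ 0
  indec : ∀ U V : Submodule A (Ideal.span {e} : Ideal A), IsCompl U V → U = ⊥ ∨ V = ⊥

/-- `e` is a primitive idempotent belonging to the simple module `L`, so that `Ae` is a projective
cover of `L`. -/
def IsPrimitiveFor (e : A) (L : Type u) [AddCommGroup L] [Module A L] : Prop :=
  IsPrimitiveIdempotent e ∧ ∃ v : L, e • v ≠ 0

/-- Equivalence of idempotents. -/
def IdemEquiv (e f : A) : Prop := ∃ a b : A, e = a * b ∧ f = b * a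

variable (A) in
/-- `X` has a finite filtration by submodules all of whose sections satisfy `P`. -/
def HasFiltration (X : Type u) [AddCommGroup X] [Module A X] (P : ModuleCat.{u} A → Prop) : Prop :=
  ∃ (d : ℕ) (F : ℕ → Submodule A X), Monotone F ∧ F 0 = ⊥ ∧ F d = ⊤ ∧
    ∀ i < d, P (ModuleCat.of A (F (i + 1) ⧸ (F i).submoduleOf (F (i + 1))))

variable (A) in
/-- `X` has finite length and the Jordan–Hölder multiplicity `[X : L]` is `m`. -/
def HasMultiplicity (X L : Type u) [AddCommGroup X] [Module A X] [AddCommGroup L] [Module A L]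
    (m : ℕ) : Prop :=
  ∃ (d : ℕ) (F : ℕ → Submodule A X), Monotone F ∧ F 0 = ⊥ ∧ F d = ⊤ ∧
    (∀ i < d, IsSimpleModule A (F (i + 1) ⧸ (F i).submoduleOf (F (i + 1)))) ∧
    {i | i < d ∧
      Nonempty ((F (i + 1) ⧸ (F i).submoduleOf (F (i + 1))) ≃ₗ[A] L)}.ncard = m

/-- The strict relation belonging to a partial order `le`. -/
def Strict {Λ : Type w} (le : Λ → Λ → Prop) (x y : Λ) : Prop := le x y ∧ x ≠ y

/-- `(A, ≤)` is quasi-hereditary, with simple modules `L x` and standard modules `Δ x`. -/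
structure IsQuasiHereditary {Λ : Type w} (L : Λ → ModuleCat.{u} A) (le : Λ → Λ → Prop)
    (Δ : Λ → ModuleCat.{u} A) : Prop where
  simples : IsSimpleLabelling A L
  refl : ∀ x, le x x
  trans : ∀ x y z, le x y → le y z → le x z
  antisymm : ∀ x y, le x y → le y x → x = y
  mult_zero : ∀ x y, ¬ le y x → HasMultiplicity A (Δ x) (L y) 0
  mult_one : ∀ x, HasMultiplicity A (Δ x) (L x) 1
  cover : ∀ x, ∃ e : A, IsPrimitiveFor e (L x) ∧
    ∃ f : (Ideal.span {e} : Ideal A) →ₗ[A] Δ x, Function.Surjective f ∧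
      HasFiltration A (LinearMap.ker f) fun X => ∃ y, Strict le x y ∧ Nonempty (X ≃ₗ[A] Δ y)

end General

/-! ## Induction along a subalgebra and exact Borel subalgebras -/

section Borel

variable {k : Type v} [Field k] {A : Type u} [Ring A] [Algebra k A] (B : Subalgebra k A)

/-- The relations `ab ⊗ n = a ⊗ bn`. -/
def balanced (N : Type u) [AddCommGroup N] [Module B N] : Submodule A (A ⊗[ℤ] N) :=
  Submodule.span A {t | ∃ (a : A) (b : B) (n : N), t = (a * (b : A)) ⊗ₜ[ℤ] n - a ⊗ₜ[ℤ] (b • n)}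

/-- The left `A`-module `A ⊗_B N`. -/
abbrev Ind (N : Type u) [AddCommGroup N] [Module B N] : Type u :=
  (A ⊗[ℤ] N) ⧸ balanced B N

/-- The `A`-linear map `A ⊗_B N → A ⊗_B N'` induced by a `B`-linear map `N → N'`. -/
def Ind.map {N N' : Type u} [AddCommGroup N] [Module B N] [AddCommGroup N'] [Module B N']
    (f : N →ₗ[B] N') : Ind B N →ₗ[A] Ind B N' :=
  Submodule.mapQ _ _
    (TensorProduct.AlgebraTensorModule.map (LinearMap.id : A →ₗ[A] A)
      f.toAddMonoidHom.toIntLinearMap) (by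
    rw [balanced, Submodule.span_le]
    rintro _ ⟨a, b, n, rfl⟩
    refine Submodule.subset_span ⟨a, b, f n, ?_⟩
    simp)

/-- The functor `A ⊗_B -` from finitely generated `B`-modules to `A`-modules is exact. -/
def IndExact : Prop :=
  ∀ (X Y Z : ModuleCat.{u} B) [Module.Finite B X] [Module.Finite B Y] [Module.Finite B Z]
    (f : X →ₗ[B] Y) (g : Y →ₗ[B] Z),
    Function.Injective f → Function.Exact f g → Function.Surjective g →
      Function.Injective (Ind.map B f) ∧ Function.Exact (Ind.map B f) (Ind.map B g) ∧
        Function.Surjective (Ind.map B g)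

/-- `B` is an exact Borel subalgebra of a quasi-hereditary algebra `A` with partial order `le` and
standard modules `Δ`. -/
def IsExactBorel {Λ : Type w} (le : Λ → Λ → Prop) (Δ : Λ → ModuleCat.{u} A) : Prop :=
  ∃ L₀ : Λ → ModuleCat.{u} B, IsSimpleLabelling B L₀ ∧
    (∀ x, ∃ e : B, IsPrimitiveFor e (L₀ x) ∧ ∀ y, ¬ Strict le x y →
      HasMultiplicity B (Module.jacobson B (Ideal.span {e} : Ideal B)) (L₀ y) 0) ∧
    IndExact B ∧
    ∀ x, Nonempty (Ind B (L₀ x) ≃ₗ[A] Δ x)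

end Borel

/-! ## Idempotent gradings -/

section Grading

variable (k : Type v) [Field k] {A : Type u} [Ring A] [Algebra k A] {m : ℕ} (ε : Fin m → A)

/-- The part of degree `d` of the idempotent grading, `⨁_i ε_i A ε_{i+d}`. -/
def gradedPart (d : ℤ) : Submodule k A :=
  ⨆ (i : Fin m) (j : Fin m) (_ : (j : ℤ) - (i : ℤ) = d),
    Submodule.span k {x | ∃ a : A, x = ε i * a * ε j}

/-- The sum of the parts of negative degree. -/
def negPart : Submodule k A := ⨆ (d : ℤ) (_ : d < 0), gradedPart k ε d

variable {k}

/-- `B` is an `ℕ`-graded subalgebra: a graded subalgebra, containing the idempotents `ε_i`,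
without components of negative degree. -/
structure IsNGraded (B : Subalgebra k A) : Prop where
  idem_mem : ∀ i, ε i ∈ B
  graded : ⨆ d : ℤ, (Subalgebra.toSubmodule B ⊓ gradedPart k ε d) = Subalgebra.toSubmodule B
  nonneg : ∀ d : ℤ, d < 0 → Subalgebra.toSubmodule B ⊓ gradedPart k ε d = ⊥

/-- The subalgebra `H = B_0` of `B`; for a complete system of orthogonal idempotents, the elements
of degree zero of `A` are those that commute with every `ε_i`. -/
def degZero (B : Subalgebra k A) : Subalgebra k B :=
  (Subalgebra.centralizer k (Set.range ε)).comap B.val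

/-- `B` is a graded pre-Borelic subalgebra of the idempotent graded algebra `A`: an `ℕ`-graded
subalgebra with `A = B ⊕ A_- B` such that `A` is projective as a right `B`-module and `B` is
projective as a left `B_0`-module. -/
structure IsGradedPreBorelic (B : Subalgebra k A) : Prop where
  idempotents : CompleteOrthogonalIdempotents ε
  nGraded : IsNGraded ε B
  complete : IsCompl (Subalgebra.toSubmodule B) (negPart k ε * Subalgebra.toSubmodule B)
  projective_right : Module.Projective B.op A
  projective_left : Module.Projective (degZero ε B) B

/-- For a simple module `L`: the least `i` such that `ε_i A ε_i` contains an idempotent equivalent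
to a primitive idempotent belonging to `L`. -/
def idemLevel (L : Type u) [AddCommGroup L] [Module A L] : ℕ :=
  sInf {n | ∃ i : Fin m, (i : ℕ) = n ∧ ∃ f : A, IsIdempotentElem f ∧ ε i * f = f ∧ f * ε i = f ∧
    ∃ e : A, IsPrimitiveFor e L ∧ IdemEquiv f e}

/-- The idempotent partial order: `x < y` if and only if `x` has larger level than `y`. -/
def idemLE {Λ : Type w} (L : Λ → ModuleCat.{u} A) (x y : Λ) : Prop :=
  x = y ∨ idemLevel ε (L y) < idemLevel ε (L x)

end Grading

/-! ## Wedderburn algebras -/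

/-- `S` is a semisimple subalgebra with `R = S ⊕ rad R` as vector spaces. -/
structure IsWedderburnComplement {k : Type v} {R : Type u} [Field k] [Ring R] [Algebra k R]
    (S : Subalgebra k R) : Prop where
  semisimple : IsSemisimpleRing S
  isCompl : IsCompl (Subalgebra.toSubmodule S) ((Ring.jacobson R).restrictScalars k)

/-! ## The Auslander–Dlab–Ringel algebra -/

section Auslander

variable (R : Type u) [Ring R]

/-- The power `J^i` of the Jacobson radical, as a submodule of the right regular module. Right
`R`-modules are left modules over the opposite ring. -/
def radPow (i : ℕ) : Submodule Rᵐᵒᵖ R where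
  carrier := {x | x ∈ Ring.jacobson R ^ i}
  add_mem' := fun hx hy => (Ring.jacobson R ^ i).add_mem hx hy
  zero_mem' := zero_mem (Ring.jacobson R ^ i)
  smul_mem' := fun r _ hx => Ideal.mul_mem_right r.unop _ hx

/-- The Loewy length of a right `R`-module: the least `l` with `N J^l = 0`. -/
def loewyLength (N : Type u) [AddCommGroup N] [Module Rᵐᵒᵖ N] : ℕ :=
  sInf {l | ∀ r ∈ Ring.jacobson R ^ l, ∀ x : N, MulOpposite.op r • x = 0}

/-- The smallest positive integer `n` with `J^n = 0`. -/
def nilLength : ℕ := sInf {n | 0 < n ∧ Ring.jacobson R ^ n = ⊥}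

/-- No nonzero direct summand of `X` is isomorphic to a direct summand of `Y`. -/
def NoCommonSummand (X Y : Type u) [AddCommGroup X] [Module Rᵐᵒᵖ X] [AddCommGroup Y]
    [Module Rᵐᵒᵖ Y] : Prop :=
  ∀ (D : Submodule Rᵐᵒᵖ X) (D' : Submodule Rᵐᵒᵖ Y), IsComplemented D → IsComplemented D' →
    D ≠ ⊥ → IsEmpty (D ≃ₗ[Rᵐᵒᵖ] D')

/-- For each `i ≥ 1`, `M i` is the largest direct summand of the right module `R / J^i` such that
no direct summand of `M i` appears as a direct summand of `M j` for some `1 ≤ j < i`. -/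
structure IsAuslanderFamily (M : (i : ℕ) → Submodule Rᵐᵒᵖ (R ⧸ radPow R i)) : Prop where
  summand : ∀ i, 1 ≤ i → IsComplemented (M i)
  new : ∀ i j, 1 ≤ j → j < i → NoCommonSummand R (M i) (M j)
  largest : ∀ i, 1 ≤ i → ∀ N : Submodule Rᵐᵒᵖ (R ⧸ radPow R i), IsComplemented N →
    (∀ j, 1 ≤ j → j < i → NoCommonSummand R N (M j)) →
      ∃ D : Submodule Rᵐᵒᵖ (M i), IsComplemented D ∧ Nonempty (N ≃ₗ[Rᵐᵒᵖ] D)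

variable {R}
variable {Λ₀ : Type w} [Fintype Λ₀]

/-- `c` is a decomposition of `1` into orthogonal idempotents such that the right module `c x R` has
semisimple top isotypic of type `T x`. -/
structure IsTopDecomposition (T : Λ₀ → ModuleCat.{u} Rᵐᵒᵖ) (c : Λ₀ → R) : Prop where
  idempotents : CompleteOrthogonalIdempotents c
  ne_zero : ∀ x, c x ≠ 0
  top : ∀ x, IsIsotypicOfType Rᵐᵒᵖ
    ((Submodule.span Rᵐᵒᵖ {c x}) ⧸ Module.jacobson Rᵐᵒᵖ (Submodule.span Rᵐᵒᵖ {c x})) (T x)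

variable (c : Λ₀ → R)

/-- The Loewy length of the right module `c x R`. -/
def len (x : Λ₀) : ℕ := loewyLength R (Submodule.span Rᵐᵒᵖ {c x})

open Classical in
/-- The sum of those `c x` for which `c x R` has Loewy length at least `i`. -/
def cGe (i : ℕ) : R := ∑ x ∈ Finset.univ.filter (fun x => i ≤ len c x), c x

/-- The right module `r R / r J^i`, for an idempotent `r`, as the submodule of `R / J^i` generated
by the class of `r`. -/
def cyc (r : R) (i : ℕ) : Submodule Rᵐᵒᵖ (R ⧸ radPow R i) :=
  Submodule.span Rᵐᵒᵖ {(radPow R i).mkQ r}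

/-- The right module `c_{≥ i} R / c_{≥ i} J^i`. -/
def auslanderSummand (i : ℕ) : Submodule Rᵐᵒᵖ (R ⧸ radPow R i) := cyc (cGe c i) i

instance (i : ℕ) : AddCommGroup (auslanderSummand c i) := Submodule.addCommGroup _

/-- The generator of `c_{≥ i} R / c_{≥ i} J^i`. -/
def gen (i : ℕ) : auslanderSummand c i :=
  ⟨(radPow R i).mkQ (cGe c i), Submodule.subset_span rfl⟩

/-- The direct sum of the modules `c_{≥ i} R / c_{≥ i} J^i` for `0 ≤ i ≤ n`, where `n` is the
nilpotency index of the radical; the summand for `i = 0` is zero. -/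
abbrev AuslanderModule : Type u := (i : Fin (nilLength R + 1)) → auslanderSummand c i

/-- The Auslander–Dlab–Ringel algebra. -/
abbrev ADRAlgebra : Type u := Module.End Rᵐᵒᵖ (AuslanderModule c)

/-- The idempotent given by the projection onto the `i`-th summand. -/
def proj (i : Fin (nilLength R + 1)) : ADRAlgebra c :=
  (LinearMap.single Rᵐᵒᵖ (fun j : Fin (nilLength R + 1) => auslanderSummand c j) i) ∘ₗ
    (LinearMap.proj i)

/-- The pairs `(i, x)` with `1 ≤ i ≤ ℓ(x)`. -/
abbrev Label : Type w := {p : ℕ × Λ₀ // 1 ≤ p.1 ∧ p.1 ≤ len c p.2}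

/-- The simple module `L p` belongs to the pair `p = (i, x)`: an idempotent of the algebra whose
image is isomorphic to `c_x R / c_x J^i` acts nontrivially on `L p` and as zero on `L q` for
`q ≠ p`. -/
def MatchesLabels (L : Label c → ModuleCat.{u} (ADRAlgebra c)) : Prop :=
  ∀ (p q : Label c) (f : ADRAlgebra c), IsIdempotentElem f →
    Nonempty (LinearMap.range f ≃ₗ[Rᵐᵒᵖ] cyc (c p.1.2) p.1.1) →
      ((∃ v : L q, f • v ≠ 0) ↔ q = p)

/-- The subspace `B` of those `α` all of whose components `α_{ij} : M^j → M^i` send the generator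
`c_{≥ j}` into `c_{≥ i} S`. -/
def borelSet (S : Set R) : Set (ADRAlgebra c) :=
  {α | ∀ i j : Fin (nilLength R + 1), ∃ s ∈ S,
    ((α (Pi.single j (gen c j)) i : auslanderSummand c i) : R ⧸ radPow R i) =
      (radPow R i).mkQ (cGe c i * s)}

end Auslander

end ADR

end

noncomputable section

/-! Over a perfect field a semisimple algebra has a separability element. Contracting with it kills
the Hochschild 2-cocycle that measures how far a linear section of R → R/J is from being
multiplicative, so the section can be corrected one power of J at a time; its final image is S
(`exists_section_mul_mem_pow_succ`, `exists_algHom_section`).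

For a given S, everything is computed inside the A-R-bimodule M = ⊕ M^i. Let g_i ∈ M^i be the class
of c_{≥i}, and M[j] the set of elements killed by J^j (`annPow`), an A-submodule. An element of A is
determined by the images of the g_i, and g_i may be sent to any m ∈ M[i] with m c_{≥i} = m
(`hom_ext_g`, `homAt`). The decisive fact is `Splitting.mem_jacobson_of_mul_mem`: an element g_i r
of M^i, with r ∈ c_{≥i}R, that is killed by J^j for some j < i has r ∈ J. So a map M^j → M^i with j
< i sends g_j to a radical multiple of g_i, and reading off the S-part of the diagonal coefficients
gives multiplicative maps π_x from A to the blocks c_λ S, one for each label x = (i, λ), with nil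
common kernel. This determines the simple modules and their levels (`Splitting.topData`,
`TopData.isSimpleLabelling`).

Let f be a primitive idempotent of S below c_λ. Evaluation at g_i f identifies the projective cover
of L(i, λ) with M[i]f. The chain 0 = M[0]f ⊆ M[1]f ⊆ … ⊆ M[i]f has sections Δ(j, λ) = M[j]f /
M[j-1]f, which is the required standard filtration. An idempotent belonging to (j, μ) ≠ (i, λ) with
j ≤ i maps M[i]f into M[i-1]f, which gives the multiplicities.

B is upper triangular because an S-multiple of g_i that is also a radical multiple vanishes. The
decomposition A = B ⊕ A_-B comes from splitting coefficients along R = S ⊕ J: the element g_i r with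
r ∈ J is killed by J^(i-1), so the corresponding map factors through g_(i-1). A dual basis of M over
S adapted to the chain M[j] becomes a finite dual basis of A as a right B-module
(`Splitting.exists_dualBasis_borel`), which gives projectivity and exactness of induction. Finally α
⊗ n ↦ α(g_i n) identifies A ⊗_B L⁰(x) with Δ(x): if α sends g_i f into M[i-1]f, then on g_i f it
factors through the map g_i ↦ g_(i-1), which lies in B and annihilates L⁰(x).

The decisive fact also shows that M^i and M^j have no common summand for j < i; maximality of M^i is
Fitting's lemma. -/

namespace ADR

/-! ### Separability of simple algebras over their centre -/

section Separability

/-- `e` is a separability element of the algebra `Q`. -/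
def IsSepElem (k : Type*) {Q : Type*} [CommRing k] [Ring Q] [Algebra k Q] (e : Q ⊗[k] Q) : Prop :=
  LinearMap.mul' k Q e = 1 ∧
    ∀ a : Q, (LinearMap.mulLeft k a).rTensor Q e = (LinearMap.mulRight k a).lTensor Q e

/-- The map sending `x ⊗ y` to the endomorphism `q ↦ x q y`. -/
def sandwich (k Q : Type*) [CommRing k] [Ring Q] [Algebra k Q] : Q ⊗[k] Q →ₗ[k] Module.End k Q :=
  TensorProduct.lift (LinearMap.mk₂ k (fun x y => LinearMap.mulLeft k x ∘ₗ LinearMap.mulRight k y)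
    (fun _ _ _ => by ext; simp [add_mul]) (fun _ _ _ => by ext; simp)
    (fun _ _ _ => by ext; simp [mul_add]) (fun _ _ _ => by ext; simp))

@[simp] lemma sandwich_tmul {k Q : Type*} [CommRing k] [Ring Q] [Algebra k Q] (x y q : Q) :
    sandwich k Q (x ⊗ₜ y) q = x * (q * y) := by
  simp [sandwich]

variable {L Q : Type*} [Field L] [Ring Q] [Algebra L Q] [IsSimpleRing Q]

/-- A shortest-relation argument. The values taken by one chosen coefficient in relations supported
on the given set form a two-sided ideal, so by simplicity that coefficient may be taken to be 1.
Commutators with c then remove it and give a shorter relation, so all coefficients are central,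
hence scalars, against the independence of `b`. -/
lemma coeff_eq_zero_of_sandwich (hc : ∀ x : Q, (∀ y, y * x = x * y) → ∃ l : L, algebraMap L Q l = x)
    {ι : Type*} (b : ι → Q) (hb : LinearIndependent L b) (s : Finset ι) :
    ∀ x : ι → Q, (∀ q, ∑ i ∈ s, x i * (q * b i) = 0) → ∀ i ∈ s, x i = 0 := by
  classical
  induction s using Finset.induction_on with
  | empty => simp
  | insert j t hj ih =>
    intro x hx
    have key : x j = 0 := by
      by_contra hne
      let I : TwoSidedIdeal Q := TwoSidedIdeal.mk'
        {y | ∃ x' : ι → Q, x' j = y ∧ ∀ q, ∑ i ∈ insert j t, x' i * (q * b i) = 0}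
        ⟨0, rfl, by simp⟩
        (by
          rintro _ _ ⟨x, rfl, hx⟩ ⟨y, rfl, hy⟩
          exact ⟨x + y, rfl, fun q => by
            simp only [Pi.add_apply, add_mul, Finset.sum_add_distrib, hx, hy, add_zero]⟩)
        (by
          rintro _ ⟨x, rfl, hx⟩
          exact ⟨-x, rfl, fun q => by
            simp only [Pi.neg_apply, neg_mul, Finset.sum_neg_distrib, hx, neg_zero]⟩)
        (by
          rintro a _ ⟨x, rfl, hx⟩
          exact ⟨fun i => a * x i, rfl, fun q => by
            simp only [mul_assoc, ← Finset.mul_sum, hx, mul_zero]⟩)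
        (by
          rintro _ a ⟨x, rfl, hx⟩
          exact ⟨fun i => x i * a, rfl, fun q => by
            have := hx (a * q)
            simpa only [mul_assoc] using this⟩)
      have h1 : (1 : Q) ∈ I := by
        refine IsSimpleRing.one_mem_of_ne_zero_mem I hne ?_
        rw [TwoSidedIdeal.mem_mk']
        exact ⟨x, rfl, hx⟩
      rw [TwoSidedIdeal.mem_mk'] at h1
      obtain ⟨y, hy1, hy⟩ := h1
      have hcomm : ∀ c, ∀ i ∈ insert j t, c * y i = y i * c := by
        intro c
        have h2 : ∀ q, ∑ i ∈ insert j t, (c * y i - y i * c) * (q * b i) = 0 := by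
          intro q
          have e1 := hy (c * q)
          have e2 := congrArg (c * ·) (hy q)
          simp only [Finset.mul_sum, mul_zero] at e2
          simp only [sub_mul, Finset.sum_sub_distrib]
          rw [sub_eq_zero]
          simp only [mul_assoc] at e1 e2 ⊢
          rw [e1, e2]
        have h3 := ih (fun i => c * y i - y i * c) (fun q => by
          have := h2 q
          rwa [Finset.sum_insert hj, hy1, mul_one, one_mul, sub_self, zero_mul, zero_add] at this)
        intro i hi
        rcases Finset.mem_insert.1 hi with rfl | hi
        · simp [hy1]
        · exact sub_eq_zero.1 (h3 i hi)
      choose l hl using fun i : {i // i ∈ insert j t} => hc (y i) (fun c => hcomm c i i.2)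
      have h4 := hy 1
      rw [← Finset.sum_attach] at h4
      simp only [one_mul] at h4
      have h5 : ∑ i ∈ insert j t, (fun i => if h : i ∈ insert j t then l ⟨i, h⟩ else 0) i • b i = 0 := by
        rw [← Finset.sum_attach, ← h4]
        refine Finset.sum_congr rfl fun i _ => ?_
        rw [Algebra.smul_def]
        simp [← hl]
      have h6 := linearIndependent_iff'.1 hb _ _ h5 j (Finset.mem_insert_self _ _)
      simp only [Finset.mem_insert_self, dite_true] at h6
      have h7 := hl ⟨j, Finset.mem_insert_self _ _⟩
      rw [h6, map_zero, hy1] at h7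
      exact zero_ne_one h7
    intro i hi
    rcases Finset.mem_insert.1 hi with rfl | hi
    · exact key
    · refine ih x (fun q => ?_) i hi
      have := hx q
      rwa [Finset.sum_insert hj, key, zero_mul, zero_add] at this

lemma sandwich_injective
    (hc : ∀ x : Q, (∀ y, y * x = x * y) → ∃ l : L, algebraMap L Q l = x) :
    Function.Injective (sandwich L Q) := by
  rw [injective_iff_map_eq_zero]
  intro e he
  let b := Module.Free.chooseBasis L Q
  obtain ⟨x, rfl⟩ := TensorProduct.eq_repr_basis_right b e
  have h : ∀ q, ∑ i ∈ x.support, x i * (q * b i) = 0 := by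
    intro q
    have := congrArg (fun f => f q) he
    simpa [Finsupp.sum, LinearMap.sum_apply] using this
  refine Finset.sum_eq_zero fun i hi => ?_
  have := coeff_eq_zero_of_sandwich hc b b.linearIndependent _ x h i hi
  simp only [this, TensorProduct.zero_tmul]

/-- By a dimension count `sandwich` is bijective onto the L-endomorphisms of Q, so a separability
element may be given as an endomorphism: take an L-linear retraction Q → L ⊆ Q. Its value at 1 is
the product condition, and the commutation condition holds because its values are scalars. -/
lemma exists_isSepElem_of_central [Module.Finite L Q]
    (hc : ∀ x : Q, (∀ y, y * x = x * y) → ∃ l : L, algebraMap L Q l = x) :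
    ∃ e : Q ⊗[L] Q, IsSepElem L e := by
  have hinj := sandwich_injective hc
  have hsurj : Function.Surjective (sandwich L Q) := by
    rw [← LinearMap.injective_iff_surjective_of_finrank_eq_finrank]
    · exact hinj
    · rw [Module.finrank_tensorProduct, Module.finrank_linearMap]
  obtain ⟨φ, hφ⟩ := LinearMap.exists_leftInverse_of_injective (Algebra.linearMap L Q)
    (LinearMap.ker_eq_bot.2 (algebraMap L Q).injective)
  obtain ⟨e, he⟩ := hsurj (Algebra.linearMap L Q ∘ₗ φ)
  have hφ1 : φ 1 = 1 := by
    have := LinearMap.congr_fun hφ 1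
    simpa using this
  refine ⟨e, ?_, fun a => hinj ?_⟩
  · have : LinearMap.mul' L Q e = sandwich L Q e 1 := by
      clear he
      induction e with
      | zero => simp
      | tmul x y => simp
      | add x y hx hy => simp [hx, hy]
    rw [this, he]
    simp [hφ1]
  · have h1 : ∀ (e : Q ⊗[L] Q) q, sandwich L Q ((LinearMap.mulLeft L a).rTensor Q e) q
        = a * sandwich L Q e q := by
      intro e q
      induction e with
      | zero => simp
      | tmul x y => simp [mul_assoc]
      | add x y hx hy => simp [hx, hy, mul_add]
    have h2 : ∀ (e : Q ⊗[L] Q) q, sandwich L Q ((LinearMap.mulRight L a).lTensor Q e) q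
        = sandwich L Q e q * a := by
      intro e q
      induction e with
      | zero => simp
      | tmul x y => simp [mul_assoc]
      | add x y hx hy => simp [hx, hy, add_mul]
    ext q
    rw [h1, h2, he]
    simp [Algebra.commutes]

end Separability

/-! ### Separability over a perfect field, by transitivity through the centre -/

section Transitivity

variable {k L Q : Type*} [Field k] [Field L] [Algebra k L] [Ring Q] [Algebra k Q] [Algebra L Q]
  [IsScalarTower k L Q]

/-- The map `l ⊗ m ↦ u l ⊗ m v`. -/
def insertMap (k L : Type*) {Q : Type*} [Field k] [Field L] [Algebra k L] [Ring Q] [Algebra k Q]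
    [Algebra L Q] [IsScalarTower k L Q] (u v : Q) : L ⊗[k] L →ₗ[k] Q ⊗[k] Q :=
  TensorProduct.map (LinearMap.mulLeft k u ∘ₗ (IsScalarTower.toAlgHom k L Q).toLinearMap)
    (LinearMap.mulRight k v ∘ₗ (IsScalarTower.toAlgHom k L Q).toLinearMap)

@[simp] lemma insertMap_tmul (u v : Q) (l m : L) :
    insertMap k L u v (l ⊗ₜ m) = (u * algebraMap L Q l) ⊗ₜ (algebraMap L Q m * v) := by
  simp [insertMap]

lemma insertMap_add_left (u u' v : Q) (e : L ⊗[k] L) :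
    insertMap k L (u + u') v e = insertMap k L u v e + insertMap k L u' v e := by
  induction e with
  | zero => simp
  | tmul x y => simp [add_mul, TensorProduct.add_tmul]
  | add x y hx hy => simp only [map_add, hx, hy]; abel

lemma insertMap_add_right (u v v' : Q) (e : L ⊗[k] L) :
    insertMap k L u (v + v') e = insertMap k L u v e + insertMap k L u v' e := by
  induction e with
  | zero => simp
  | tmul x y => simp [mul_add, TensorProduct.tmul_add]
  | add x y hx hy => simp only [map_add, hx, hy]; abel

/-- The relation `he` on the tensor over k is what makes the insertion balanced over L, so that it
descends to Q ⊗[L] Q. -/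
lemma insertMap_smul (u v : Q) (r : L) {e : L ⊗[k] L}
    (he : (1 ⊗ₜ r) * e = (r ⊗ₜ 1) * e) :
    insertMap k L (r • u) v e = insertMap k L u (r • v) e := by
  have h1 : ∀ e : L ⊗[k] L, insertMap k L (r • u) v e = insertMap k L u v ((r ⊗ₜ 1) * e) := by
    intro e
    induction e with
    | zero => simp
    | tmul x y => simp [Algebra.smul_def, ← mul_assoc, Algebra.commutes r u]
    | add x y hx hy => simp only [map_add, mul_add, hx, hy]
  have h2 : ∀ e : L ⊗[k] L, insertMap k L u (r • v) e = insertMap k L u v ((1 ⊗ₜ r) * e) := by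
    intro e
    induction e with
    | zero => simp
    | tmul x y =>
      simp [Algebra.smul_def, ← mul_assoc, ← map_mul, mul_comm r y]
    | add x y hx hy => simp only [map_add, mul_add, hx, hy]
  rw [h1, h2, he]

/-- With z = Σ l ⊗ m the canonical element of the unramified extension L/k, send u ⊗ v over L to Σ u
l ⊗ m v over k. Multiplication only sees the product of z, which is 1, and the outer factors carry
the commutation relation over from `d`. -/
lemma exists_isSepElem_trans [Algebra.FormallyUnramified k L] [Algebra.EssFiniteType k L]
    {d : Q ⊗[L] Q} (hd : IsSepElem L d) : ∃ e : Q ⊗[k] Q, IsSepElem k e := by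
  let z := Algebra.FormallyUnramified.elem k L
  let ι : Q ⊗[L] Q →+ Q ⊗[k] Q := TensorProduct.liftAddHom
    (AddMonoidHom.mk' (fun u => AddMonoidHom.mk' (fun v => insertMap k L u v z)
      (fun v v' => insertMap_add_right u v v' z))
      (fun u u' => by ext v; exact insertMap_add_left u u' v z))
    (fun r u v => insertMap_smul u v r (Algebra.FormallyUnramified.one_tmul_mul_elem r))
  have hι : ∀ u v, ι (u ⊗ₜ v) = insertMap k L u v z := fun u v => rfl
  have hmul : ∀ (u v : Q) (z : L ⊗[k] L), LinearMap.mul' k Q (insertMap k L u v z)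
      = u * algebraMap L Q (Algebra.TensorProduct.lmul' k z) * v := by
    intro u v z
    induction z with
    | zero => simp
    | tmul x y => simp [mul_assoc]
    | add x y hx hy => simp only [map_add, hx, hy, mul_add, add_mul]
  refine ⟨ι d, ?_, fun a => ?_⟩
  · rw [← hd.1]
    clear hd
    induction d with
    | zero => simp
    | tmul x y =>
      rw [hι, hmul, Algebra.FormallyUnramified.lmul_elem]
      simp
    | add x y hx hy => simp only [map_add, hx, hy]
  · have h1 : ∀ d, (LinearMap.mulLeft k a).rTensor Q (ι d)
        = ι ((LinearMap.mulLeft L a).rTensor Q d) := by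
      intro d
      induction d with
      | zero => simp
      | tmul x y =>
        rw [hι, LinearMap.rTensor_tmul, hι]
        induction z with
        | zero => simp
        | tmul x y => simp [mul_assoc]
        | add x y hx hy => simp only [map_add, hx, hy]
      | add x y hx hy => simp only [map_add, hx, hy]
    have h2 : ∀ d, (LinearMap.mulRight k a).lTensor Q (ι d)
        = ι ((LinearMap.mulRight L a).lTensor Q d) := by
      intro d
      induction d with
      | zero => simp
      | tmul x y =>
        rw [hι, LinearMap.lTensor_tmul, hι]
        induction z with
        | zero => simp
        | tmul x y => simp [mul_assoc]
        | add x y hx hy => simp only [map_add, hx, hy]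
      | add x y hx hy => simp only [map_add, hx, hy]
    rw [h1, h2, hd.2]

/-- The center of a simple algebra, as a field in its own right. -/
def CenterField (k Q : Type*) [Field k] [Ring Q] [Algebra k Q] : Type _ := Subalgebra.center k Q

namespace CenterField

variable (k Q : Type*) [Field k] [Ring Q] [Algebra k Q]

instance : CommRing (CenterField k Q) := inferInstanceAs (CommRing (Subalgebra.center k Q))

instance : Algebra k (CenterField k Q) := inferInstanceAs (Algebra k (Subalgebra.center k Q))

instance [IsSimpleRing Q] : Field (CenterField k Q) :=
  IsField.toField (R := CenterField k Q) (IsSimpleRing.isField_center Q)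

instance [IsSimpleRing Q] : Algebra (CenterField k Q) Q :=
  RingHom.toAlgebra' (Subalgebra.center k Q).val.toRingHom
    fun z y => (Subalgebra.mem_center_iff.1 z.2 y).symm

instance [IsSimpleRing Q] : IsScalarTower k (CenterField k Q) Q :=
  IsScalarTower.of_algebraMap_eq fun _ => rfl

end CenterField

/-- The centre is a finite extension of a perfect field, hence separable and formally unramified,
and Q is central over it. -/
lemma exists_isSepElem_of_isSimpleRing (k Q : Type*) [Field k] [PerfectField k] [Ring Q]
    [Algebra k Q] [Module.Finite k Q] [IsSimpleRing Q] : ∃ e : Q ⊗[k] Q, IsSepElem k e := by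
  have : Module.Finite (CenterField k Q) Q := Module.Finite.of_restrictScalars_finite k _ _
  have : Module.Finite k (CenterField k Q) :=
    Module.Finite.of_injective (IsScalarTower.toAlgHom k (CenterField k Q) Q).toLinearMap
      (algebraMap (CenterField k Q) Q).injective
  obtain ⟨d, hd⟩ := exists_isSepElem_of_central (L := CenterField k Q) (Q := Q)
    (fun x hx => ⟨⟨x, Subalgebra.mem_center_iff.2 hx⟩, rfl⟩)
  have : Algebra.FormallyUnramified k (CenterField k Q) :=
    Algebra.FormallyUnramified.of_isSeparable k _
  exact exists_isSepElem_trans hd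

lemma exists_isSepElem_pi {k : Type*} [Field k] {ι : Type*} [Fintype ι] [DecidableEq ι]
    {Q : ι → Type*} [∀ i, Ring (Q i)] [∀ i, Algebra k (Q i)]
    (h : ∀ i, ∃ e : Q i ⊗[k] Q i, IsSepElem k e) :
    ∃ e : (∀ i, Q i) ⊗[k] (∀ i, Q i), IsSepElem k e := by
  choose e he using h
  let s (i : ι) := LinearMap.single k Q i
  have hmul : ∀ i (e : Q i ⊗[k] Q i), LinearMap.mul' k (∀ i, Q i) (TensorProduct.map (s i) (s i) e)
      = s i (LinearMap.mul' k (Q i) e) := by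
    intro i e
    induction e with
    | zero => simp
    | tmul x y => simp [s, Pi.single_mul]
    | add x y hx hy => simp only [map_add, hx, hy]
  have h1 : ∀ i (a : ∀ i, Q i) (e : Q i ⊗[k] Q i),
      (LinearMap.mulLeft k a).rTensor _ (TensorProduct.map (s i) (s i) e)
        = TensorProduct.map (s i) (s i) ((LinearMap.mulLeft k (a i)).rTensor _ e) := by
    intro i a e
    induction e with
    | zero => simp
    | tmul x y =>
      have : a * Pi.single i x = Pi.single i (a i * x) := by
        ext j
        by_cases hj : j = i
        · subst hj; simp
        · simp [hj]
      simp [s, this]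
    | add x y hx hy => simp only [map_add, hx, hy]
  have h2 : ∀ i (a : ∀ i, Q i) (e : Q i ⊗[k] Q i),
      (LinearMap.mulRight k a).lTensor _ (TensorProduct.map (s i) (s i) e)
        = TensorProduct.map (s i) (s i) ((LinearMap.mulRight k (a i)).lTensor _ e) := by
    intro i a e
    induction e with
    | zero => simp
    | tmul x y =>
      have : Pi.single i y * a = Pi.single i (y * a i) := by
        ext j
        by_cases hj : j = i
        · subst hj; simp
        · simp [hj]
      simp [s, this]
    | add x y hx hy => simp only [map_add, hx, hy]
  refine ⟨∑ i, TensorProduct.map (s i) (s i) (e i), ?_, fun a => ?_⟩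
  · rw [map_sum]
    simp only [hmul, (he _).1]
    exact Finset.univ_sum_single (1 : ∀ i, Q i)
  · simp only [map_sum, h1, h2, (he _).2]

lemma exists_isSepElem_of_algEquiv {k P Q : Type*} [Field k] [Ring P] [Algebra k P] [Ring Q]
    [Algebra k Q] (f : P ≃ₐ[k] Q) {e : P ⊗[k] P} (he : IsSepElem k e) :
    ∃ e : Q ⊗[k] Q, IsSepElem k e := by
  let F := TensorProduct.map f.toLinearMap f.toLinearMap
  refine ⟨F e, ?_, fun a => ?_⟩
  · have : ∀ e, LinearMap.mul' k Q (F e) = f (LinearMap.mul' k P e) := by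
      intro e
      induction e with
      | zero => simp
      | tmul x y => simp [F]
      | add x y hx hy => simp only [map_add, hx, hy]
    rw [this, he.1, map_one]
  · obtain ⟨a, rfl⟩ := f.surjective a
    have h1 : ∀ e, (LinearMap.mulLeft k (f a)).rTensor Q (F e)
        = F ((LinearMap.mulLeft k a).rTensor P e) := by
      intro e
      induction e with
      | zero => simp
      | tmul x y => simp [F]
      | add x y hx hy => simp only [map_add, hx, hy]
    have h2 : ∀ e, (LinearMap.mulRight k (f a)).lTensor Q (F e)
        = F ((LinearMap.mulRight k a).lTensor P e) := by
      intro e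
      induction e with
      | zero => simp
      | tmul x y => simp [F]
      | add x y hx hy => simp only [map_add, hx, hy]
    rw [h1, h2, he.2]

/-- A finite-dimensional semisimple algebra over a perfect field is separable. -/
theorem exists_isSepElem_of_isSemisimpleRing (k Q : Type*) [Field k] [PerfectField k] [Ring Q]
    [Algebra k Q] [Module.Finite k Q] [IsSemisimpleRing Q] : ∃ e : Q ⊗[k] Q, IsSepElem k e := by
  obtain ⟨n, D, d, _, _, _, _, ⟨f⟩⟩ :=
    IsSemisimpleRing.exists_algEquiv_pi_matrix_divisionRing_finite k Q
  obtain ⟨e, he⟩ := exists_isSepElem_pi (k := k) (Q := fun i => Matrix (Fin (d i)) (Fin (d i)) (D i))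
    (fun i => exists_isSepElem_of_isSimpleRing k _)
  exact exists_isSepElem_of_algEquiv f.symm he

end Transitivity

/-! ### Lifting a separable quotient along a nilpotent ideal -/

section WedderburnPrincipal

variable {k R Q : Type*} [Field k] [Ring R] [Algebra k R] [Ring Q] [Algebra k Q]

/-- The map `x ⊗ y ↦ (a ↦ g x (g y g a - g (y a)))`. -/
def defectMap (g : Q →ₗ[k] R) : Q ⊗[k] Q →ₗ[k] (Q →ₗ[k] R) :=
  TensorProduct.lift (LinearMap.mk₂ k
    (fun x y => LinearMap.mulLeft k (g x) ∘ₗ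
      (LinearMap.mulLeft k (g y) ∘ₗ g - g ∘ₗ LinearMap.mulLeft k y))
    (fun _ _ _ => by ext; simp [add_mul]) (fun _ _ _ => by ext; simp)
    (fun _ _ _ => by ext; simp only [map_add, LinearMap.comp_apply, LinearMap.sub_apply,
      LinearMap.mulLeft_apply, LinearMap.add_apply, add_mul]; noncomm_ring)
    (fun _ _ _ => by ext; simp [← smul_sub]))

@[simp] lemma defectMap_tmul (g : Q →ₗ[k] R) (x y a : Q) :
    defectMap g (x ⊗ₜ y) a = g x * (g y * g a - g (y * a)) := by
  simp [defectMap]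

/-- Modulo J^(m+1) the defect g a * g b - g (a * b) is a Hochschild 2-cocycle, and `defectMap g e`
is the 1-cochain obtained by contracting it with the separability element. Its coboundary is the
defect again, so g - `defectMap g e` is multiplicative to one order more. The quadratic term of the
correction is negligible because m ≥ 1. -/
lemma exists_section_mul_mem_pow_succ {J : Ideal R} [J.IsTwoSided] {p : R →ₐ[k] Q}
    (hp : RingHom.ker p = J) {e : Q ⊗[k] Q} (he : IsSepElem k e) {m : ℕ} (hm : 1 ≤ m)
    {g : Q →ₗ[k] R} (hg : ∀ q, p (g q) = q) (hmul : ∀ a b, g a * g b - g (a * b) ∈ J ^ m) :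
    ∃ g' : Q →ₗ[k] R, (∀ q, p (g' q) = q) ∧ ∀ a b, g' a * g' b - g' (a * b) ∈ J ^ (m + 1) := by
  have hJ : ∀ x, x ∈ J ↔ p x = 0 := fun x => by rw [← hp]; rfl
  have hle : J ^ m ≤ J := by
    simpa [Submodule.pow_one] using Ideal.pow_le_pow_right (I := J) hm
  have hmj : ∀ x ∈ J ^ m, ∀ y ∈ J, x * y ∈ J ^ (m + 1) := fun x hx y hy => by
    rw [Submodule.pow_succ]; exact Ideal.mul_mem_mul hx hy
  have hjm : ∀ x ∈ J, ∀ y ∈ J ^ m, x * y ∈ J ^ (m + 1) := fun x hx y hy => by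
    rw [Ideal.IsTwoSided.pow_succ]; exact Ideal.mul_mem_mul hx hy
  have hFm : ∀ t a, defectMap g t a ∈ J ^ m := by
    intro t a
    induction t with
    | zero => simp
    | tmul x y => simpa using Ideal.mul_mem_left _ _ (hmul y a)
    | add x y hx hy => simpa using add_mem hx hy
  -- The coboundary formula for an arbitrary tensor t; the error is a sum of products of a defect in
  -- J with a defect in J^m. For t = e the terms with a moved to the left and to the right cancel,
  -- and g 1 ≡ 1 leaves the defect.
  have key : ∀ t a b, (g a * defectMap g t b - defectMap g t (a * b) + defectMap g t a * g b)
      - (defectMap g ((LinearMap.mulLeft k a).rTensor Q t) b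
        + g (LinearMap.mul' k Q t) * (g a * g b - g (a * b))
        - defectMap g ((LinearMap.mulRight k a).lTensor Q t) b) ∈ J ^ (m + 1) := by
    intro t a b
    induction t with
    | zero => simp
    | tmul x y =>
      have h1 := hjm _ (hle (hmul a x)) _ (hmul y b)
      have h2 := hjm _ (hle (hmul x y)) _ (hmul a b)
      have h3 := add_mem h1 h2
      simp only [defectMap_tmul, LinearMap.rTensor_tmul, LinearMap.lTensor_tmul,
        LinearMap.mul'_apply, LinearMap.mulLeft_apply, LinearMap.mulRight_apply]
      convert h3 using 1
      rw [mul_assoc y a b]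
      noncomm_ring
    | add x y hx hy =>
      have := add_mem hx hy
      simp only [map_add, LinearMap.add_apply]
      convert this using 1
      noncomm_ring
  have hg1 : g 1 - 1 ∈ J := by rw [hJ]; simp [hg]
  refine ⟨g - defectMap g e, fun q => ?_, fun a b => ?_⟩
  · have := (hJ _).1 (hle (hFm e q))
    simp [hg, this]
  · have h1 := key e a b
    rw [he.1, he.2 a] at h1
    have h2 := hjm _ hg1 _ (hmul a b)
    have h3 := hmj _ (hFm e a) _ (hle (hFm e b))
    have := sub_mem (sub_mem h3 h1) h2
    simp only [LinearMap.sub_apply]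
    convert this using 1
    noncomm_ring

/-- A surjection with nilpotent kernel onto a separable algebra splits. -/
theorem exists_algHom_section {J : Ideal R} [J.IsTwoSided] {p : R →ₐ[k] Q}
    (hs : Function.Surjective p) (hp : RingHom.ker p = J) (hJn : IsNilpotent J)
    {e : Q ⊗[k] Q} (he : IsSepElem k e) : ∃ g : Q →ₐ[k] R, ∀ q, p (g q) = q := by
  have hJ : ∀ x, x ∈ J ↔ p x = 0 := fun x => by rw [← hp]; rfl
  have h : ∀ m : ℕ, ∃ g : Q →ₗ[k] R, (∀ q, p (g q) = q) ∧
      ∀ a b, g a * g b - g (a * b) ∈ J ^ (m + 1) := by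
    intro m
    induction m with
    | zero =>
      obtain ⟨g, hg⟩ := LinearMap.exists_rightInverse_of_surjective p.toLinearMap
        (LinearMap.range_eq_top.2 hs)
      have hg' : ∀ q, p (g q) = q := fun q => LinearMap.congr_fun hg q
      refine ⟨g, hg', fun a b => ?_⟩
      rw [zero_add, Submodule.pow_one, hJ]
      simp [hg']
    | succ m ih =>
      obtain ⟨g, hg, hmul⟩ := ih
      exact exists_section_mul_mem_pow_succ hp he (Nat.le_add_left 1 m) hg hmul
  obtain ⟨n, hn⟩ := hJn
  obtain ⟨g, hg, hmul⟩ := h n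
  have hmul' : ∀ a b, g (a * b) = g a * g b := by
    intro a b
    have := hmul a b
    rw [Submodule.pow_succ, hn, Ideal.zero_eq_bot, Ideal.bot_mul, Ideal.mem_bot, sub_eq_zero] at this
    exact this.symm
  -- Unitality is automatic: 1 - g 1 is an idempotent in a nilpotent ideal.
  have h1 : g 1 = 1 := by
    have hid : IsIdempotentElem (1 - g 1) :=
      IsIdempotentElem.one_sub (by rw [IsIdempotentElem, ← hmul', one_mul])
    have hmem : 1 - g 1 ∈ J := by rw [hJ]; simp [hg]
    have hpow := Ideal.pow_mem_pow hmem (n + 1)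
    rw [hid.pow_succ_eq, Submodule.pow_succ, hn, Ideal.zero_eq_bot, Ideal.bot_mul, Ideal.mem_bot,
      sub_eq_zero] at hpow
    exact hpow.symm
  exact ⟨AlgHom.ofLinearMap g h1 hmul', hg⟩

end WedderburnPrincipal

/-- Wedderburn's principal theorem over a perfect field. -/
theorem exists_isWedderburnComplement (k : Type v) (R : Type u) [Field k] [PerfectField k] [Ring R]
    [Algebra k R] [Module.Finite k R] : ∃ S : Subalgebra k R, IsWedderburnComplement S := by
  have : IsArtinianRing R := IsArtinianRing.of_finite k R
  let p : R →ₐ[k] R ⧸ Ring.jacobson R := Ideal.Quotient.mkₐ k _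
  have hs : Function.Surjective p := Ideal.Quotient.mkₐ_surjective k _
  have hp : RingHom.ker p = Ring.jacobson R := Ideal.Quotient.mkₐ_ker k _
  have : Module.Finite k (R ⧸ Ring.jacobson R) := Module.Finite.of_surjective p.toLinearMap hs
  have : IsSemisimpleRing (R ⧸ Ring.jacobson R) := IsSemiprimaryRing.isSemisimpleRing
  obtain ⟨e, he⟩ := exists_isSepElem_of_isSemisimpleRing k (R ⧸ Ring.jacobson R)
  obtain ⟨g, hg⟩ := exists_algHom_section hs hp IsSemiprimaryRing.isNilpotent he
  refine ⟨g.range, ⟨?_, ?_⟩⟩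
  · exact (AlgEquiv.ofInjective g (Function.LeftInverse.injective hg)).toRingEquiv.isSemisimpleRing
  · have hmem : ∀ x, x ∈ Ring.jacobson R ↔ p x = 0 := fun x =>
      ⟨fun h => (Ideal.ext_iff.1 hp x).2 h, fun h => (Ideal.ext_iff.1 hp x).1 h⟩
    constructor
    · rw [Submodule.disjoint_def]
      rintro x ⟨q, rfl⟩ hx
      have := (hmem _).1 hx
      have h2 : p (g q) = q := hg q
      have h3 : q = 0 := by rw [← h2]; exact this
      change g q = 0
      rw [h3, map_zero]
    · rw [codisjoint_iff, eq_top_iff]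
      intro x _
      refine Submodule.mem_sup.2 ⟨g (p x), ⟨p x, rfl⟩, x - g (p x), (hmem _).2 ?_, by abel⟩
      rw [map_sub, hg, sub_self]

/-! ### Blocks of a semisimple ring -/

section Blocks

/-- The block decomposition of a semisimple ring `S`: the `c x` are its centrally primitive
idempotents, and `f x` is a primitive idempotent below `c x`. -/
structure BlockData {S : Type*} [Ring S] {X : Type*} (c f : X → S) : Prop where
  idem_c : ∀ x, IsIdempotentElem (c x)
  central : ∀ x s, c x * s = s * c x
  idem : ∀ x, IsIdempotentElem (f x)
  f_mul_c : ∀ x, f x * c x = f x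
  f_ne_zero : ∀ x, f x ≠ 0
  full : ∀ x, c x ∈ AddSubmonoid.closure {s | ∃ a b, s = a * f x * b}
  division : ∀ x s, f x * s * f x ≠ 0 → ∃ t, (f x * t * f x) * (f x * s * f x) = f x ∧
    (f x * s * f x) * (f x * t * f x) = f x

namespace BlockData

variable {S : Type*} [Ring S] {X : Type*} {c f : X → S} (h : BlockData c f)
include h

lemma c_mul_f (x : X) : c x * f x = f x := by rw [h.central, h.f_mul_c]

lemma c_ne_zero (x : X) : c x ≠ 0 := fun h0 => h.f_ne_zero x (by rw [← h.f_mul_c, h0, mul_zero])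

lemma exists_f_mul_ne_zero {x : X} {s : S} (hs : c x * s ≠ 0) : ∃ b, f x * b * s ≠ 0 := by
  by_contra! hb
  apply hs
  have : ∀ t ∈ AddSubmonoid.closure {s | ∃ a b, s = a * f x * b}, t * s = 0 := by
    intro t ht
    induction ht using AddSubmonoid.closure_induction with
    | mem t ht =>
      obtain ⟨a, b, rfl⟩ := ht
      rw [mul_assoc, mul_assoc, ← mul_assoc (f x), hb, mul_zero]
    | zero => rw [zero_mul]
    | add _ _ _ _ h1 h2 => rw [add_mul, h1, h2, add_zero]
  exact this _ (h.full x)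

lemma exists_mul_f_ne_zero {x : X} {s : S} (hs : s * c x ≠ 0) : ∃ b, s * b * f x ≠ 0 := by
  by_contra! hb
  apply hs
  have : ∀ t ∈ AddSubmonoid.closure {s | ∃ a b, s = a * f x * b}, s * t = 0 := by
    intro t ht
    induction ht using AddSubmonoid.closure_induction with
    | mem t ht =>
      obtain ⟨a, b, rfl⟩ := ht
      rw [← mul_assoc, ← mul_assoc, hb, zero_mul]
    | zero => rw [mul_zero]
    | add _ _ _ _ h1 h2 => rw [mul_add, h1, h2, add_zero]
  exact this _ (h.full x)

/-- Multiplying s on both sides yields a nonzero element of the corner f x S f x, which is a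
division ring, and there it can be inverted. -/
lemma exists_f_eq_mul {x : X} {s : S} (hs : c x * s ≠ 0) : ∃ a b, f x = a * s * b := by
  obtain ⟨a, ha⟩ := h.exists_f_mul_ne_zero hs
  have h1 : (f x * a * s) * c x ≠ 0 := by
    rwa [← h.central, ← mul_assoc, ← mul_assoc, h.c_mul_f]
  obtain ⟨b, hb⟩ := h.exists_mul_f_ne_zero h1
  obtain ⟨t, ht, -⟩ := h.division x (a * s * b) (by simpa only [mul_assoc] using hb)
  exact ⟨f x * t * f x * f x * a, b * f x, ht.symm.trans (by simp only [mul_assoc])⟩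

/-- The ideal generated by an element with a nonzero component in a block contains the block. -/
lemma c_mem_closure {x : X} {s : S} (hs : c x * s ≠ 0) :
    c x ∈ AddSubmonoid.closure {t | ∃ a b, t = a * s * b} := by
  obtain ⟨p, q, hpq⟩ := h.exists_f_eq_mul hs
  refine AddSubmonoid.closure_mono ?_ (h.full x)
  rintro _ ⟨a, b, rfl⟩
  exact ⟨a * p, q * b, by rw [hpq]; simp only [mul_assoc]⟩

lemma comp {Y : Type*} (g : Y → X) : BlockData (c ∘ g) (f ∘ g) where
  idem_c _ := h.idem_c _
  central _ := h.central _
  idem _ := h.idem _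
  f_mul_c _ := h.f_mul_c _
  f_ne_zero _ := h.f_ne_zero _
  full _ := h.full _
  division _ := h.division _

lemma map {S' : Type*} [Ring S'] (e : S ≃+* S') : BlockData (e ∘ c) (e ∘ f) where
  idem_c x := (h.idem_c x).map e
  central x s := by
    obtain ⟨s, rfl⟩ := e.surjective s
    simp only [Function.comp_apply, ← map_mul, h.central]
  idem x := (h.idem x).map e
  f_mul_c x := by simp only [Function.comp_apply, ← map_mul, h.f_mul_c]
  f_ne_zero x := by simpa using h.f_ne_zero x
  full x := by
    have : e (c x) ∈ (AddSubmonoid.closure {s | ∃ a b, s = a * f x * b}).map (e : S →+ S') :=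
      ⟨_, h.full x, rfl⟩
    rw [AddMonoidHom.map_mclosure] at this
    refine AddSubmonoid.closure_mono ?_ this
    rintro _ ⟨_, ⟨a, b, rfl⟩, rfl⟩
    exact ⟨e a, e b, by simp⟩
  division x s hs := by
    obtain ⟨s, rfl⟩ := e.surjective s
    obtain ⟨t, ht⟩ := h.division x s (fun h0 => hs (by
      simp only [Function.comp_apply, ← map_mul, h0, map_zero]))
    exact ⟨e t, by simp only [Function.comp_apply, ← map_mul, ht, and_self]⟩

end BlockData

/-- The primitive idempotent of a block is the matrix unit E_00, whose corner is the division ring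
of entries; fullness is 1 = Σ E_k0 E_00 E_0k. -/
lemma blockData_pi_matrix {n : ℕ} {D : Fin n → Type*} [∀ i, DivisionRing (D i)] {d : Fin n → ℕ}
    [∀ i, NeZero (d i)] :
    BlockData (S := ∀ i, Matrix (Fin (d i)) (Fin (d i)) (D i)) (fun i => Pi.single i 1)
      (fun i => Pi.single i (Matrix.single 0 0 1)) where
  idem_c i := by rw [IsIdempotentElem, ← Pi.single_mul, one_mul]
  central i s := by
    ext1 j
    by_cases hj : j = i
    · subst hj; simp
    · simp [hj]
  idem i := by rw [IsIdempotentElem, ← Pi.single_mul]; simp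
  f_mul_c i := by rw [← Pi.single_mul, mul_one]
  f_ne_zero i h := by
    have := congrArg (fun m => m i 0 0) h
    simp at this
  full i := by
    have : (1 : Matrix (Fin (d i)) (Fin (d i)) (D i)) = ∑ k, Matrix.single k k 1 := by
      ext a b
      rcases eq_or_ne a b with rfl | hab
      · simp [Matrix.sum_apply, Matrix.single_apply]
      · simp only [Matrix.sum_apply, Matrix.single_apply, Matrix.one_apply, if_neg hab]
        exact (Finset.sum_eq_zero fun x _ => if_neg fun h => hab (h.1.symm.trans h.2)).symm
    rw [this]
    change AddMonoidHom.single (fun i => Matrix (Fin (d i)) (Fin (d i)) (D i)) i _ ∈ _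
    rw [map_sum]
    refine sum_mem fun k _ => AddSubmonoid.subset_closure
      ⟨Pi.single i (Matrix.single k 0 1), Pi.single i (Matrix.single 0 k 1), ?_⟩
    simp [← Pi.single_mul]
  division i s hs := by
    have h1 : ∀ s : ∀ i, Matrix (Fin (d i)) (Fin (d i)) (D i),
        (Pi.single i (Matrix.single 0 0 1) * s * Pi.single i (Matrix.single 0 0 1) :
        ∀ i, Matrix (Fin (d i)) (Fin (d i)) (D i)) = Pi.single i (Matrix.single 0 0 (s i 0 0)) := by
      intro s
      ext1 j
      by_cases hj : j = i
      · subst hj; simp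
      · simp [hj]
    have h2 : s i 0 0 ≠ 0 := by
      intro h0
      rw [h1, h0] at hs
      simp at hs
    refine ⟨Pi.single i (Matrix.single 0 0 (s i 0 0)⁻¹), ?_⟩
    rw [h1, h1]
    simp [← Pi.single_mul, h2]

lemma exists_blockData (S : Type*) [Ring S] [IsSemisimpleRing S] :
    ∃ (n : ℕ) (c f : Fin n → S), BlockData c f ∧ CompleteOrthogonalIdempotents c := by
  obtain ⟨n, D, d, _, _, _, ⟨e⟩⟩ := IsSemisimpleRing.exists_algEquiv_pi_matrix_divisionRing ℕ S
  refine ⟨n, _, _, (blockData_pi_matrix (D := D) (d := d)).map e.symm.toRingEquiv, ?_⟩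
  exact (CompleteOrthogonalIdempotents.single _).map e.symm.toRingEquiv.toRingHom

end Blocks

/-! ### Simple modules detected by local idempotents -/

section SimpleModules

/-- If a kills e • v but not e • w, simplicity gives b with (b a) e • w = e • w. Then e (b a) e
fixes e • w, so it is not in N and is left invertible modulo N; applying the inverse relation to v
gives e • v = 0. -/
lemma ker_toSpanSingleton_le {A : Type*} [Ring A] {X Y : Type*} [AddCommGroup X]
    [Module A X] [AddCommGroup Y] [Module A Y] [IsSimpleModule A Y]
    {N : Set A} (hX : ∀ a ∈ N, ∀ v : X, a • v = 0) (hY : ∀ a ∈ N, ∀ v : Y, a • v = 0)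
    {e : A} (he : IsIdempotentElem e)
    (hloc : ∀ a, e * a * e ∈ N ∨ ∃ b, b * (e * a * e) - e ∈ N)
    {v : X} (hv : e • v ≠ 0) {w : Y} (hw : e • w ≠ 0) :
    LinearMap.ker (LinearMap.toSpanSingleton A X (e • v)) ≤
        LinearMap.ker (LinearMap.toSpanSingleton A Y (e • w)) := by
  intro a ha
  rw [LinearMap.mem_ker, LinearMap.toSpanSingleton_apply] at ha ⊢
  by_contra hne
  obtain ⟨b, hb⟩ := IsSimpleModule.toSpanSingleton_surjective A hne (e • w)
  rw [LinearMap.toSpanSingleton_apply] at hb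
  have h1 : (e * (b * a) * e) • w = e • w := by
    have : e • e • w = e • w := by rw [smul_smul, he]
    rw [mul_smul, mul_smul, mul_smul, hb, this]
  rcases hloc (b * a) with h2 | ⟨d, hd⟩
  · exact hw (by rw [← h1, hY _ h2])
  · have h3 := hX _ hd v
    rw [sub_smul, sub_eq_zero] at h3
    apply hv
    rw [← h3]
    simp only [mul_smul, ha, smul_zero]

/-- Two simple modules on which an idempotent that is primitive modulo a radical acts nontrivially
are isomorphic. -/
lemma nonempty_linearEquiv_of_smul_ne_zero {A : Type*} [Ring A] {X Y : Type*} [AddCommGroup X]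
    [Module A X] [AddCommGroup Y] [Module A Y] [IsSimpleModule A X] [IsSimpleModule A Y]
    {N : Set A} (hX : ∀ a ∈ N, ∀ v : X, a • v = 0) (hY : ∀ a ∈ N, ∀ v : Y, a • v = 0)
    {e : A} (he : IsIdempotentElem e)
    (hloc : ∀ a, e * a * e ∈ N ∨ ∃ b, b * (e * a * e) - e ∈ N)
    {v : X} (hv : e • v ≠ 0) {w : Y} (hw : e • w ≠ 0) : Nonempty (X ≃ₗ[A] Y) := by
  have hker := le_antisymm (ker_toSpanSingleton_le hX hY he hloc hv hw)
    (ker_toSpanSingleton_le hY hX he hloc hw hv)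
  exact ⟨(LinearMap.quotKerEquivOfSurjective _
      (IsSimpleModule.toSpanSingleton_surjective A hv)).symm ≪≫ₗ
    Submodule.quotEquivOfEq _ _ hker ≪≫ₗ LinearMap.quotKerEquivOfSurjective _
      (IsSimpleModule.toSpanSingleton_surjective A hw)⟩

/-- An element generating a nil left ideal annihilates every simple module. -/
lemma smul_eq_zero_of_nil {A : Type*} [Ring A] {X : Type*} [AddCommGroup X] [Module A X]
    [IsSimpleModule A X] {a : A} (ha : ∀ b, IsNilpotent (b * a)) (v : X) : a • v = 0 := by
  by_contra hne
  obtain ⟨b, hb⟩ := IsSimpleModule.toSpanSingleton_surjective A hne v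
  rw [LinearMap.toSpanSingleton_apply] at hb
  have h1 : (1 - b * a) • v = 0 := by rw [sub_smul, one_smul, mul_smul, hb, sub_self]
  have h2 : v = 0 := (IsNilpotent.isUnit_one_sub (ha b)).smul_eq_zero.1 h1
  exact hne (by rw [h2, smul_zero])

end SimpleModules

/-! ### Blocks of the complement and simple right modules -/

section Complement

variable {k : Type v} {R : Type u} [Field k] [Ring R] [Algebra k R]

/-- A splitting of `R` modulo its nilpotent radical by the projection `τ` onto a subalgebra `S`,
with the block decomposition of `S`. -/
structure Splitting (S : Subalgebra k R) (τ : R →+* S) {Λ₀ : Type w} [Fintype Λ₀]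
    (c f : Λ₀ → S) : Prop where
  proj_coe : ∀ s : S, τ s = s
  proj_eq_zero : ∀ r, τ r = 0 ↔ r ∈ Ring.jacobson R
  nilpotent : ∃ n, Ring.jacobson R ^ n = ⊥
  block : BlockData c f
  complete : CompleteOrthogonalIdempotents c

lemma exists_proj (S : Subalgebra k R) (hS : IsWedderburnComplement S) :
    ∃ τ : R →+* S, (∀ s : S, τ s = s) ∧ ∀ r, τ r = 0 ↔ r ∈ Ring.jacobson R := by
  let q : S →+* R ⧸ Ring.jacobson R := (Ideal.Quotient.mk _).comp S.val.toRingHom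
  have hq : Function.Bijective q := by
    constructor
    · rw [injective_iff_map_eq_zero]
      intro s hs
      have h1 : (s : R) ∈ Ring.jacobson R := Ideal.Quotient.eq_zero_iff_mem.1 hs
      have := (Submodule.disjoint_def.1 hS.isCompl.disjoint) s s.2 h1
      exact Subtype.ext this
    · intro x
      obtain ⟨r, rfl⟩ := Ideal.Quotient.mk_surjective x
      have : r ∈ Subalgebra.toSubmodule S ⊔ (Ring.jacobson R).restrictScalars k := by
        rw [hS.isCompl.sup_eq_top]; trivial
      obtain ⟨s, hs, j, hj, rfl⟩ := Submodule.mem_sup.1 this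
      refine ⟨⟨s, hs⟩, ?_⟩
      have hj' : Ideal.Quotient.mk (Ring.jacobson R) j = 0 := Ideal.Quotient.eq_zero_iff_mem.2 hj
      rw [map_add, hj', add_zero]
      rfl
  let e := RingEquiv.ofBijective q hq
  refine ⟨e.symm.toRingHom.comp (Ideal.Quotient.mk _), fun s => e.symm_apply_apply s, fun r => ?_⟩
  rw [← Ideal.Quotient.eq_zero_iff_mem]
  change e.symm _ = 0 ↔ _
  rw [EmbeddingLike.map_eq_zero_iff]

/-- A nilpotent ideal annihilates the simple right modules. -/
lemma op_smul_eq_zero_of_mem_jacobson (hn : ∃ n, Ring.jacobson R ^ n = ⊥) {X : Type*}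
    [AddCommGroup X] [Module Rᵐᵒᵖ X] [IsSimpleModule Rᵐᵒᵖ X] {r : R} (hr : r ∈ Ring.jacobson R)
    (v : X) : MulOpposite.op r • v = 0 := by
  obtain ⟨n, hn⟩ := hn
  refine smul_eq_zero_of_nil (fun b => ⟨n, ?_⟩) v
  have h1 := Ideal.pow_mem_pow (Ideal.mul_mem_right b.unop (Ring.jacobson R) hr) n
  rw [hn, Ideal.mem_bot] at h1
  have : b * MulOpposite.op r = MulOpposite.op (r * b.unop) := rfl
  rw [this, ← MulOpposite.op_pow, h1, MulOpposite.op_zero]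

section

variable {S : Subalgebra k R} {τ : R →+* S} (hτ : ∀ s : S, τ s = s)
  (hJ : ∀ r, τ r = 0 ↔ r ∈ Ring.jacobson R) (hn : ∃ n, Ring.jacobson R ^ n = ⊥)
  {ι : Type*} {c f : ι → S} (hb : BlockData c f)
include hτ hJ

lemma sub_coe_proj_mem (r : R) : r - τ r ∈ Ring.jacobson R := by
  rw [← hJ, map_sub, hτ, sub_self]

include hn hb

/-- The simple module is generated by the image of v under f i. Modulo the radical, which acts as
zero, c i is central and is absorbed by f i. -/
lemma smul_eq_self_of_central {X : Type*} [AddCommGroup X] [Module Rᵐᵒᵖ X] [IsSimpleModule Rᵐᵒᵖ X]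
    {i : ι} {v : X} (hv : MulOpposite.op (f i : R) • v ≠ 0) (w : X) :
    MulOpposite.op (c i : R) • w = w := by
  obtain ⟨b, rfl⟩ := IsSimpleModule.toSpanSingleton_surjective Rᵐᵒᵖ hv w
  have h1 : (f i : R) * b.unop * c i - f i * b.unop ∈ Ring.jacobson R := by
    rw [← hJ, map_sub, map_mul, map_mul, hτ, hτ, ← hb.central, ← mul_assoc, hb.c_mul_f, sub_self]
  have h2 := op_smul_eq_zero_of_mem_jacobson hn h1 v
  rw [MulOpposite.op_sub, sub_smul, sub_eq_zero] at h2
  simpa [mul_smul] using h2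

-- Modulo the radical, the corner at f i is the division ring f i S f i.
omit hn in
lemma op_f_local (i : ι) (a : Rᵐᵒᵖ) :
    MulOpposite.op (f i : R) * a * MulOpposite.op (f i : R) ∈ {a | a.unop ∈ Ring.jacobson R} ∨
      ∃ b, b * (MulOpposite.op (f i : R) * a * MulOpposite.op (f i : R)) - MulOpposite.op (f i : R)
        ∈ {a | a.unop ∈ Ring.jacobson R} := by
  by_cases h : f i * τ a.unop * f i = 0
  · left
    simp only [Set.mem_ofPred_eq, MulOpposite.unop_mul, MulOpposite.unop_op]
    rw [← hJ]
    simp only [map_mul, hτ]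
    rw [← h, mul_assoc]
  · right
    obtain ⟨t, -, ht⟩ := hb.division i _ h
    refine ⟨MulOpposite.op ((f i * t * f i : S) : R), ?_⟩
    simp only [Set.mem_ofPred_eq, MulOpposite.unop_mul, MulOpposite.unop_op, MulOpposite.unop_sub]
    rw [← hJ]
    simp only [map_mul, hτ, map_sub]
    rw [sub_eq_zero]
    conv_rhs => rw [← ht]
    simp only [mul_assoc]

-- A nonzero idempotent is not in a nilpotent ideal, so f i avoids the radical of Rᵐᵒᵖ and hence
-- some maximal left ideal.
omit hτ hJ hn in
lemma exists_isSimpleModule_f_smul_ne_zero [IsArtinianRing Rᵐᵒᵖ] (i : ι) :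
    ∃ X : ModuleCat.{u} Rᵐᵒᵖ, IsSimpleModule Rᵐᵒᵖ X ∧ ∃ v : X, MulOpposite.op (f i : R) • v ≠ 0 := by
  have h1 : MulOpposite.op (f i : R) ∉ Ring.jacobson Rᵐᵒᵖ := by
    intro hmem
    obtain ⟨n, hn⟩ := IsSemiprimaryRing.isNilpotent (R := Rᵐᵒᵖ)
    have h2 := Ideal.pow_mem_pow hmem (n + 1)
    have h3 : IsIdempotentElem (MulOpposite.op (f i : R)) := by
      rw [IsIdempotentElem, ← MulOpposite.op_mul, ← Subalgebra.coe_mul, hb.idem]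
    rw [h3.pow_succ_eq, Submodule.pow_succ, hn, Ideal.zero_eq_bot, Ideal.bot_mul, Ideal.mem_bot,
      MulOpposite.op_eq_zero_iff] at h2
    exact hb.f_ne_zero i (Subtype.ext h2)
  rw [Ring.jacobson_eq_sInf_isMaximal, Submodule.mem_sInf] at h1
  push Not at h1
  obtain ⟨m, hm, hfm⟩ := h1
  refine ⟨ModuleCat.of Rᵐᵒᵖ (Rᵐᵒᵖ ⧸ m), isSimpleModule_iff_isCoatom.2 (Ideal.isMaximal_def.1 hm),
    Submodule.Quotient.mk 1, ?_⟩
  intro h0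
  apply hfm
  rw [← Submodule.Quotient.mk_smul, smul_eq_mul, mul_one] at h0
  exact (Submodule.Quotient.mk_eq_zero _).1 h0

end

/-- Each f i acts nontrivially on some simple module. Two blocks cannot share one, since c i and c j
would both act on it as the identity although they are orthogonal. Every simple module is reached,
because 1 = Σ c i and each c i lies in the ideal generated by f i. The blocks are reindexed along
this bijection. -/
lemma exists_splitting [Module.Finite k R] (S : Subalgebra k R) (hS : IsWedderburnComplement S)
    {Λ₀ : Type w} [Fintype Λ₀] {T : Λ₀ → ModuleCat.{u} Rᵐᵒᵖ} (hT : IsSimpleLabelling Rᵐᵒᵖ T) :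
    ∃ (τ : R →+* S) (c f : Λ₀ → S), Splitting S τ c f ∧
      ∀ x, ∃ v : T x, MulOpposite.op (f x : R) • v ≠ 0 := by
  have : IsArtinianRing R := IsArtinianRing.of_finite k R
  have : Module.Finite k Rᵐᵒᵖ := Module.Finite.equiv (MulOpposite.opLinearEquiv k)
  have : IsArtinianRing Rᵐᵒᵖ := IsArtinianRing.of_finite k Rᵐᵒᵖ
  have := hS.semisimple
  have hsimp := hT.simple
  obtain ⟨τ, hτ, hJ⟩ := exists_proj S hS
  obtain ⟨n, c, f, hb, hc⟩ := exists_blockData S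
  have hn : ∃ n, Ring.jacobson R ^ n = ⊥ := IsSemiprimaryRing.isNilpotent
  have hex : ∀ i, ∃ x, ∃ v : T x, MulOpposite.op (f i : R) • v ≠ 0 := by
    intro i
    obtain ⟨X, hX, v, hv⟩ := exists_isSimpleModule_f_smul_ne_zero hb i
    obtain ⟨x, ⟨e⟩⟩ := hT.complete X hX
    exact ⟨x, e v, fun h0 => hv (e.injective (by rw [map_smul, h0, map_zero]))⟩
  choose φ v hv using hex
  have huniq : ∀ x i j (v w : T x), MulOpposite.op (f i : R) • v ≠ 0 →
      MulOpposite.op (f j : R) • w ≠ 0 → i = j := by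
    intro x i j v w hv hw
    by_contra hij
    have h1 := smul_eq_self_of_central hτ hJ hn hb hv w
    have h2 := smul_eq_self_of_central hτ hJ hn hb hw w
    apply hw
    rw [← h2, ← h1, smul_smul, smul_smul]
    simp only [← MulOpposite.op_mul, ← Subalgebra.coe_mul]
    rw [← mul_assoc, hc.ortho hij, zero_mul]
    simp
  have hinj : Function.Injective φ := by
    intro i j hij
    have h1 := hv i
    have h2 := hv j
    obtain ⟨w, hw⟩ : ∃ w : T (φ j), MulOpposite.op (f i : R) • w ≠ 0 := by
      rw [← hij]; exact ⟨_, h1⟩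
    exact huniq _ _ _ _ _ hw h2
  have hsurj : Function.Surjective φ := by
    intro x
    obtain ⟨i, w, hw⟩ : ∃ i, ∃ w : T x, MulOpposite.op (f i : R) • w ≠ 0 := by
      obtain ⟨w, hw⟩ := @exists_ne _ (IsSimpleModule.nontrivial Rᵐᵒᵖ (T x)) 0
      by_contra! hall
      apply hw
      have h1 : ∀ i, MulOpposite.op (c i : R) • w = 0 := by
        intro i
        have : ∀ t ∈ AddSubmonoid.closure {s | ∃ a b, s = a * f i * b},
            MulOpposite.op (t : R) • w = 0 := by
          intro t ht
          induction ht using AddSubmonoid.closure_induction with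
          | mem t ht =>
            obtain ⟨a, b, rfl⟩ := ht
            simp [mul_smul, hall]
          | zero => simp
          | add _ _ _ _ h1 h2 => simp [add_smul, h1, h2]
        exact this _ (hb.full i)
      have h2 : MulOpposite.op ((∑ i, c i : S) : R) • w = 0 := by
        have h3 : MulOpposite.op ((∑ i, c i : S) : R) = ∑ i, MulOpposite.op (c i : R) := by
          rw [AddSubmonoidClass.coe_finsetSum]
          exact map_sum MulOpposite.opAddEquiv _ _
        rw [h3, Finset.sum_smul]
        exact Finset.sum_eq_zero fun i _ => h1 i
      rwa [hc.complete, Subalgebra.coe_one, MulOpposite.op_one, one_smul] at h2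
    obtain ⟨e⟩ := nonempty_linearEquiv_of_smul_ne_zero (N := {a : Rᵐᵒᵖ | a.unop ∈ Ring.jacobson R})
      (X := T (φ i)) (Y := T x) (fun a ha v => op_smul_eq_zero_of_mem_jacobson hn ha v)
      (fun a ha v => op_smul_eq_zero_of_mem_jacobson hn ha v)
      (e := MulOpposite.op (f i : R))
      (by rw [IsIdempotentElem, ← MulOpposite.op_mul, ← Subalgebra.coe_mul, hb.idem])
      (op_f_local hτ hJ hb i) (hv i) hw
    exact ⟨i, hT.irredundant _ _ ⟨e⟩⟩
  let e := Equiv.ofBijective φ ⟨hinj, hsurj⟩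
  refine ⟨τ, c ∘ e.symm, f ∘ e.symm, ⟨hτ, hJ, hn, hb.comp _, ?_⟩, fun x => ?_⟩
  · exact (CompleteOrthogonalIdempotents.equiv e.symm).2 hc
  · obtain ⟨i, rfl⟩ := hsurj x
    have : e.symm (φ i) = i := e.symm_apply_apply i
    simp only [Function.comp_apply, this]
    exact ⟨_, hv i⟩

/-- J annihilates the top of c x R, and c x is central modulo J, so c x acts as the identity on the
top. On a simple constituent of type y the idempotent c y also acts as the identity, and
orthogonality forces x = y. -/
lemma Splitting.isTopDecomposition {S : Subalgebra k R} {τ : R →+* S} {Λ₀ : Type w} [Fintype Λ₀]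
    {c f : Λ₀ → S} (h : Splitting S τ c f) {T : Λ₀ → ModuleCat.{u} Rᵐᵒᵖ}
    (hT : IsSimpleLabelling Rᵐᵒᵖ T) (hf : ∀ x, ∃ v : T x, MulOpposite.op (f x : R) • v ≠ 0) :
    IsTopDecomposition T (fun x => (c x : R)) where
  idempotents := h.complete.map S.val.toRingHom
  ne_zero x := fun h0 => h.block.c_ne_zero x (Subtype.ext h0)
  top x := by
    have hsimp := hT.simple
    intro m hm
    obtain ⟨y, ⟨e⟩⟩ := hT.complete (ModuleCat.of Rᵐᵒᵖ m) hm
    suffices x = y by subst this; exact ⟨e⟩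
    set U := Submodule.span Rᵐᵒᵖ {(c x : R)} with hU
    have hJU : ∀ (u : U) (j : R), j ∈ Ring.jacobson R →
        MulOpposite.op j • u ∈ Module.jacobson Rᵐᵒᵖ U := by
      intro u j hj
      rw [Module.jacobson, Submodule.mem_sInf]
      intro P hP
      have : IsSimpleModule Rᵐᵒᵖ (U ⧸ P) := isSimpleModule_iff_isCoatom.2 hP
      have h1 := op_smul_eq_zero_of_mem_jacobson h.nilpotent hj (Submodule.Quotient.mk (p := P) u)
      rw [← Submodule.Quotient.mk_smul] at h1
      exact (Submodule.Quotient.mk_eq_zero _).1 h1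
    have hid : ∀ w : U ⧸ Module.jacobson Rᵐᵒᵖ U, MulOpposite.op (c x : R) • w = w := by
      intro w
      obtain ⟨⟨u, hu⟩, rfl⟩ := Submodule.Quotient.mk_surjective _ w
      obtain ⟨a, rfl⟩ := Submodule.mem_span_singleton.1 hu
      rw [← sub_eq_zero, ← Submodule.Quotient.mk_smul, ← Submodule.Quotient.mk_sub,
        Submodule.Quotient.mk_eq_zero]
      have hj : a.unop * c x - c x * a.unop ∈ Ring.jacobson R := by
        rw [← h.proj_eq_zero, map_sub, map_mul, map_mul, h.proj_coe, h.block.central, sub_self]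
      convert hJU ⟨(c x : R), Submodule.mem_span_singleton_self _⟩ _ hj using 1
      apply Subtype.ext
      have hcc : (c x : R) * c x = c x := congrArg Subtype.val (h.block.idem_c x)
      simp only [Submodule.coe_sub, Submodule.coe_smul, MulOpposite.smul_eq_mul_unop,
        MulOpposite.unop_op, mul_sub]
      rw [← mul_assoc, ← mul_assoc, hcc]
    obtain ⟨v, hv⟩ := hf y
    by_contra hxy
    have h1 := smul_eq_self_of_central h.proj_coe h.proj_eq_zero h.nilpotent h.block hv v
    have h2 : MulOpposite.op (c x : R) • v = v := by
      have h3 : MulOpposite.op (c x : R) • e.symm v = e.symm v := Subtype.ext (hid _)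
      have := congrArg e h3
      rwa [map_smul, LinearEquiv.apply_symm_apply] at this
    apply hv
    have h0 : v = 0 := by
      rw [← h1, ← h2, smul_smul, ← MulOpposite.op_mul, ← Subalgebra.coe_mul,
        h.complete.ortho hxy, Subalgebra.coe_zero, MulOpposite.op_zero, zero_smul]
    rw [h0, smul_zero]

end Complement

/-! ### Simple modules from a quotient by a nil ideal -/

section TopData

/-- A ring `A` whose quotient by a nil ideal is a product of simple Artinian rings, namely of the
blocks `c x S`, `x ∈ X`: the projections are `π x`, and the maps `σ x` lift the factors. -/
structure TopData {A S X : Type*} [Ring A] [Ring S] (c f : X → S) (π : X → A →+ S)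
    (σ : X → S →+ A) : Prop where
  block : BlockData c f
  π_mul : ∀ x a b, π x (a * b) = π x a * π x b
  π_one : ∀ x, π x 1 = c x
  σ_mul : ∀ x s t, σ x (s * t) = σ x s * σ x t
  π_σ : ∀ x s, π x (σ x s) = c x * s
  π_σ_ne : ∀ x y s, x ≠ y → π x (σ y s) = 0
  one_mem : (1 : A) ∈ AddSubmonoid.closure (Set.range fun x => σ x (c x))
  nil : ∀ a, (∀ x, π x a = 0) → IsNilpotent a

/-- An idempotent `e` is primitive if `0` and `e` are the only idempotents of `e A e`. -/
lemma isPrimitiveIdempotent_of {A : Type*} [Ring A] {e : A} (he : IsIdempotentElem e) (h0 : e ≠ 0)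
    (h : ∀ w, e * w = w → w * e = w → w * w = w → w = 0 ∨ w = e) : IsPrimitiveIdempotent e where
  idem := he
  ne_zero := h0
  indec U V hUV := by
    have hmul : ∀ u : (Ideal.span {e} : Ideal A), (u : A) * e = u := by
      rintro ⟨u, hu⟩
      obtain ⟨a, rfl⟩ := Ideal.mem_span_singleton'.1 hu
      change a * e * e = a * e
      rw [mul_assoc, he]
    let e' : (Ideal.span {e} : Ideal A) := ⟨e, Ideal.mem_span_singleton_self e⟩
    have htop : ∀ W : Submodule A (Ideal.span {e} : Ideal A), e' ∈ W → W = ⊤ := by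
      intro W hW
      rw [eq_top_iff]
      rintro u -
      have : u = (u : A) • e' := Subtype.ext (hmul u).symm
      rw [this]
      exact W.smul_mem _ hW
    obtain ⟨u, hu, v, hv, huv⟩ := Submodule.mem_sup.1
      (show e' ∈ U ⊔ V by rw [hUV.sup_eq_top]; trivial)
    have huv' : (u : A) + v = e := congrArg Subtype.val huv
    have hu1 : (u : A) * u + u * v = u := by rw [← mul_add, huv', hmul]
    have hv1 : (v : A) * u + v * v = v := by rw [← mul_add, huv', hmul]
    -- u v lies in V as a left multiple of v and in U as u - u u, hence is zero; so u is an
    -- idempotent of e A e.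
    have huv0 : (u : A) * v = 0 := by
      have h1 : (u : A) • v = u - (u : A) • u := Subtype.ext (eq_sub_of_add_eq' hu1)
      have h2 : (u : A) • v ∈ U := by rw [h1]; exact U.sub_mem hu (U.smul_mem _ hu)
      exact congrArg Subtype.val (Submodule.disjoint_def.1 hUV.disjoint _ h2 (V.smul_mem _ hv))
    have hvu0 : (v : A) * u = 0 := by
      have h1 : (v : A) • u = v - (v : A) • v := Subtype.ext (eq_sub_of_add_eq hv1)
      have h2 : (v : A) • u ∈ V := by rw [h1]; exact V.sub_mem hv (V.smul_mem _ hv)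
      exact congrArg Subtype.val (Submodule.disjoint_def.1 hUV.disjoint _ (U.smul_mem _ hu) h2)
    have huu : (u : A) * u = u := by rwa [huv0, add_zero] at hu1
    have heu : e * u = u := by
      have : ((u : A) + v) * u = u := by rw [add_mul, huu, hvu0, add_zero]
      rwa [huv'] at this
    rcases h u heu (hmul u) huu with h1 | h1
    · left
      have : v = e' := Subtype.ext (by rw [h1, zero_add] at huv'; exact huv')
      have hV := htop V (by rw [← this]; exact hv)
      have := hUV.disjoint
      rwa [hV, disjoint_top] at this
    · right
      have : u = e' := Subtype.ext h1
      have hU := htop U (by rw [← this]; exact hu)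
      have := hUV.disjoint
      rwa [hU, top_disjoint] at this

namespace TopData

variable {A S X : Type*} [Ring A] [Ring S] {c f : X → S} {π : X → A →+ S} {σ : X → S →+ A}
  (h : TopData c f π σ)

section
include h

lemma smul_eq_zero_of_π {V : Type*} [AddCommGroup V] [Module A V] [IsSimpleModule A V] {a : A}
    (ha : ∀ x, π x a = 0) (v : V) : a • v = 0 :=
  smul_eq_zero_of_nil (fun b => h.nil _ fun x => by rw [h.π_mul, ha, mul_zero]) v

lemma π_σ_f (x : X) : π x (σ x (f x)) = f x := by rw [h.π_σ, h.block.c_mul_f]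

lemma f_mul_f (x : X) : f x * f x = f x := h.block.idem x

lemma idem (x : X) : IsIdempotentElem (σ x (f x)) := by
  rw [IsIdempotentElem, ← h.σ_mul, h.block.idem]

lemma local_σ_f (x : X) (a : A) : σ x (f x) * a * σ x (f x) ∈ {a | ∀ y, π y a = 0} ∨
    ∃ b, b * (σ x (f x) * a * σ x (f x)) - σ x (f x) ∈ {a | ∀ y, π y a = 0} := by
  by_cases h0 : f x * π x a * f x = 0
  · left
    intro y
    rw [h.π_mul, h.π_mul]
    rcases eq_or_ne y x with rfl | hy
    · rw [h.π_σ_f, h0]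
    · rw [h.π_σ_ne y x _ hy, zero_mul, zero_mul]
  · right
    obtain ⟨t, ht, -⟩ := h.block.division x _ h0
    refine ⟨σ x (f x * t * f x), fun y => ?_⟩
    rw [map_sub, h.π_mul, h.π_mul, h.π_mul]
    rcases eq_or_ne y x with rfl | hy
    · rw [h.π_σ_f, h.π_σ, mul_assoc (c y), ht, h.block.c_mul_f, sub_self]
    · simp only [h.π_σ_ne y x _ hy, zero_mul, sub_self]

/-- An idempotent of the corner maps under π x to an idempotent of the division ring f x S f x, that
is, to 0 or f x. One with zero image under π x is killed by every π y, so it is nilpotent and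
therefore zero. -/
lemma isPrimitiveIdempotent (x : X) : IsPrimitiveIdempotent (σ x (f x)) := by
  refine isPrimitiveIdempotent_of (h.idem x)
    (fun h0 => h.block.f_ne_zero x (by rw [← h.π_σ_f, h0, map_zero])) fun w hew hwe hww => ?_
  have hzero : ∀ w : A, σ x (f x) * w = w → w * w = w → π x w = 0 → w = 0 := by
    intro w hew hww hw
    obtain ⟨n, hn⟩ := h.nil w (fun y => by
      rcases eq_or_ne y x with rfl | hy
      · exact hw
      · rw [← hew, h.π_mul, h.π_σ_ne y x _ hy, zero_mul])
    have h1 : w ^ (n + 1) = w := IsIdempotentElem.pow_succ_eq n hww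
    rw [← h1, pow_succ, hn, zero_mul]
  by_cases h0 : π x w = 0
  · exact Or.inl (hzero w hew hww h0)
  · right
    have hf1 : f x * π x w = π x w := by
      have h1 := congrArg (π x) hew
      rwa [h.π_mul, h.π_σ_f] at h1
    have hf2 : π x w * f x = π x w := by
      have h1 := congrArg (π x) hwe
      rwa [h.π_mul, h.π_σ_f] at h1
    obtain ⟨t, ht, -⟩ := h.block.division x (π x w) (by rwa [hf1, hf2])
    rw [hf1, hf2] at ht
    have hpw : π x w = f x := by
      conv_lhs => rw [← hf1, ← ht]
      rw [mul_assoc, ← h.π_mul, hww, ht]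
    symm
    rw [← sub_eq_zero]
    refine hzero _ ?_ ?_ ?_
    · rw [mul_sub, hew, h.idem x]
    · rw [mul_sub, sub_mul, sub_mul, hew, hwe, hww, h.idem x, sub_self, sub_zero]
    · rw [map_sub, hpw, h.π_σ_f, sub_self]

end

/-- The simple module belonging to `x`: the left ideal of `S` generated by `f x`, on which `A` acts
through `π x`. -/
def TopModule (_ : TopData c f π σ) (x : X) : Type _ := (Ideal.span {f x} : Ideal S)

instance (x : X) : AddCommGroup (h.TopModule x) :=
  inferInstanceAs (AddCommGroup (Ideal.span {f x} : Ideal S))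

include h in
lemma c_mul_coe (x : X) (v : (Ideal.span {f x} : Ideal S)) : c x * (v : S) = v := by
  obtain ⟨a, ha⟩ := Ideal.mem_span_singleton'.1 v.2
  rw [← ha]
  clear ha
  rw [← mul_assoc, h.block.central, mul_assoc, h.block.c_mul_f]

include h in
lemma coe_mul_f (x : X) (v : (Ideal.span {f x} : Ideal S)) : (v : S) * f x = v := by
  obtain ⟨a, ha⟩ := Ideal.mem_span_singleton'.1 v.2
  rw [← ha]
  clear ha
  rw [mul_assoc, h.block.idem]

instance (x : X) : Module A (h.TopModule x) where
  smul a v := ⟨π x a * (v : (Ideal.span {f x} : Ideal S)).1, Ideal.mul_mem_left _ _ v.2⟩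
  one_smul v := Subtype.ext ((congrArg (· * _) (h.π_one x)).trans (h.c_mul_coe x v))
  mul_smul a b v := Subtype.ext (by
    change π x (a * b) * (v : (Ideal.span {f x} : Ideal S)).1 = π x a * (π x b * _)
    rw [h.π_mul, mul_assoc])
  smul_zero a := Subtype.ext (mul_zero (π x a))
  smul_add a v w := Subtype.ext (mul_add (π x a) _ _)
  add_smul a b v := Subtype.ext (by
    change π x (a + b) * (v : (Ideal.span {f x} : Ideal S)).1 = π x a * _ + π x b * _
    rw [map_add, add_mul])
  zero_smul v := Subtype.ext (by
    change π x 0 * (v : (Ideal.span {f x} : Ideal S)).1 = 0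
    rw [map_zero, zero_mul])

/-- The inclusion of the simple module belonging to `x` into `S`. -/
def val (x : X) : h.TopModule x →+ S := (Ideal.span {f x} : Ideal S).subtype.toAddMonoidHom

lemma val_injective (x : X) : Function.Injective (h.val x) := Subtype.val_injective

@[simp] lemma val_smul (x : X) (a : A) (v : h.TopModule x) : h.val x (a • v) = π x a * h.val x v :=
  rfl

/-- An element of `S f x` as an element of the simple module belonging to `x`. -/
def ofS (x : X) (s : S) (hs : s * f x = s) : h.TopModule x :=
  (⟨s, Ideal.mem_span_singleton'.2 ⟨s, hs⟩⟩ : (Ideal.span {f x} : Ideal S))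

@[simp] lemma val_ofS (x : X) (s : S) (hs : s * f x = s) : h.val x (h.ofS x s hs) = s := rfl

lemma val_mul_f (x : X) (v : h.TopModule x) : h.val x v * f x = h.val x v := h.coe_mul_f x v

lemma c_mul_val (x : X) (v : h.TopModule x) : c x * h.val x v = h.val x v := h.c_mul_coe x v

lemma σ_f_smul_ne_zero (x : X) :
    σ x (f x) • h.ofS x (f x) (h.f_mul_f x) ≠ 0 := by
  intro h0
  have := congrArg (h.val x) h0
  rw [val_smul, val_ofS, h.π_σ_f, h.f_mul_f, map_zero] at this
  exact h.block.f_ne_zero x this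

lemma σ_smul_eq_zero {x y : X} (hxy : x ≠ y) (s : S) (v : h.TopModule x) : σ y s • v = 0 :=
  h.val_injective x (by rw [val_smul, h.π_σ_ne x y s hxy, zero_mul, map_zero])

lemma isPrimitiveFor_topModule {A S : Type u} {X : Type w} [Ring A] [Ring S] {c f : X → S}
    {π : X → A →+ S} {σ : X → S →+ A} (h : TopData c f π σ) (x : X) :
    IsPrimitiveFor (σ x (f x)) (h.TopModule x) :=
  ⟨h.isPrimitiveIdempotent x, _, h.σ_f_smul_ne_zero x⟩

instance isSimpleModule_topModule (x : X) : IsSimpleModule A (h.TopModule x) := by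
  rw [isSimpleModule_iff_toSpanSingleton_surjective]
  refine ⟨⟨⟨h.ofS x (f x) (h.f_mul_f x), 0, fun h0 => h.σ_f_smul_ne_zero x (by
    rw [h0, smul_zero])⟩⟩, fun w hw v => ?_⟩
  have hw' : c x * h.val x w ≠ 0 := by
    rw [h.c_mul_val]
    exact fun h0 => hw (h.val_injective x (by rw [h0, map_zero]))
  obtain ⟨b, hb⟩ := h.block.exists_f_mul_ne_zero hw'
  obtain ⟨t, ht, -⟩ := h.block.division x (b * h.val x w) (by
    rw [mul_assoc, mul_assoc, h.val_mul_f, ← mul_assoc]; exact hb)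
  refine ⟨σ x (h.val x v * (f x * t * f x) * (f x * b)), h.val_injective x ?_⟩
  rw [LinearMap.toSpanSingleton_apply, val_smul, h.π_σ]
  have h1 : f x * b * h.val x w = f x * (b * h.val x w) * f x := by
    simp only [mul_assoc, h.val_mul_f]
  rw [mul_assoc, mul_assoc _ (f x * b), h1, mul_assoc (h.val x v), ht, h.val_mul_f, h.c_mul_val]

end TopData

/-- The simple modules of a ring with `TopData`. -/
def TopData.simple {A : Type u} {S : Type u} {X : Type w} [Ring A] [Ring S] {c f : X → S}
    {π : X → A →+ S} {σ : X → S →+ A} (h : TopData c f π σ) (x : X) : ModuleCat.{u} A :=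
  ModuleCat.of A (h.TopModule x)

/-- The idempotent σ x (f x) acts nontrivially on the module of x and as zero on the others. On any
simple module some σ x (c x), and then some σ x (f x), is nonzero, because 1 lies in the span of the
former; being local, this idempotent determines the module. -/
theorem TopData.isSimpleLabelling {A : Type u} {S : Type u} {X : Type w} [Ring A] [Ring S]
    {c f : X → S} {π : X → A →+ S} {σ : X → S →+ A} (h : TopData c f π σ) :
    IsSimpleLabelling A h.simple where
  simple x := h.isSimpleModule_topModule x
  irredundant x y := by
    rintro ⟨e⟩
    by_contra hxy
    have h1 : e (σ x (f x) • h.ofS x (f x) (h.f_mul_f x)) = 0 :=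
      (e.map_smul _ _).trans (h.σ_smul_eq_zero (Ne.symm hxy) _ _)
    exact h.σ_f_smul_ne_zero x ((LinearEquiv.map_eq_zero_iff e).1 h1)
  complete V hV := by
    obtain ⟨v, hv⟩ := @exists_ne V (IsSimpleModule.nontrivial A V) 0
    obtain ⟨x, hx⟩ : ∃ x, σ x (c x) • v ≠ 0 := by
      by_contra! hall
      have : ∀ a ∈ AddSubmonoid.closure (Set.range fun x => σ x (c x)), a • v = 0 := by
        intro a ha
        induction ha using AddSubmonoid.closure_induction with
        | mem a ha => obtain ⟨x, rfl⟩ := ha; exact hall x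
        | zero => rw [zero_smul]
        | add _ _ _ _ h1 h2 => rw [add_smul, h1, h2, add_zero]
      exact hv (by rw [← one_smul A v, this _ h.one_mem])
    obtain ⟨w, hw⟩ : ∃ w : V, σ x (f x) • w ≠ 0 := by
      by_contra! hall
      have : ∀ s ∈ AddSubmonoid.closure {s | ∃ a b, s = a * f x * b}, σ x s • v = 0 := by
        intro s hs
        induction hs using AddSubmonoid.closure_induction with
        | mem s hs =>
          obtain ⟨a, b, rfl⟩ := hs
          rw [h.σ_mul, h.σ_mul, mul_smul, mul_smul, hall, smul_zero]
        | zero => rw [map_zero, zero_smul]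
        | add _ _ _ _ h1 h2 => rw [map_add, add_smul, h1, h2, add_zero]
      exact hx (this _ (h.block.full x))
    have e : Nonempty (V ≃ₗ[A] h.TopModule x) :=
      nonempty_linearEquiv_of_smul_ne_zero (N := {a | ∀ y, π y a = 0})
        (fun a ha v => h.smul_eq_zero_of_π ha v) (fun a ha v => h.smul_eq_zero_of_π ha v)
        (h.idem x) (h.local_σ_f x) hw (h.σ_f_smul_ne_zero x)
    exact ⟨x, e⟩

end TopData

/-! ### Composition multiplicities -/

section Multiplicity

variable {A : Type u} [Ring A]

lemma exists_series (X : Type u) [AddCommGroup X] [Module A X] [IsNoetherian A X]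
    [IsArtinian A X] : ∃ (d : ℕ) (F : ℕ → Submodule A X), Monotone F ∧ F 0 = ⊥ ∧ F d = ⊤ ∧
      ∀ i < d, F i ⋖ F (i + 1) := by
  obtain ⟨s, hs0, hs1⟩ := isFiniteLength_iff_exists_compositionSeries.1
    ((isFiniteLength_iff_isNoetherian_isArtinian (R := A) (M := X)).2
      ⟨inferInstance, inferInstance⟩)
  -- The chain indexed by ℕ stays constant beyond the length of the series.
  refine ⟨s.length, fun i => s ⟨min i s.length, by omega⟩, ?_, ?_, ?_, ?_⟩
  · intro i j hij
    exact s.strictMono.monotone (by simp only [Fin.mk_le_mk]; omega)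
  · rw [← hs0]; rfl
  · rw [← hs1, RelSeries.last]
    simp [Fin.last]
  · intro i hi
    have := s.step ⟨i, hi⟩
    have h1 : (⟨min i s.length, by omega⟩ : Fin (s.length + 1)) = Fin.castSucc ⟨i, hi⟩ :=
      Fin.ext (min_eq_left hi.le)
    have h2 : (⟨min (i + 1) s.length, by omega⟩ : Fin (s.length + 1)) = Fin.succ ⟨i, hi⟩ :=
      Fin.ext (min_eq_left hi)
    simp only [h1, h2]
    exact this

lemma not_linearEquiv_of_smul_eq_zero {X L : Type*} [AddCommGroup X] [Module A X]
    [AddCommGroup L] [Module A L] {e : A} {U V : Submodule A X} (hX : ∀ v ∈ V, e • v = 0)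
    {v : L} (hv : e • v ≠ 0) : ¬ Nonempty ((V ⧸ U.submoduleOf V) ≃ₗ[A] L) := by
  rintro ⟨φ⟩
  obtain ⟨w, rfl⟩ := φ.surjective v
  obtain ⟨⟨w, hw⟩, rfl⟩ := Submodule.Quotient.mk_surjective _ w
  apply hv
  rw [← map_smul, ← Submodule.Quotient.mk_smul]
  have : e • (⟨w, hw⟩ : V) = 0 := Subtype.ext (hX w hw)
  rw [this, Submodule.Quotient.mk_zero, map_zero]

/-- A module annihilated by an idempotent belonging to `L` does not involve `L`. -/
lemma hasMultiplicity_zero {X L : Type u} [AddCommGroup X] [Module A X] [IsNoetherian A X]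
    [IsArtinian A X] [AddCommGroup L] [Module A L] {e : A} (hX : ∀ v : X, e • v = 0)
    {v : L} (hv : e • v ≠ 0) : HasMultiplicity A X L 0 := by
  obtain ⟨d, F, hF, h0, h1, hcov⟩ := exists_series (A := A) X
  refine ⟨d, F, hF, h0, h1, fun i hi => ?_, ?_⟩
  · exact (covBy_iff_quot_is_simple (hcov i hi).le).1 (hcov i hi)
  · convert Set.ncard_empty ℕ
    rw [Set.eq_empty_iff_forall_notMem]
    rintro i ⟨_, hi⟩
    exact not_linearEquiv_of_smul_eq_zero (fun v _ => hX v) hv hi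

/-- A module with simple quotient `L`, the kernel of which is annihilated by an idempotent belonging
to `L`, involves `L` exactly once. -/
lemma hasMultiplicity_one {X L : Type u} [AddCommGroup X] [Module A X] [IsNoetherian A X]
    [IsArtinian A X] [AddCommGroup L] [Module A L] [IsSimpleModule A L] {φ : X →ₗ[A] L}
    (hφ : Function.Surjective φ) {e : A} (hX : ∀ v : X, φ v = 0 → e • v = 0)
    {v : L} (hv : e • v ≠ 0) : HasMultiplicity A X L 1 := by
  obtain ⟨d, F, hF, h0, h1, hcov⟩ := exists_series (A := A) (LinearMap.ker φ)
  have hker : ∀ i, (F i).map (LinearMap.ker φ).subtype ≤ LinearMap.ker φ :=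
    fun i => Submodule.map_subtype_le _ _
  -- A composition series of the kernel, continued by the whole module. Only the last section can be
  -- L, since e kills the earlier ones.
  let G : ℕ → Submodule A X := fun i => if i ≤ d then (F i).map (LinearMap.ker φ).subtype else ⊤
  have hG : ∀ i ≤ d, G i = (F i).map (LinearMap.ker φ).subtype := fun i hi => if_pos hi
  have hGd : G d = LinearMap.ker φ := by
    rw [hG d le_rfl, h1, Submodule.map_subtype_top]
  have hGt : G (d + 1) = ⊤ := if_neg (by omega)
  have eL : Nonempty ((G (d + 1) ⧸ (G d).submoduleOf (G (d + 1))) ≃ₗ[A] L) := by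
    rw [hGd, hGt]
    refine ⟨LinearMap.quotKerEquivOfSurjective (φ ∘ₗ (⊤ : Submodule A X).subtype) ?_⟩
    intro y
    obtain ⟨x, rfl⟩ := hφ y
    exact ⟨⟨x, trivial⟩, rfl⟩
  refine ⟨d + 1, G, ?_, ?_, hGt, fun i hi => ?_, ?_⟩
  · intro i j hij
    by_cases hj : j ≤ d
    · rw [hG i (hij.trans hj), hG j hj]
      exact Submodule.map_mono (hF hij)
    · exact le_top.trans (if_neg hj).ge
  · rw [hG 0 (Nat.zero_le _), h0, Submodule.map_bot]
  · rcases Nat.lt_succ_iff_lt_or_eq.1 hi with hi | rfl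
    · have hle : G i ≤ G (i + 1) := by
        rw [hG i hi.le, hG (i + 1) hi]
        exact Submodule.map_mono (hF (Nat.le_succ i))
      refine (covBy_iff_quot_is_simple hle).1 ?_
      rw [hG i hi.le, hG (i + 1) hi]
      have hoc : (Set.range (Submodule.MapSubtype.orderEmbedding (LinearMap.ker φ))).OrdConnected := by
        refine ⟨?_⟩
        rintro _ ⟨P, rfl⟩ _ ⟨Q, rfl⟩ N ⟨-, hN⟩
        refine ⟨N.comap (LinearMap.ker φ).subtype, ?_⟩
        change Submodule.map _ _ = _
        rw [Submodule.map_comap_subtype]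
        exact inf_eq_right.2 (hN.trans (Submodule.map_subtype_le _ _))
      exact (Set.OrdConnected.apply_covBy_apply_iff
        (Submodule.MapSubtype.orderEmbedding (LinearMap.ker φ)) hoc).2 (hcov i hi)
    · obtain ⟨eL⟩ := eL
      exact IsSimpleModule.congr eL
  · have : {i | i < d + 1 ∧
        Nonempty ((G (i + 1) ⧸ (G i).submoduleOf (G (i + 1))) ≃ₗ[A] L)} = {d} := by
      ext i
      constructor
      · rintro ⟨hi, hL⟩
        rcases Nat.lt_succ_iff_lt_or_eq.1 hi with hi | rfl
        · refine absurd hL (not_linearEquiv_of_smul_eq_zero (fun v hv => hX v ?_) hv)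
          rw [hG (i + 1) hi] at hv
          exact hker _ hv
        · rfl
      · rintro rfl
        exact ⟨Nat.lt_succ_self _, eL⟩
    rw [this, Set.ncard_singleton]

/-- Sections of a filtration pulled back along an injective map. -/
lemma nonempty_section_equiv {X Y : Type*} [AddCommGroup X] [Module A X] [AddCommGroup Y]
    [Module A Y] {φ : X →ₗ[A] Y} (hφ : Function.Injective φ) {U V : Submodule A Y}
    (hV : V ≤ LinearMap.range φ) :
    Nonempty ((V.comap φ ⧸ (U.comap φ).submoduleOf (V.comap φ)) ≃ₗ[A] (V ⧸ U.submoduleOf V)) := by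
  let ψ : V.comap φ ≃ₗ[A] V := LinearEquiv.ofBijective
    (φ.restrict (p := V.comap φ) (q := V) fun _ hx => hx) (by
      constructor
      · intro x y hxy
        exact Subtype.ext (hφ (congrArg Subtype.val hxy))
      · rintro ⟨y, hy⟩
        obtain ⟨x, rfl⟩ := hV hy
        exact ⟨⟨x, hy⟩, rfl⟩)
  refine ⟨Submodule.Quotient.equiv _ _ ψ ?_⟩
  ext y
  constructor
  · rintro ⟨x, hx, rfl⟩
    exact hx
  · intro hy
    obtain ⟨x, rfl⟩ := ψ.surjective y
    exact ⟨x, hy, rfl⟩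

end Multiplicity

/-! ### Induction along a subalgebra with a finite dual basis -/

section DualBasis

variable {k : Type v} [Field k] {A : Type u} [Ring A] [Algebra k A] (B : Subalgebra k A)

/-- A finite dual basis of `A` as a right `B`-module. -/
structure DualBasis {T : Type*} [Fintype T] (a : T → A) (Φ : T → A →+ B) : Prop where
  map_mul : ∀ t α (b : B), Φ t (α * b) = Φ t α * b
  sum_eq : ∀ α, ∑ t, a t * Φ t α = α

variable {B} {T : Type*} [Fintype T] {a : T → A} {Φ : T → A →+ B}

lemma Ind.mk_mul_tmul {N : Type u} [AddCommGroup N] [Module B N] (α : A) (b : B) (n : N) :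
    (balanced B N).mkQ ((α * (b : A)) ⊗ₜ[ℤ] n) = (balanced B N).mkQ (α ⊗ₜ[ℤ] (b • n)) := by
  rw [← sub_eq_zero, ← map_sub, Submodule.mkQ_apply, Submodule.Quotient.mk_eq_zero]
  exact Submodule.subset_span ⟨α, b, n, rfl⟩

lemma Ind.map_mk_tmul {N N' : Type u} [AddCommGroup N] [Module B N] [AddCommGroup N'] [Module B N']
    (f : N →ₗ[B] N') (α : A) (n : N) :
    Ind.map B f ((balanced B N).mkQ (α ⊗ₜ[ℤ] n)) = (balanced B N').mkQ (α ⊗ₜ[ℤ] f n) := by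
  simp [Ind.map]

namespace DualBasis

variable (h : DualBasis B a Φ)

lemma projective (h : DualBasis B a Φ) : Module.Projective B.op A := by
  let s : A →ₗ[B.op] (T → B.op) :=
    { toFun := fun α t => ⟨MulOpposite.op (Φ t α : A), by simp⟩
      map_add' := fun α β => by ext t; simp
      map_smul' := fun b α => by
        ext t
        have h1 : b • α = α * ((⟨b.1.unop, b.2⟩ : B) : A) := rfl
        have h2 : Φ t (b • α) = Φ t α * ⟨b.1.unop, b.2⟩ := by rw [h1, h.map_mul]
        change MulOpposite.op ((Φ t (b • α) : B) : A) = _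
        rw [h2]
        rfl }
  let q : (T → B.op) →ₗ[B.op] A := Fintype.linearCombination B.op a
  refine Module.Projective.of_split s q ?_
  ext α
  conv_rhs => rw [LinearMap.id_apply, ← h.sum_eq α]
  simp only [LinearMap.comp_apply, q, Fintype.linearCombination_apply]
  rfl

/-- The bilinear map underlying `DualBasis.coord`. -/
def coordAux (_ : DualBasis B a Φ) (N : Type u) [AddCommGroup N] [Module B N] :
    A ⊗[ℤ] N →ₗ[ℤ] (T → N) :=
  TensorProduct.lift (LinearMap.mk₂ ℤ (fun α n t => Φ t α • n)
    (fun _ _ _ => by ext t; simp [add_smul])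
    (fun m α n => by ext t; simp only [map_zsmul, Pi.smul_apply, smul_assoc])
    (fun _ _ _ => by ext t; simp)
    (fun m α n => by ext t; exact smul_comm (Φ t α) m n))

lemma coordAux_tmul {N : Type u} [AddCommGroup N] [Module B N] (α : A) (n : N) (t : T) :
    h.coordAux N (α ⊗ₜ[ℤ] n) t = Φ t α • n := rfl

/-- `balanced` is a span over A while the coordinates are only additive, so the span induction
closes only if all left multiples are treated at once. -/
lemma coordAux_smul_eq_zero {N : Type u} [AddCommGroup N] [Module B N] {x : A ⊗[ℤ] N}
    (hx : x ∈ balanced B N) (α : A) : h.coordAux N (α • x) = 0 := by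
  rw [balanced] at hx
  induction hx using Submodule.span_induction generalizing α with
  | mem x hx =>
    obtain ⟨β, b, n, rfl⟩ := hx
    rw [smul_sub, TensorProduct.smul_tmul', TensorProduct.smul_tmul', map_sub]
    ext t
    simp only [smul_eq_mul, Pi.sub_apply, Pi.zero_apply, coordAux_tmul]
    rw [← mul_assoc, h.map_mul, mul_smul, sub_self]
  | zero => simp
  | add x y _ _ hx hy => rw [smul_add, map_add, hx, hy, add_zero]
  | smul β x _ hx => rw [smul_smul, hx]

/-- The coordinates of an element of `A ⊗_B N` with respect to a dual basis of `A`. -/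
def coord (h : DualBasis B a Φ) (N : Type u) [AddCommGroup N] [Module B N] :
    Ind B N →+ (T → N) :=
  QuotientAddGroup.lift (balanced B N).toAddSubgroup (h.coordAux N).toAddMonoidHom fun x hx => by
    have := h.coordAux_smul_eq_zero hx 1
    rwa [one_smul] at this

@[simp] lemma coord_mk_tmul {N : Type u} [AddCommGroup N] [Module B N] (α : A) (n : N) (t : T) :
    h.coord N ((balanced B N).mkQ (α ⊗ₜ[ℤ] n)) t = Φ t α • n :=
  rfl

/-- The element of `A ⊗_B N` with given coordinates. -/
def ofCoord (_ : DualBasis B a Φ) (N : Type u) [AddCommGroup N] [Module B N] (ν : T → N) :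
    Ind B N :=
  ∑ t, (balanced B N).mkQ (a t ⊗ₜ[ℤ] ν t)

lemma ind_induction {N : Type u} [AddCommGroup N] [Module B N] {P : Ind B N → Prop}
    (tmul : ∀ α n, P ((balanced B N).mkQ (α ⊗ₜ[ℤ] n))) (add : ∀ x y, P x → P y → P (x + y))
    (x : Ind B N) : P x := by
  obtain ⟨x, rfl⟩ := Submodule.mkQ_surjective _ x
  induction x with
  | zero => rw [← TensorProduct.tmul_zero N (0 : A)]; exact tmul 0 0
  | tmul α n => exact tmul α n
  | add x y hx hy => rw [map_add]; exact add _ _ hx hy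

lemma ofCoord_coord {N : Type u} [AddCommGroup N] [Module B N] (x : Ind B N) :
    h.ofCoord N (h.coord N x) = x := by
  induction x using ind_induction with
  | tmul α n =>
    simp only [ofCoord, coord_mk_tmul]
    simp only [← Ind.mk_mul_tmul, ← map_sum, ← TensorProduct.sum_tmul, h.sum_eq]
  | add x y hx hy =>
    conv_rhs => rw [← hx, ← hy]
    simp only [ofCoord, ← Finset.sum_add_distrib, ← map_add, ← TensorProduct.tmul_add,
      ← Pi.add_apply]

lemma coord_map {N N' : Type u} [AddCommGroup N] [Module B N] [AddCommGroup N'] [Module B N']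
    (f : N →ₗ[B] N') (x : Ind B N) (t : T) :
    h.coord N' (Ind.map B f x) t = f (h.coord N x t) := by
  induction x using ind_induction with
  | tmul α n => rw [Ind.map_mk_tmul, coord_mk_tmul, coord_mk_tmul, map_smul]
  | add x y hx hy => simp only [map_add, Pi.add_apply, hx, hy]

lemma map_ofCoord {N N' : Type u} [AddCommGroup N] [Module B N] [AddCommGroup N'] [Module B N']
    (f : N →ₗ[B] N') (ν : T → N) :
    Ind.map B f (h.ofCoord N ν) = h.ofCoord N' (fun t => f (ν t)) := by
  simp only [ofCoord, map_sum, Ind.map_mk_tmul]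

-- Coordinates are natural in N and recover the element by `ofCoord_coord`, so injectivity,
-- exactness and surjectivity can all be checked one coordinate at a time.
include h in
theorem indExact : IndExact B := by
  intro X Y Z _ _ _ f g hf hfg hg
  refine ⟨fun x y hxy => ?_, fun y => ⟨fun hy => ?_, ?_⟩, fun z => ?_⟩
  · rw [← h.ofCoord_coord x, ← h.ofCoord_coord y]
    congr 1
    ext t
    apply hf
    rw [← h.coord_map, ← h.coord_map, hxy]
  · have h1 : ∀ t, ∃ x, f x = h.coord Y y t := fun t => (hfg _).1 (by
      rw [← h.coord_map, hy, map_zero, Pi.zero_apply])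
    choose x hx using h1
    refine ⟨h.ofCoord X x, ?_⟩
    rw [h.map_ofCoord]
    simp only [hx]
    exact h.ofCoord_coord y
  · rintro ⟨x, rfl⟩
    rw [← h.ofCoord_coord x, h.map_ofCoord, h.map_ofCoord]
    simp [hfg.apply_apply_eq_zero, ofCoord]
  · choose y hy using fun t => hg (h.coord Z z t)
    refine ⟨h.ofCoord Y y, ?_⟩
    rw [h.map_ofCoord]
    simp only [hy]
    exact h.ofCoord_coord z

end DualBasis

end DualBasis

/-! ### Subquotients and filtrations -/

section Sections

variable {A : Type u} [Ring A] {M : Type u} [AddCommGroup M] [Module A M]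

/-- The subquotient `V / (U ∩ V)` of a module. -/
def subquot (V U : Submodule A M) : ModuleCat.{u} A := ModuleCat.of A (V ⧸ U.submoduleOf V)

/-- The class of an element in a subquotient. -/
def subquotMk {V : Submodule A M} (U : Submodule A M) (m : M) (hm : m ∈ V) : subquot V U :=
  (U.submoduleOf V).mkQ ⟨m, hm⟩

variable {V U : Submodule A M}

lemma exists_eq_subquotMk (v : subquot V U) : ∃ m hm, v = subquotMk U m hm := by
  obtain ⟨⟨m, hm⟩, rfl⟩ := (U.submoduleOf V).mkQ_surjective v
  exact ⟨m, hm, rfl⟩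

lemma smul_subquotMk (a : A) {m : M} (hm : m ∈ V) :
    a • subquotMk U m hm = subquotMk U (a • m) (V.smul_mem a hm) := rfl

lemma subquotMk_add {m m' : M} (hm : m ∈ V) (hm' : m' ∈ V) :
    subquotMk U (m + m') (V.add_mem hm hm') = subquotMk U m hm + subquotMk U m' hm' := rfl

lemma subquotMk_eq_zero_iff {m : M} (hm : m ∈ V) : subquotMk U m hm = 0 ↔ m ∈ U := by
  rw [subquotMk, Submodule.mkQ_apply]
  exact Submodule.Quotient.mk_eq_zero _

/-- The map out of a subquotient induced by a map vanishing on the denominator. -/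
def subquotLift {L : Type*} [AddCommGroup L] [Module A L] (φ : V →ₗ[A] L)
    (hφ : ∀ m : V, (m : M) ∈ U → φ m = 0) : subquot V U →ₗ[A] L :=
  (U.submoduleOf V).liftQ φ hφ

instance [IsNoetherian A M] : IsNoetherian A (subquot V U) :=
  inferInstanceAs (IsNoetherian A (V ⧸ U.submoduleOf V))

instance [IsArtinian A M] : IsArtinian A (subquot V U) :=
  inferInstanceAs (IsArtinian A (V ⧸ U.submoduleOf V))

/-- A module embedded as the top of a chain of submodules surjects onto the last subquotient, and
the kernel is filtered by the others. -/
lemma exists_filtered_cover {P : Type u} [AddCommGroup P] [Module A P] {φ : P →ₗ[A] M}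
    (hφ : Function.Injective φ) {D : ℕ → Submodule A M} (hD : Monotone D) (h0 : D 0 = ⊥) {i : ℕ}
    (hi : LinearMap.range φ = D i) :
    ∃ f : P →ₗ[A] subquot (D i) (D (i - 1)), Function.Surjective f ∧
      HasFiltration A (LinearMap.ker f) fun X =>
        ∃ j, j + 1 < i ∧ Nonempty (X ≃ₗ[A] subquot (D (j + 1)) (D j)) := by
  have hmem : ∀ a, φ a ∈ D i := fun a => hi ▸ LinearMap.mem_range_self φ a
  let f : P →ₗ[A] subquot (D i) (D (i - 1)) := ((D (i - 1)).submoduleOf (D i)).mkQ ∘ₗ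
    φ.codRestrict (D i) hmem
  have hker : ∀ a, f a = 0 ↔ φ a ∈ D (i - 1) := fun a => subquotMk_eq_zero_iff (hmem a)
  refine ⟨f, ?_, ?_⟩
  · intro v
    obtain ⟨m, hm, rfl⟩ := exists_eq_subquotMk v
    obtain ⟨a, rfl⟩ : m ∈ LinearMap.range φ := hi ▸ hm
    exact ⟨a, rfl⟩
  · let ψ := φ ∘ₗ (LinearMap.ker f).subtype
    have hψ : Function.Injective ψ := hφ.comp Subtype.val_injective
    have hrange : D (i - 1) ≤ LinearMap.range ψ := by
      intro m hm
      obtain ⟨a, rfl⟩ : m ∈ LinearMap.range φ := hi ▸ hD (Nat.sub_le _ _) hm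
      exact ⟨⟨a, (hker a).2 hm⟩, rfl⟩
    refine ⟨i - 1, fun j => (D j).comap ψ, fun i j hij => Submodule.comap_mono (hD hij), ?_, ?_, ?_⟩
    · dsimp only
      rw [h0, Submodule.comap_bot, LinearMap.ker_eq_bot.2 hψ]
    · rw [eq_top_iff]
      rintro ⟨a, ha⟩ -
      exact (hker a).1 ha
    · intro j hj
      exact ⟨j, by omega, nonempty_section_equiv hψ ((hD (Nat.succ_le_of_lt hj)).trans hrange)⟩

/-- The same, for a left ideal generated by one element. -/
lemma exists_filtered_cover_of_span (e : A) (w : M) (hinj : ∀ a : A, (a * e) • w = 0 → a * e = 0)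
    {D : ℕ → Submodule A M} (hD : Monotone D) (h0 : D 0 = ⊥) {i : ℕ} (hw : w ∈ D i)
    (hsurj : ∀ m ∈ D i, ∃ a : A, (a * e) • w = m) :
    ∃ f : (Ideal.span {e} : Ideal A) →ₗ[A] subquot (D i) (D (i - 1)), Function.Surjective f ∧
      HasFiltration A (LinearMap.ker f) fun X =>
        ∃ j, j + 1 < i ∧ Nonempty (X ≃ₗ[A] subquot (D (j + 1)) (D j)) := by
  refine exists_filtered_cover
    (φ := (LinearMap.toSpanSingleton A M w).domRestrict (Ideal.span {e} : Ideal A)) ?_ hD h0 ?_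
  · rw [← LinearMap.ker_eq_bot, LinearMap.ker_eq_bot']
    rintro ⟨a, ha⟩ h1
    obtain ⟨b, rfl⟩ := Ideal.mem_span_singleton'.1 ha
    exact Subtype.ext (hinj b h1)
  · apply le_antisymm
    · rintro _ ⟨⟨a, ha⟩, rfl⟩
      exact (D i).smul_mem a hw
    · intro m hm
      obtain ⟨a, rfl⟩ := hsurj m hm
      exact ⟨⟨a * e, Ideal.mul_mem_left _ _ (Ideal.mem_span_singleton_self e)⟩, rfl⟩

lemma hasMultiplicity_subquot_zero (hN : IsNoetherian A M) (hA : IsArtinian A M)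
    (V U : Submodule A M) {L : Type u} [AddCommGroup L] [Module A L] {e : A}
    (he : ∀ m ∈ V, e • m ∈ U) {v : L} (hv : e • v ≠ 0) : HasMultiplicity A (subquot V U) L 0 := by
  refine hasMultiplicity_zero (e := e) (fun v => ?_) hv
  obtain ⟨m, hm, rfl⟩ := exists_eq_subquotMk v
  rw [smul_subquotMk]
  exact (subquotMk_eq_zero_iff _).2 (he m hm)

lemma hasMultiplicity_subquot_one (hN : IsNoetherian A M) (hA : IsArtinian A M)
    (V U : Submodule A M) {L : Type u} [AddCommGroup L] [Module A L] (hL : IsSimpleModule A L)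
    (φ : V →ₗ[A] L) (hφ : ∀ m : V, (m : M) ∈ U → φ m = 0) (hs : Function.Surjective φ) {e : A}
    (he : ∀ m : V, φ m = 0 → e • (m : M) ∈ U) {v : L} (hv : e • v ≠ 0) :
    HasMultiplicity A (subquot V U) L 1 := by
  refine hasMultiplicity_one (φ := subquotLift φ hφ) (e := e) ?_ (fun v h0 => ?_) hv
  · intro v
    obtain ⟨m, rfl⟩ := hs v
    exact ⟨subquotMk U m m.2, rfl⟩
  · obtain ⟨m, hm, rfl⟩ := exists_eq_subquotMk v
    rw [smul_subquotMk]
    exact (subquotMk_eq_zero_iff _).2 (he ⟨m, hm⟩ h0)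

end Sections

/-- Idempotents of a subalgebra as elements of the algebra. -/
abbrev cR {k : Type v} {R : Type u} [Field k] [Ring R] [Algebra k R] {S : Subalgebra k R}
    {Λ₀ : Type w} (c : Λ₀ → S) : Λ₀ → R := fun x => (c x : R)

/-! ### Powers of the radical and Loewy lengths -/

section RadPow

variable {R : Type u} [Ring R]

lemma mkQ_eq_zero_iff {i : ℕ} {r : R} : (radPow R i).mkQ r = 0 ↔ r ∈ Ring.jacobson R ^ i := by
  rw [Submodule.mkQ_apply, Submodule.Quotient.mk_eq_zero]
  rfl

lemma op_smul_mkQ {i : ℕ} (r a : R) :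
    MulOpposite.op a • (radPow R i).mkQ r = (radPow R i).mkQ (r * a) := rfl

lemma mul_mem_jacobson_pow_add {a b : ℕ} {x y : R} (hx : x ∈ Ring.jacobson R ^ a)
    (hy : y ∈ Ring.jacobson R ^ b) : x * y ∈ Ring.jacobson R ^ (a + b) := by
  rw [Ideal.IsTwoSided.pow_add]
  exact Ideal.mul_mem_mul hx hy

lemma mem_jacobson_pow_one {x : R} : x ∈ Ring.jacobson R ^ 1 ↔ x ∈ Ring.jacobson R := by
  rw [Submodule.pow_one]

lemma mem_jacobson_pow_zero (x : R) : x ∈ Ring.jacobson R ^ 0 := by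
  rw [Submodule.pow_zero, Ideal.one_eq_top]
  trivial

lemma mem_jacobson_pow_of_le {a b : ℕ} (hab : a ≤ b) {x : R} (hx : x ∈ Ring.jacobson R ^ b) :
    x ∈ Ring.jacobson R ^ a := Ideal.pow_le_pow_right hab hx

end RadPow

namespace Splitting

variable {k : Type v} {R : Type u} [Field k] [Ring R] [Algebra k R] {S : Subalgebra k R}
  {τ : R →+* S} {Λ₀ : Type w} [Fintype Λ₀] {c f : Λ₀ → S} (h : Splitting S τ c f)
include h

lemma jacobson_pow_nilLength : Ring.jacobson R ^ nilLength R = ⊥ := by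
  obtain ⟨n, hn⟩ := h.nilpotent
  have : nilLength R ∈ {n | 0 < n ∧ Ring.jacobson R ^ n = ⊥} :=
    Nat.sInf_mem ⟨n + 1, Nat.succ_pos n, by rw [Submodule.pow_succ, hn, Ideal.bot_mul]⟩
  exact this.2

lemma coe_c_mul_c (x : Λ₀) : (c x : R) * c x = c x := congrArg Subtype.val (h.block.idem_c x)

/-- Annihilation of c x R by J^l can be tested on the generator c x. Nilpotency of J makes the set
defining the Loewy length nonempty, so its infimum is attained. -/
lemma len_le_iff (x : Λ₀) (l : ℕ) :
    len (cR c) x ≤ l ↔ ∀ r ∈ Ring.jacobson R ^ l, (c x : R) * r = 0 := by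
  have key : ∀ l, (∀ r ∈ Ring.jacobson R ^ l, ∀ y : Submodule.span Rᵐᵒᵖ {cR c x},
      MulOpposite.op r • y = 0) ↔ ∀ r ∈ Ring.jacobson R ^ l, (c x : R) * r = 0 := by
    intro l
    constructor
    · intro H r hr
      exact congrArg Subtype.val (H r hr ⟨c x, Submodule.mem_span_singleton_self _⟩)
    · rintro H r hr ⟨y, hy⟩
      obtain ⟨a, rfl⟩ := Submodule.mem_span_singleton.1 hy
      apply Subtype.ext
      change (c x : R) * a.unop * r = 0
      rw [mul_assoc]
      exact H _ (Ideal.mul_mem_left _ _ hr)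
  obtain ⟨n, hn⟩ := h.nilpotent
  have hmem : len (cR c) x ∈ {l | ∀ r ∈ Ring.jacobson R ^ l,
      ∀ y : Submodule.span Rᵐᵒᵖ {cR c x}, MulOpposite.op r • y = 0} :=
    Nat.sInf_mem ⟨n, (key n).2 fun r hr => by rw [hn, Ideal.mem_bot] at hr; rw [hr, mul_zero]⟩
  constructor
  · intro hl r hr
    exact (key _).1 hmem r (mem_jacobson_pow_of_le hl hr)
  · intro H
    exact Nat.sInf_le ((key l).2 H)

lemma len_le (x : Λ₀) : len (cR c) x ≤ nilLength R := by
  rw [h.len_le_iff, h.jacobson_pow_nilLength]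
  intro r hr
  rw [(Ideal.mem_bot).1 hr, mul_zero]

lemma one_le_len (x : Λ₀) : 1 ≤ len (cR c) x := by
  by_contra! hlt
  have := (h.len_le_iff x 0).1 (by omega) 1 (mem_jacobson_pow_zero 1)
  rw [mul_one] at this
  exact h.block.c_ne_zero x (Subtype.ext this)

omit h in
/-- The sum of the `c x` for which `c x R` has Loewy length at least `i`, as an element of `S`. -/
def _root_.ADR.cGeS (c : Λ₀ → S) (i : ℕ) : S :=
  open Classical in ∑ x ∈ Finset.univ.filter (fun x => i ≤ len (cR c) x), c x

omit h in
lemma _root_.ADR.coe_cGeS (i : ℕ) : (cGeS c i : R) = cGe (cR c) i := by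
  rw [cGeS, cGe, AddSubmonoidClass.coe_finsetSum]

lemma c_mul_cGeS_of_le {x : Λ₀} {i : ℕ} (hx : i ≤ len (cR c) x) : c x * cGeS c i = c x := by
  classical
  rw [cGeS, Finset.mul_sum, Finset.sum_eq_single x]
  · exact h.block.idem_c x
  · intro y _ hy
    exact h.complete.ortho (Ne.symm hy)
  · intro hx'
    exact (hx' (Finset.mem_filter.2 ⟨Finset.mem_univ x, hx⟩)).elim

lemma cGeS_central (i : ℕ) (s : S) : cGeS c i * s = s * cGeS c i := by
  rw [cGeS, Finset.sum_mul, Finset.mul_sum]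
  exact Finset.sum_congr rfl fun x _ => h.block.central x s

lemma cGeS_mul_cGeS {i j : ℕ} (hij : i ≤ j) : cGeS c i * cGeS c j = cGeS c j := by
  classical
  rw [h.cGeS_central]
  conv_lhs => rw [cGeS, Finset.sum_mul]
  refine Finset.sum_congr rfl fun x hx => h.c_mul_cGeS_of_le ?_
  exact hij.trans (Finset.mem_filter.1 hx).2

lemma cGeS_idem (i : ℕ) : cGeS c i * cGeS c i = cGeS c i := h.cGeS_mul_cGeS le_rfl

lemma coe_cGe_mul (i : ℕ) : cGe (cR c) i * cGe (cR c) i = cGe (cR c) i := by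
  rw [← coe_cGeS, ← Subalgebra.coe_mul, h.cGeS_idem]

omit h in
/-- An element of `c_{≥ i} S` all of whose block components of Loewy length at least `i` vanish. -/
lemma eq_zero_of_c_mul {i : ℕ} {s : S} (hs : cGeS c i * s = s)
    (H : ∀ x, i ≤ len (cR c) x → c x * s = 0) : s = 0 := by
  classical
  rw [← hs, cGeS, Finset.sum_mul]
  exact Finset.sum_eq_zero fun x hx => H x (Finset.mem_filter.1 hx).2

lemma tau_cGe (i : ℕ) : τ (cGe (cR c) i) = cGeS c i := by rw [← coe_cGeS, h.proj_coe]

/-- Otherwise c x J^j ⊆ J^(j+1), and since c x is idempotent this can be iterated: c x J^j ⊆ J^(j+m)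
for all m, so c x J^j = 0 and the Loewy length is at most j. -/
lemma exists_c_mul_notMem {x : Λ₀} {j : ℕ} (hj : j < len (cR c) x) :
    ∃ r ∈ Ring.jacobson R ^ j, (c x : R) * r ∉ Ring.jacobson R ^ (j + 1) := by
  by_contra! H
  have h1 : ∀ m, ∀ r ∈ Ring.jacobson R ^ (j + m), (c x : R) * r ∈ Ring.jacobson R ^ (j + m + 1) := by
    intro m r hr
    rw [Ideal.IsTwoSided.pow_add] at hr
    induction hr using Submodule.mul_induction_on' with
    | mem_mul_mem a ha b hb =>
      rw [← mul_assoc, show j + m + 1 = (j + 1) + m by omega]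
      exact mul_mem_jacobson_pow_add (H a ha) hb
    | add a _ b _ ha hb => rw [mul_add]; exact add_mem ha hb
  have h2 : ∀ m, ∀ r ∈ Ring.jacobson R ^ j, (c x : R) * r ∈ Ring.jacobson R ^ (j + m) := by
    intro m
    induction m with
    | zero => exact fun r hr => Ideal.mul_mem_left _ _ hr
    | succ m ih =>
      intro r hr
      have := h1 m _ (ih r hr)
      rwa [← mul_assoc, h.coe_c_mul_c] at this
  have h3 : len (cR c) x ≤ j := by
    rw [h.len_le_iff]
    intro r hr
    have := mem_jacobson_pow_of_le (Nat.le_add_left (nilLength R) j) (h2 (nilLength R) r hr)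
    rwa [h.jacobson_pow_nilLength, Ideal.mem_bot] at this
  omega

/-- An element of `c_{≥ i} R` whose class modulo `J^i` is annihilated by `J^j` with `j < i` lies in
the radical. -/
lemma mem_jacobson_of_mul_mem {i j : ℕ} (hij : j < i) {r : R} (hr : cGe (cR c) i * r = r)
    (H : ∀ a ∈ Ring.jacobson R ^ j, r * a ∈ Ring.jacobson R ^ i) : r ∈ Ring.jacobson R := by
  rw [← h.proj_eq_zero]
  have hs : cGeS c i * τ r = τ r := by rw [← h.tau_cGe, ← map_mul, hr]
  refine eq_zero_of_c_mul hs fun x hx => ?_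
  by_contra hne
  obtain ⟨a, ha, hna⟩ := h.exists_c_mul_notMem (x := x) (j := j) (by omega)
  -- As r ≡ τ r modulo J, every element of the ideal of S generated by τ r multiplies a into
  -- J^(j+1). If the component of τ r in the block x is nonzero, that ideal contains c x, against
  -- the choice of a.
  have h1 : ∀ t ∈ AddSubmonoid.closure {t | ∃ p q, t = p * τ r * q}, (t : R) * a ∈
      Ring.jacobson R ^ (j + 1) := by
    intro t ht
    induction ht using AddSubmonoid.closure_induction with
    | mem t ht =>
      obtain ⟨p, q, rfl⟩ := ht
      have hqa : (q : R) * a ∈ Ring.jacobson R ^ j := Ideal.mul_mem_left _ _ ha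
      have h2 : (τ r : R) * (q * a) ∈ Ring.jacobson R ^ (j + 1) := by
        have h3 : (r - τ r) * (q * a) ∈ Ring.jacobson R ^ (j + 1) := by
          rw [add_comm]
          exact mul_mem_jacobson_pow_add
            (mem_jacobson_pow_one.2 (sub_coe_proj_mem h.proj_coe h.proj_eq_zero r)) hqa
        have h4 := mem_jacobson_pow_of_le (Nat.succ_le_of_lt hij) (H _ hqa)
        have := sub_mem h4 h3
        rwa [sub_mul, sub_sub_cancel] at this
      have := Ideal.mul_mem_left _ (p : R) h2
      simpa only [Subalgebra.coe_mul, mul_assoc] using this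
    | zero => simp
    | add a b _ _ ha hb => rw [Subalgebra.coe_add, add_mul]; exact add_mem ha hb
  exact hna (h1 _ (h.block.c_mem_closure hne))

end Splitting

/-! ### The direct sum, its generators and its annihilator chain -/

section Gens

variable {R : Type u} [Ring R] {Λ₀ : Type w} [Fintype Λ₀] (c : Λ₀ → R)

/-- The generator of the `i`-th summand, as an element of the direct sum. -/
def g (i : Fin (nilLength R + 1)) : AuslanderModule c := Pi.single i (gen c i)

variable {c}

lemma coe_op_smul_gen (i : ℕ) (r : R) :
    ((MulOpposite.op r • gen c i : auslanderSummand c i) : R ⧸ radPow R i)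
      = (radPow R i).mkQ (cGe c i * r) := rfl

lemma op_smul_g (i : Fin (nilLength R + 1)) (r : R) :
    MulOpposite.op r • g c i = Pi.single i (MulOpposite.op r • gen c i) := by
  rw [g, ← Pi.single_smul]

lemma exists_eq_op_smul_gen {i : ℕ} (hc : cGe c i * cGe c i = cGe c i) (y : auslanderSummand c i) :
    ∃ r, cGe c i * r = r ∧ y = MulOpposite.op r • gen c i := by
  obtain ⟨y, hy⟩ := y
  obtain ⟨a, rfl⟩ := Submodule.mem_span_singleton.1 hy
  refine ⟨cGe c i * a.unop, by rw [← mul_assoc, hc], Subtype.ext ?_⟩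
  rw [coe_op_smul_gen, ← mul_assoc, hc]
  rfl

lemma op_smul_gen_eq_zero_iff {i : ℕ} {r : R} (hr : cGe c i * r = r) :
    MulOpposite.op r • gen c i = 0 ↔ r ∈ Ring.jacobson R ^ i := by
  rw [← mkQ_eq_zero_iff, ← hr, ← coe_op_smul_gen, hr, Submodule.coe_eq_zero]

lemma sum_g (m : AuslanderModule c) (r : Fin (nilLength R + 1) → R)
    (hr : ∀ i, m i = MulOpposite.op (r i) • gen c i) : m = ∑ i, MulOpposite.op (r i) • g c i := by
  simp only [op_smul_g, ← hr]
  exact (Finset.univ_sum_single m).symm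

variable (c) in
/-- The elements of the direct sum annihilated by `J^j`. -/
def annPow (j : ℕ) : Submodule (ADRAlgebra c) (AuslanderModule c) where
  carrier := {m | ∀ r ∈ Ring.jacobson R ^ j, MulOpposite.op r • m = 0}
  add_mem' := fun ha hb r hr => by rw [smul_add, ha r hr, hb r hr, add_zero]
  zero_mem' := fun r _ => smul_zero _
  smul_mem' := fun α m hm r hr => by
    rw [Module.End.smul_def, ← map_smul, hm r hr, map_zero]

lemma apply_mem_annPow {j : ℕ} {m : AuslanderModule c} (hm : m ∈ annPow c j) (α : ADRAlgebra c) :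
    α m ∈ annPow c j := (annPow c j).smul_mem α hm

lemma annPow_mono : Monotone (annPow c) := fun _ _ hij _ hm r hr =>
  hm r (mem_jacobson_pow_of_le hij hr)

lemma annPow_zero : annPow c 0 = ⊥ := by
  rw [eq_bot_iff]
  intro m hm
  have := hm 1 (mem_jacobson_pow_zero 1)
  rwa [MulOpposite.op_one, one_smul] at this

lemma op_smul_mem_annPow {j : ℕ} {m : AuslanderModule c} (hm : m ∈ annPow c j) (a : R) :
    MulOpposite.op a • m ∈ annPow c j := fun r hr => by
  rw [smul_smul, ← MulOpposite.op_mul]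
  exact hm _ (Ideal.mul_mem_left _ _ hr)

/-- Multiplication by J descends one step in the annihilator chain; this lets radical coefficients
factor through the preceding generator. -/
lemma op_smul_mem_annPow_of_mem {j : ℕ} {m : AuslanderModule c} (hm : m ∈ annPow c (j + 1)) {a : R}
    (ha : a ∈ Ring.jacobson R) : MulOpposite.op a • m ∈ annPow c j := fun r hr => by
  rw [smul_smul, ← MulOpposite.op_mul]
  refine hm _ ?_
  rw [add_comm]
  exact mul_mem_jacobson_pow_add (mem_jacobson_pow_one.2 ha) hr

lemma g_mem_annPow (i : Fin (nilLength R + 1)) : g c i ∈ annPow c i := fun r hr => by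
  rw [op_smul_g]
  have : MulOpposite.op r • gen c i = 0 := by
    apply Subtype.ext
    rw [coe_op_smul_gen]
    exact mkQ_eq_zero_iff.2 (Ideal.mul_mem_left _ _ hr)
  rw [this, Pi.single_zero]

/-- J^0 is the whole ring, so the summand of index 0 is only a placeholder. -/
lemma single_zero_index (y : auslanderSummand c 0) : y = 0 := by
  obtain ⟨y, hy⟩ := y
  apply Subtype.ext
  obtain ⟨r, rfl⟩ := Submodule.mkQ_surjective _ y
  exact mkQ_eq_zero_iff.2 (mem_jacobson_pow_zero r)

/-- The map from `R / J^i` sending `1` to an element annihilated by `J^i`. -/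
def liftOf (i : ℕ) (m : AuslanderModule c) (hm : m ∈ annPow c i) :
    (R ⧸ radPow R i) →ₗ[Rᵐᵒᵖ] AuslanderModule c :=
  (radPow R i).liftQ
    { toFun := fun r => MulOpposite.op r • m
      map_add' := fun a b => by rw [MulOpposite.op_add, add_smul]
      map_smul' := fun a r => by
        change MulOpposite.op (r * a.unop) • m = a • _
        rw [MulOpposite.op_mul, MulOpposite.op_unop, mul_smul] }
    (fun r hr => hm r hr)

lemma liftOf_mkQ (i : ℕ) (m : AuslanderModule c) (hm : m ∈ annPow c i) (r : R) :
    liftOf i m hm ((radPow R i).mkQ r) = MulOpposite.op r • m := rfl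

/-- The endomorphism sending the `i`-th generator to a given element, and the others to zero. -/
def homAt (i : Fin (nilLength R + 1)) (m : AuslanderModule c) (hm : m ∈ annPow c i) :
    ADRAlgebra c :=
  liftOf (i : ℕ) m hm ∘ₗ (auslanderSummand c i).subtype ∘ₗ
    LinearMap.proj (φ := fun i : Fin (nilLength R + 1) => auslanderSummand c i) i

/-- The map sends the class of 1 to m, but the generator is the class of c_{≥i}; hence the extra
factor, which disappears when m is fixed by c_{≥i}. -/
lemma homAt_g (i : Fin (nilLength R + 1)) (m : AuslanderModule c) (hm : m ∈ annPow c i) :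
    homAt i m hm (g c i) = MulOpposite.op (cGe c i) • m := by
  simp only [homAt, LinearMap.comp_apply, LinearMap.proj_apply, g, Pi.single_eq_same]
  exact liftOf_mkQ _ _ _ _

lemma homAt_g_of_ne {i j : Fin (nilLength R + 1)} (hij : j ≠ i) (m : AuslanderModule c)
    (hm : m ∈ annPow c i) : homAt i m hm (g c j) = 0 := by
  simp only [homAt, LinearMap.comp_apply, LinearMap.proj_apply, g, Pi.single_eq_of_ne hij.symm,
    map_zero]

lemma g_zero : g c 0 = 0 := by
  have : gen c ((0 : Fin (nilLength R + 1)) : ℕ) = 0 := single_zero_index _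
  rw [g, this, Pi.single_zero]

lemma exists_eq_sum_g (hc : ∀ i, cGe c i * cGe c i = cGe c i) (m : AuslanderModule c) :
    ∃ r : Fin (nilLength R + 1) → R, (∀ i : Fin (nilLength R + 1), cGe c i * r i = r i) ∧
      (∀ i, m i = MulOpposite.op (r i) • gen c i) ∧ m = ∑ i, MulOpposite.op (r i) • g c i := by
  choose r hr hm using fun i : Fin (nilLength R + 1) => exists_eq_op_smul_gen (hc i) (m i)
  exact ⟨r, hr, hm, sum_g m r hm⟩

lemma hom_ext_g (hc : ∀ i, cGe c i * cGe c i = cGe c i) {α β : ADRAlgebra c}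
    (h : ∀ i, α (g c i) = β (g c i)) : α = β := by
  refine LinearMap.ext fun m => ?_
  obtain ⟨r, -, -, hm⟩ := exists_eq_sum_g hc m
  rw [hm, map_sum, map_sum]
  exact Finset.sum_congr rfl fun i _ => by rw [map_smul, map_smul, h]

variable (c) in
/-- The multiples of the `i`-th generator by elements of `J^a`. -/
def radS (i a : ℕ) : AddSubgroup (auslanderSummand c i) where
  carrier := {y | ∃ r ∈ Ring.jacobson R ^ a, y = MulOpposite.op r • gen c i}
  add_mem' := by
    rintro _ _ ⟨r, hr, rfl⟩ ⟨s, hs, rfl⟩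
    exact ⟨r + s, add_mem hr hs, by rw [MulOpposite.op_add, add_smul]⟩
  zero_mem' := ⟨0, zero_mem _, by rw [MulOpposite.op_zero, zero_smul]⟩
  neg_mem' := by
    rintro _ ⟨r, hr, rfl⟩
    exact ⟨-r, neg_mem hr, by rw [MulOpposite.op_neg, neg_smul]⟩

lemma op_smul_mem_radS {i a b : ℕ} {y : auslanderSummand c i} (hy : y ∈ radS c i a) {r : R}
    (hr : r ∈ Ring.jacobson R ^ b) : MulOpposite.op r • y ∈ radS c i (a + b) := by
  obtain ⟨s, hs, rfl⟩ := hy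
  exact ⟨s * r, mul_mem_jacobson_pow_add hs hr, by rw [smul_smul, MulOpposite.op_mul]⟩

lemma mem_radS_zero (hc : ∀ i, cGe c i * cGe c i = cGe c i) {i : ℕ} (y : auslanderSummand c i) :
    y ∈ radS c i 0 := by
  obtain ⟨r, -, hr⟩ := exists_eq_op_smul_gen (hc i) y
  exact ⟨r, mem_jacobson_pow_zero r, hr⟩

end Gens

/-! ### The semisimple quotient of the Auslander–Dlab–Ringel algebra -/

namespace Splitting

variable {k : Type v} {R : Type u} [Field k] [Ring R] [Algebra k R] {S : Subalgebra k R}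
  {τ : R →+* S} {Λ₀ : Type w} [Fintype Λ₀] {c f : Λ₀ → S} (h : Splitting S τ c f)

/-- The projection of `R` onto the complement of its radical, as a semilinear map of right
modules. -/
def projₛₗ (τ : R →+* S) : R →ₛₗ[τ.op] S where
  toFun := τ
  map_add' := map_add τ
  map_smul' a r := map_mul τ r a.unop

include h in
lemma radPow_le_ker {i : ℕ} (hi : 1 ≤ i) : radPow R i ≤ LinearMap.ker (projₛₗ τ) := fun r hr =>
  (h.proj_eq_zero r).2 (mem_jacobson_pow_one.1 (mem_jacobson_pow_of_le hi hr))

/-- The `S`-component of the coefficient at the `i`-th generator. -/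
def θ (i : Fin (nilLength R + 1)) (hi : 1 ≤ (i : ℕ)) :
    AuslanderModule (cR c) →ₛₗ[τ.op] S :=
  (radPow R i).liftQ (projₛₗ τ) (h.radPow_le_ker hi) ∘ₛₗ ((auslanderSummand (cR c) i).subtype ∘ₗ
    LinearMap.proj (φ := fun i : Fin (nilLength R + 1) => auslanderSummand (cR c) i) i)

section
include h

lemma cGe_idem (i : ℕ) : cGe (cR c) i * cGe (cR c) i = cGe (cR c) i := h.coe_cGe_mul i

lemma θ_apply {i : Fin (nilLength R + 1)} (hi : 1 ≤ (i : ℕ)) {m : AuslanderModule (cR c)} {r : R}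
    (hr : m i = MulOpposite.op r • gen (cR c) i) : h.θ i hi m = cGeS c i * τ r := by
  change (radPow R i).liftQ (projₛₗ τ) (h.radPow_le_ker hi) (m i : R ⧸ radPow R i) = _
  rw [hr, coe_op_smul_gen, Submodule.mkQ_apply, Submodule.liftQ_apply]
  change τ _ = _
  rw [map_mul, h.tau_cGe]

lemma cGeS_mul_θ {i : Fin (nilLength R + 1)} (hi : 1 ≤ (i : ℕ)) (m : AuslanderModule (cR c)) :
    cGeS c i * h.θ i hi m = h.θ i hi m := by
  obtain ⟨r, -, hm, -⟩ := exists_eq_sum_g h.cGe_idem m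
  rw [h.θ_apply hi (hm i), ← mul_assoc, h.cGeS_idem]

lemma θ_op_smul {i : Fin (nilLength R + 1)} (hi : 1 ≤ (i : ℕ)) (a : R)
    (m : AuslanderModule (cR c)) : h.θ i hi (MulOpposite.op a • m) = h.θ i hi m * τ a :=
  (h.θ i hi).map_smulₛₗ _ _

lemma θ_g {i : Fin (nilLength R + 1)} (hi : 1 ≤ (i : ℕ)) : h.θ i hi (g (cR c) i) = cGeS c i := by
  rw [h.θ_apply (r := 1) hi (by rw [g, Pi.single_eq_same, MulOpposite.op_one, one_smul]), map_one,
    mul_one]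

lemma θ_eq_zero_iff {i : Fin (nilLength R + 1)} (hi : 1 ≤ (i : ℕ)) {m : AuslanderModule (cR c)} :
    h.θ i hi m = 0 ↔ m i ∈ radS (cR c) i 1 := by
  constructor
  · intro h0
    obtain ⟨r, hr, hm, -⟩ := exists_eq_sum_g h.cGe_idem m
    refine ⟨r i, ?_, hm i⟩
    rw [mem_jacobson_pow_one, ← h.proj_eq_zero]
    rwa [h.θ_apply hi (hm i), ← h.tau_cGe, ← map_mul, hr] at h0
  · rintro ⟨r, hr, hm⟩
    rw [h.θ_apply hi hm, (h.proj_eq_zero r).2 (mem_jacobson_pow_one.1 hr), mul_zero]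

lemma coeff_mem_jacobson {i : Fin (nilLength R + 1)} {j : ℕ} (hij : j < i)
    {m : AuslanderModule (cR c)} (hm : m ∈ annPow (cR c) j) {r : R}
    (hr : cGe (cR c) i * r = r) (hmr : m i = MulOpposite.op r • gen (cR c) i) :
    r ∈ Ring.jacobson R := by
  refine h.mem_jacobson_of_mul_mem hij hr fun a ha => ?_
  rw [← op_smul_gen_eq_zero_iff (c := cR c) (by rw [← mul_assoc, hr]), MulOpposite.op_mul, mul_smul,
    ← hmr]
  exact congrFun (hm a ha) i

lemma apply_mem_radS_of_mem_annPow {i : Fin (nilLength R + 1)} {j : ℕ} (hij : j < i)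
    {m : AuslanderModule (cR c)} (hm : m ∈ annPow (cR c) j) : m i ∈ radS (cR c) i 1 := by
  obtain ⟨r, hr, hmr, -⟩ := exists_eq_sum_g h.cGe_idem m
  exact ⟨r i, mem_jacobson_pow_one.2 (h.coeff_mem_jacobson hij hm (hr i) (hmr i)), hmr i⟩

lemma θ_eq_zero_of_mem_annPow {i : Fin (nilLength R + 1)} (hi : 1 ≤ (i : ℕ)) {j : ℕ} (hij : j < i)
    {m : AuslanderModule (cR c)} (hm : m ∈ annPow (cR c) j) : h.θ i hi m = 0 :=
  (h.θ_eq_zero_iff hi).2 (h.apply_mem_radS_of_mem_annPow hij hm)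

/-- Write m = Σ g_j r_j. For j < i the element α g_j is killed by J^j, so θ_i vanishes on it; for j
> i the coefficient r_j lies in J because m is killed by J^i. Only j = i survives. This is the
source of the multiplicativity of `π`. -/
lemma θ_apply_apply {i : Fin (nilLength R + 1)} (hi : 1 ≤ (i : ℕ)) (α : ADRAlgebra (cR c))
    {m : AuslanderModule (cR c)} (hm : m ∈ annPow (cR c) i) :
    h.θ i hi (α m) = h.θ i hi (α (g (cR c) i)) * h.θ i hi m := by
  obtain ⟨r, hr, hmr, hsum⟩ := exists_eq_sum_g h.cGe_idem m
  have h1 : h.θ i hi (α m) = h.θ i hi (α (g (cR c) i)) * τ (r i) := by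
    rw [hsum, map_sum, map_sum, Finset.sum_eq_single i]
    · rw [map_smul, h.θ_op_smul]
    · intro j _ hj
      rw [map_smul, h.θ_op_smul]
      rcases lt_or_gt_of_ne hj with hj | hj
      · rw [h.θ_eq_zero_of_mem_annPow hi hj (apply_mem_annPow (g_mem_annPow j) α), zero_mul]
      · rw [(h.proj_eq_zero _).2 (h.coeff_mem_jacobson hj hm (hr j) (hmr j)), mul_zero]
    · simp
  rw [h1, h.θ_apply hi (hmr i), ← h.tau_cGe, ← map_mul, hr]

end

/-- The index of the summand belonging to a label. -/
def idx (x : Label (cR c)) : Fin (nilLength R + 1) :=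
  ⟨x.1.1, Nat.lt_succ_of_le (x.2.2.trans (h.len_le _))⟩

include h in
lemma one_le_idx (x : Label (cR c)) : 1 ≤ (h.idx x : ℕ) := x.2.1

/-- The action of the algebra on the generator of the label `x`, modulo lower terms. -/
def π (x : Label (cR c)) : ADRAlgebra (cR c) →+ S where
  toFun α := c x.1.2 * h.θ (h.idx x) (h.one_le_idx x) (α (g (cR c) (h.idx x)))
  map_zero' := by rw [LinearMap.zero_apply, map_zero, mul_zero]
  map_add' α β := by rw [LinearMap.add_apply, map_add, mul_add]

/-- The multiplication of the generator of the label `x` by elements of the block of `S`. -/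
def σ (x : Label (cR c)) : S →+ ADRAlgebra (cR c) where
  toFun s := homAt (h.idx x) (MulOpposite.op ((c x.1.2 * s : S) : R) • g (cR c) (h.idx x))
    (op_smul_mem_annPow (g_mem_annPow _) _)
  map_zero' := by
    refine hom_ext_g h.cGe_idem fun i => ?_
    rcases eq_or_ne i (h.idx x) with rfl | hi
    · rw [homAt_g, mul_zero, ZeroMemClass.coe_zero, MulOpposite.op_zero, zero_smul, smul_zero,
        LinearMap.zero_apply]
    · rw [homAt_g_of_ne hi, LinearMap.zero_apply]
  map_add' s t := by
    refine hom_ext_g h.cGe_idem fun i => ?_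
    rw [LinearMap.add_apply]
    rcases eq_or_ne i (h.idx x) with rfl | hi
    · simp only [homAt_g, mul_add, Subalgebra.coe_add, MulOpposite.op_add, add_smul, smul_add]
    · simp only [homAt_g_of_ne hi, add_zero]

section
include h

lemma π_apply (x : Label (cR c)) (α : ADRAlgebra (cR c)) :
    h.π x α = c x.1.2 * h.θ (h.idx x) (h.one_le_idx x) (α (g (cR c) (h.idx x))) := rfl

lemma c_mul_cGeS (x : Label (cR c)) : c x.1.2 * cGeS c (h.idx x) = c x.1.2 :=
  h.c_mul_cGeS_of_le x.2.2

lemma σ_g (x : Label (cR c)) (s : S) : h.σ x s (g (cR c) (h.idx x)) =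
    MulOpposite.op ((c x.1.2 * s : S) : R) • g (cR c) (h.idx x) := by
  change homAt _ _ _ _ = _
  rw [homAt_g, smul_smul, ← MulOpposite.op_mul, ← coe_cGeS, ← Subalgebra.coe_mul, mul_assoc,
    ← h.cGeS_central, ← mul_assoc, h.c_mul_cGeS]

lemma σ_g_of_ne (x : Label (cR c)) (s : S) {i : Fin (nilLength R + 1)} (hi : i ≠ h.idx x) :
    h.σ x s (g (cR c) i) = 0 := homAt_g_of_ne hi _ _

lemma θ_g_eq_zero {α : ADRAlgebra (cR c)} (hα : ∀ x, h.π x α = 0) {i : Fin (nilLength R + 1)}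
    (hi : 1 ≤ (i : ℕ)) : h.θ i hi (α (g (cR c) i)) = 0 :=
  eq_zero_of_c_mul (h.cGeS_mul_θ hi _) fun x hx => hα ⟨(i, x), hi, hx⟩

lemma isNilpotent_of_π {α : ADRAlgebra (cR c)} (hα : ∀ x, h.π x α = 0) : IsNilpotent α := by
  have hg : ∀ i j : Fin (nilLength R + 1), j ≤ i → α (g (cR c) j) i ∈ radS (cR c) i 1 := by
    intro i j hji
    rcases Nat.eq_zero_or_pos (i : ℕ) with hi | hi
    · obtain rfl : i = 0 := Fin.ext hi
      rw [single_zero_index (α (g (cR c) j) (0 : Fin (nilLength R + 1)))]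
      exact zero_mem _
    · rcases hji.lt_or_eq with hji | rfl
      · exact h.apply_mem_radS_of_mem_annPow hji (apply_mem_annPow (g_mem_annPow j) α)
      · exact (h.θ_eq_zero_iff hi).1 (h.θ_g_eq_zero hα hi)
  -- In P a t all coefficients lie in J^a, and those of index ≥ t even in J^(a+1). Applying α lowers
  -- t by one: for i ≥ t, terms with j > t already have coefficient in J^(a+1), and terms with j ≤ t
  -- ≤ i gain a factor in J from `hg`. At t = nilLength R + 1 the second condition is vacuous, so
  -- that many applications of α raise a by one.
  let P : ℕ → ℕ → Set (AuslanderModule (cR c)) := fun a t => {m |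
    (∀ i : Fin (nilLength R + 1), m i ∈ radS (cR c) i a) ∧
      ∀ i : Fin (nilLength R + 1), t ≤ i → m i ∈ radS (cR c) i (a + 1)}
  have step : ∀ a t m, m ∈ P a (t + 1) → α m ∈ P a t := by
    rintro a t m ⟨h1, h2⟩
    have h3 : ∀ i : Fin (nilLength R + 1), ∃ r ∈ Ring.jacobson R ^ a,
        (t + 1 ≤ (i : ℕ) → r ∈ Ring.jacobson R ^ (a + 1)) ∧ m i = MulOpposite.op r • gen (cR c) i := by
      intro i
      by_cases hi : t + 1 ≤ (i : ℕ)
      · obtain ⟨r, hr, hm⟩ := h2 i hi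
        exact ⟨r, mem_jacobson_pow_of_le (Nat.le_succ a) hr, fun _ => hr, hm⟩
      · obtain ⟨r, hr, hm⟩ := h1 i
        exact ⟨r, hr, fun hi' => absurd hi' hi, hm⟩
    choose r hr hr' hm using h3
    have hα' : ∀ i, α m i = ∑ j, MulOpposite.op (r j) • α (g (cR c) j) i := by
      intro i
      conv_lhs => rw [sum_g m r hm, map_sum, Finset.sum_apply]
      exact Finset.sum_congr rfl fun j _ => by rw [map_smul, Pi.smul_apply]
    refine ⟨fun i => ?_, fun i hi => ?_⟩
    · rw [hα']
      refine sum_mem fun j _ => ?_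
      have := op_smul_mem_radS (mem_radS_zero h.cGe_idem (α (g (cR c) j) i)) (hr j)
      rwa [zero_add] at this
    · rw [hα']
      refine sum_mem fun j _ => ?_
      by_cases hj : t + 1 ≤ (j : ℕ)
      · have := op_smul_mem_radS (mem_radS_zero h.cGe_idem (α (g (cR c) j) i)) (hr' j hj)
        rwa [zero_add] at this
      · have := op_smul_mem_radS (hg i j (Fin.le_def.2 (by omega))) (hr j)
        rwa [add_comm 1 a] at this
  have step' : ∀ a t m, m ∈ P a t → (α ^ t) m ∈ P a 0 := by
    intro a t
    induction t with
    | zero => exact fun m hm => hm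
    | succ t ih =>
      intro m hm
      rw [pow_succ, Module.End.mul_apply]
      exact ih _ (step a t m hm)
  have key : ∀ a m, ∀ i : Fin (nilLength R + 1),
      ((α ^ (nilLength R + 1)) ^ a) m i ∈ radS (cR c) i a := by
    intro a m
    induction a with
    | zero => exact fun i => mem_radS_zero h.cGe_idem _
    | succ a ih =>
      intro i
      rw [pow_succ', Module.End.mul_apply]
      exact (step' a (nilLength R + 1) _
        ⟨ih, fun i hi => absurd hi (by have := i.2; omega)⟩).2 i (Nat.zero_le _)
  refine ⟨(nilLength R + 1) * nilLength R, LinearMap.ext fun m => funext fun i => ?_⟩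
  rw [pow_mul]
  obtain ⟨r, hr, hm⟩ := key (nilLength R) m i
  rw [h.jacobson_pow_nilLength, Ideal.mem_bot] at hr
  rw [hm, hr, MulOpposite.op_zero, zero_smul]
  rfl

/-- 1 is the sum of σ x (c λ) over all labels x = (i, λ), since c_{≥i} is the sum of the c λ for
which (i, λ) is a label. -/
lemma one_mem_closure :
    (1 : ADRAlgebra (cR c)) ∈ AddSubmonoid.closure (Set.range fun x => h.σ x (c x.1.2)) := by
  classical
  have key : (1 : ADRAlgebra (cR c)) = ∑ i : Fin (nilLength R + 1), ∑ x : Λ₀,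
      if hx : 1 ≤ (i : ℕ) ∧ (i : ℕ) ≤ len (cR c) x then h.σ ⟨(i, x), hx⟩ (c x) else 0 := by
    refine hom_ext_g h.cGe_idem fun j => ?_
    rw [Module.End.one_apply, LinearMap.sum_apply, Finset.sum_eq_single j]
    · rcases Nat.eq_zero_or_pos (j : ℕ) with hj | hj
      · obtain rfl : j = 0 := Fin.ext hj
        rw [g_zero, map_zero]
      · have h1 : ∀ x : Λ₀, (if hx : 1 ≤ (j : ℕ) ∧ (j : ℕ) ≤ len (cR c) x
            then h.σ ⟨(j, x), hx⟩ (c x) else 0 : ADRAlgebra (cR c)) (g (cR c) j) =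
            if (j : ℕ) ≤ len (cR c) x then MulOpposite.op (c x : R) • g (cR c) j else 0 := by
          intro x
          by_cases hx : (j : ℕ) ≤ len (cR c) x
          · rw [dif_pos ⟨hj, hx⟩, if_pos hx]
            have := h.σ_g ⟨((j : ℕ), x), hj, hx⟩ (c x)
            rw [h.block.idem_c x] at this
            exact this
          · rw [dif_neg (fun h => hx h.2), if_neg hx, LinearMap.zero_apply]
        rw [LinearMap.sum_apply, Finset.sum_congr rfl fun x _ => h1 x, ← Finset.sum_filter,
          ← Finset.sum_smul]
        have h2 : ∑ x ∈ Finset.univ.filter (fun x => (j : ℕ) ≤ len (cR c) x),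
            MulOpposite.op (c x : R) = MulOpposite.op (cGe (cR c) j) := by
          rw [cGe, Finset.op_sum]
        rw [h2, op_smul_g]
        have h3 : MulOpposite.op (cGe (cR c) j) • gen (cR c) j = gen (cR c) j := by
          apply Subtype.ext
          rw [coe_op_smul_gen, h.cGe_idem]
          rfl
        rw [h3, g]
    · intro i _ hij
      rw [LinearMap.sum_apply]
      refine Finset.sum_eq_zero fun x _ => ?_
      by_cases hx : 1 ≤ (i : ℕ) ∧ (i : ℕ) ≤ len (cR c) x
      · rw [dif_pos hx]
        exact h.σ_g_of_ne _ _ hij.symm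
      · rw [dif_neg hx, LinearMap.zero_apply]
    · simp
  rw [key]
  refine sum_mem fun i _ => sum_mem fun x _ => ?_
  by_cases hx : 1 ≤ (i : ℕ) ∧ (i : ℕ) ≤ len (cR c) x
  · rw [dif_pos hx]
    exact AddSubmonoid.subset_closure ⟨⟨(i, x), hx⟩, rfl⟩
  · rw [dif_neg hx]
    exact zero_mem _

lemma topData : TopData (fun x : Label (cR c) => c x.1.2) (fun x => f x.1.2) h.π h.σ where
  block := h.block.comp fun x : Label (cR c) => x.1.2
  π_mul x α β := by
    rw [π_apply, Module.End.mul_apply,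
      h.θ_apply_apply (h.one_le_idx x) α (apply_mem_annPow (g_mem_annPow _) β),
      π_apply, π_apply, mul_assoc, ← mul_assoc _ (c x.1.2), ← h.block.central, ← mul_assoc,
      ← mul_assoc, ← mul_assoc, h.block.idem_c, mul_assoc]
  π_one x := by rw [π_apply, Module.End.one_apply, h.θ_g, h.c_mul_cGeS]
  σ_mul x s t := by
    refine hom_ext_g h.cGe_idem fun i => ?_
    rw [Module.End.mul_apply]
    rcases eq_or_ne i (h.idx x) with rfl | hi
    · rw [h.σ_g, h.σ_g, map_smul, h.σ_g, smul_smul, ← MulOpposite.op_mul, ← Subalgebra.coe_mul,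
        mul_assoc, ← mul_assoc s, ← h.block.central, ← mul_assoc, ← mul_assoc, ← mul_assoc,
        h.block.idem_c]
    · rw [h.σ_g_of_ne x _ hi, h.σ_g_of_ne x _ hi, map_zero]
  π_σ x s := by
    rw [π_apply, h.σ_g, h.θ_op_smul, h.θ_g, h.proj_coe, ← mul_assoc, h.c_mul_cGeS, ← mul_assoc,
      h.block.idem_c]
  π_σ_ne x y s hxy := by
    rw [π_apply]
    by_cases hi : h.idx x = h.idx y
    · have hne : x.1.2 ≠ y.1.2 := fun he => hxy (Subtype.ext (Prod.ext (congrArg Fin.val hi) he))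
      have hg : h.σ y s (g (cR c) (h.idx x)) =
          MulOpposite.op ((c y.1.2 * s : S) : R) • g (cR c) (h.idx x) := by rw [hi, h.σ_g]
      rw [hg, h.θ_op_smul, h.proj_coe, ← mul_assoc, h.block.central, mul_assoc, ← mul_assoc (c x.1.2),
        h.complete.ortho hne, zero_mul, mul_zero]
    · rw [h.σ_g_of_ne _ _ hi, map_zero, mul_zero]
  one_mem := h.one_mem_closure
  nil α hα := h.isNilpotent_of_π hα

end

end Splitting

/-! ### Equivalent idempotents, labels and levels -/

section

lemma IdemEquiv.exists_smul_ne_zero {A V : Type*} [Ring A] [AddCommGroup V] [Module A V] {e f : A}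
    (h : IdemEquiv e f) (he : IsIdempotentElem e) (hv : ∃ v : V, e • v ≠ 0) :
    ∃ v : V, f • v ≠ 0 := by
  obtain ⟨a, b, rfl, rfl⟩ := h
  obtain ⟨v, hv⟩ := hv
  refine ⟨b • v, fun h0 => hv ?_⟩
  rw [← he, show a * b * (a * b) = a * (b * a * b) by simp only [mul_assoc], mul_smul, mul_smul,
    h0, smul_zero]

lemma IdemEquiv.symm {A : Type*} [Ring A] {e f : A} (h : IdemEquiv e f) : IdemEquiv f e := by
  obtain ⟨a, b, h1, h2⟩ := h
  exact ⟨b, a, h2, h1⟩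

/-- Idempotent endomorphisms with isomorphic images are equivalent. -/
lemma idemEquiv_of_range_equiv {Q N : Type*} [Ring Q] [AddCommGroup N] [Module Q N]
    {e f : Module.End Q N} (he : IsIdempotentElem e) (hf : IsIdempotentElem f)
    (φ : LinearMap.range e ≃ₗ[Q] LinearMap.range f) : IdemEquiv e f := by
  have hr : ∀ {e : Module.End Q N}, IsIdempotentElem e → ∀ y : LinearMap.range e,
      e.rangeRestrict (y : N) = y := by
    rintro e he ⟨_, x, rfl⟩
    exact Subtype.ext (LinearMap.congr_fun he x)
  refine ⟨(LinearMap.range e).subtype ∘ₗ φ.symm.toLinearMap ∘ₗ f.rangeRestrict,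
    (LinearMap.range f).subtype ∘ₗ φ.toLinearMap ∘ₗ e.rangeRestrict,
    LinearMap.ext fun x => ?_, LinearMap.ext fun x => ?_⟩
  · change e x = (φ.symm (f.rangeRestrict ((φ (e.rangeRestrict x) : LinearMap.range f) : N)) : N)
    rw [hr hf, LinearEquiv.symm_apply_apply]
    rfl
  · change f x = (φ (e.rangeRestrict ((φ.symm (f.rangeRestrict x) : LinearMap.range e) : N)) : N)
    rw [hr he, LinearEquiv.apply_symm_apply]
    rfl

end

section Proj

variable {R : Type u} [Ring R] {Λ₀ : Type w} [Fintype Λ₀] {c : Λ₀ → R}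

lemma proj_apply (i : Fin (nilLength R + 1)) (m : AuslanderModule c) :
    proj c i m = Pi.single i (m i) := rfl

lemma proj_g (i : Fin (nilLength R + 1)) : proj c i (g c i) = g c i := by
  rw [proj_apply, g, Pi.single_eq_same]

lemma proj_g_of_ne {i j : Fin (nilLength R + 1)} (hij : j ≠ i) : proj c i (g c j) = 0 := by
  rw [proj_apply, g, Pi.single_eq_of_ne hij.symm, Pi.single_zero]

variable (c) in
/-- The elements of the direct sum annihilated by `J^j` and fixed by an element of `R`. -/
def annFix (j : ℕ) (e : R) : Submodule (ADRAlgebra c) (AuslanderModule c) :=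
  annPow c j ⊓
  { carrier := {m | MulOpposite.op e • m = m}
    add_mem' := fun {a b} ha hb => by
      rw [Set.mem_ofPred_eq] at *
      rw [smul_add, ha, hb]
    zero_mem' := smul_zero _
    smul_mem' := fun α m hm => by
      rw [Set.mem_ofPred_eq] at *
      rw [Module.End.smul_def, ← map_smul, hm] }

lemma annFix_mono (e : R) : Monotone fun j => annFix c j e := fun _ _ hij _ hm =>
  ⟨annPow_mono hij hm.1, hm.2⟩

lemma annFix_zero (e : R) : annFix c 0 e = ⊥ := by
  rw [eq_bot_iff, ← annPow_zero]
  exact inf_le_left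

end Proj

namespace Splitting

variable {k : Type v} {R : Type u} [Field k] [Ring R] [Algebra k R] {S : Subalgebra k R}
  {τ : R →+* S} {Λ₀ : Type w} [Fintype Λ₀] {c f : Λ₀ → S} (h : Splitting S τ c f)
include h

lemma σ_apply (x : Label (cR c)) (s : S) {m : AuslanderModule (cR c)} {r : R}
    (hr : m (h.idx x) = MulOpposite.op r • gen (cR c) (h.idx x)) :
    h.σ x s m = MulOpposite.op ((c x.1.2 * s : S) * r) • g (cR c) (h.idx x) := by
  have key : ∀ m' : AuslanderModule (cR c), m' (h.idx x) = 0 → h.σ x s m' = 0 := by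
    intro m' hm'
    obtain ⟨r, hr, hmr, hsum⟩ := exists_eq_sum_g h.cGe_idem m'
    rw [hsum, map_sum]
    refine Finset.sum_eq_zero fun j _ => ?_
    rw [map_smul]
    rcases eq_or_ne j (h.idx x) with rfl | hj
    · rw [← map_smul, op_smul_g, ← hmr, hm', Pi.single_zero, map_zero]
    · rw [h.σ_g_of_ne x s hj, smul_zero]
  have h1 := key (m - MulOpposite.op r • g (cR c) (h.idx x)) (by
    rw [Pi.sub_apply, hr, op_smul_g, Pi.single_eq_same, sub_self])
  rw [map_sub, sub_eq_zero] at h1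
  rw [h1, map_smul, h.σ_g, smul_smul, MulOpposite.op_mul]

lemma range_equiv (p : Label (cR c)) :
    Nonempty (LinearMap.range (h.σ p (c p.1.2)) ≃ₗ[Rᵐᵒᵖ] cyc (cR c p.1.2) p.1.1) := by
  let ψ : AuslanderModule (cR c) →ₗ[Rᵐᵒᵖ] R ⧸ radPow R p.1.1 :=
    (auslanderSummand (cR c) (h.idx p)).subtype ∘ₗ
      LinearMap.proj (φ := fun i : Fin (nilLength R + 1) => auslanderSummand (cR c) i) (h.idx p)
  have hψ : ∀ r : R, ψ (MulOpposite.op r • g (cR c) (h.idx p)) =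
      (radPow R p.1.1).mkQ (cGe (cR c) (h.idx p) * r) := by
    intro r
    change (auslanderSummand (cR c) (h.idx p)).subtype
      ((MulOpposite.op r • g (cR c) (h.idx p)) (h.idx p)) = _
    rw [op_smul_g, Pi.single_eq_same]
    rfl
  have hc : cGe (cR c) (h.idx p) * cR c p.1.2 = cR c p.1.2 := by
    rw [← coe_cGeS, ← Subalgebra.coe_mul, h.cGeS_central, h.c_mul_cGeS]
  have hσ : ∀ m : AuslanderModule (cR c), ∃ r, h.σ p (c p.1.2) m =
      MulOpposite.op (cR c p.1.2 * r) • g (cR c) (h.idx p) := by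
    intro m
    obtain ⟨r, -, hr⟩ := exists_eq_op_smul_gen (h.cGe_idem _) (m (h.idx p))
    exact ⟨r, by rw [h.σ_apply p _ hr, h.block.idem_c]⟩
  have hinj : Function.Injective (ψ.domRestrict (LinearMap.range (h.σ p (c p.1.2)))) := by
    rw [← LinearMap.ker_eq_bot, LinearMap.ker_eq_bot']
    rintro ⟨_, m, rfl⟩ hm
    apply Subtype.ext
    obtain ⟨r, hr⟩ := hσ m
    change ψ (h.σ p (c p.1.2) m) = 0 at hm
    rw [hr] at hm
    change (h.σ p (c p.1.2)) m = 0
    rw [hr, op_smul_g]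
    have : MulOpposite.op (cR c p.1.2 * r) • gen (cR c) (h.idx p) = 0 := by
      apply Subtype.ext
      rw [coe_op_smul_gen]
      rwa [hψ] at hm
    rw [this, Pi.single_zero]
  refine ⟨(LinearEquiv.ofInjective _ hinj).trans (LinearEquiv.ofEq _ _ ?_)⟩
  apply le_antisymm
  · rintro _ ⟨⟨_, m, rfl⟩, rfl⟩
    obtain ⟨r, hr⟩ := hσ m
    change ψ (h.σ p (c p.1.2) m) ∈ _
    rw [hr, hψ, ← mul_assoc, hc, ← op_smul_mkQ]
    exact Submodule.smul_mem _ _ (Submodule.mem_span_singleton_self _)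
  · rw [cyc, Submodule.span_singleton_le_iff_mem]
    refine ⟨⟨_, g (cR c) (h.idx p), rfl⟩, ?_⟩
    rw [LinearMap.domRestrict_apply]
    change ψ (h.σ p (c p.1.2) (g (cR c) (h.idx p))) = _
    rw [h.σ_g, h.block.idem_c, hψ]
    exact congrArg _ hc

lemma isIdempotentElem_σ_c (p : Label (cR c)) : IsIdempotentElem (h.σ p (c p.1.2)) := by
  rw [IsIdempotentElem, ← h.topData.σ_mul, h.block.idem_c]

/-- Idempotents with isomorphic images are equivalent, and equivalent idempotents act nontrivially
on the same modules, so only σ p (c λ) has to be tested. -/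
lemma matchesLabels : MatchesLabels (cR c) h.topData.simple := by
  rintro p q e he ⟨φ⟩
  change (∃ v : h.topData.TopModule q, e • v ≠ 0) ↔ _
  obtain ⟨ψ⟩ := h.range_equiv p
  have hef : IdemEquiv e (h.σ p (c p.1.2)) :=
    idemEquiv_of_range_equiv he (h.isIdempotentElem_σ_c p) (φ.trans ψ.symm)
  constructor
  · intro hv
    obtain ⟨v, hv⟩ := hef.exists_smul_ne_zero he hv
    by_contra hne
    exact hv (h.topData.σ_smul_eq_zero hne _ v)
  · rintro rfl
    have h1 : h.σ q (f q.1.2) = h.σ q (f q.1.2) * h.σ q (c q.1.2) := by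
      rw [← h.topData.σ_mul, h.block.f_mul_c]
    have h2 := h.topData.σ_f_smul_ne_zero q
    rw [h1, mul_smul] at h2
    exact hef.symm.exists_smul_ne_zero (V := h.topData.TopModule q) (h.isIdempotentElem_σ_c q)
      ⟨_, fun h0 => h2 ((congrArg _ h0).trans (smul_zero _))⟩

lemma proj_mul_σ (x : Label (cR c)) (s : S) : proj (cR c) (h.idx x) * h.σ x s = h.σ x s := by
  refine hom_ext_g h.cGe_idem fun i => ?_
  rw [Module.End.mul_apply]
  rcases eq_or_ne i (h.idx x) with rfl | hi
  · rw [h.σ_g, map_smul, proj_g]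
  · rw [h.σ_g_of_ne x s hi, map_zero]

lemma σ_mul_proj (x : Label (cR c)) (s : S) : h.σ x s * proj (cR c) (h.idx x) = h.σ x s := by
  refine hom_ext_g h.cGe_idem fun i => ?_
  rw [Module.End.mul_apply]
  rcases eq_or_ne i (h.idx x) with rfl | hi
  · rw [proj_g]
  · rw [proj_g_of_ne hi, h.σ_g_of_ne x s hi, map_zero]

lemma π_proj_of_ne (x : Label (cR c)) {i : Fin (nilLength R + 1)} (hi : h.idx x ≠ i) :
    h.π x (proj (cR c) i) = 0 := by
  rw [π_apply, proj_g_of_ne hi, map_zero, mul_zero]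

/-- For i other than the first entry of p, the projection onto the i-th summand has π p equal to
zero, so no idempotent under it acts nontrivially on the module of p. The set of admissible levels
is therefore a singleton. -/
lemma idemLevel_simple (p : Label (cR c)) :
    idemLevel (proj (cR c)) (h.topData.simple p) = p.1.1 := by
  rw [idemLevel]
  refine (congrArg sInf (Set.ext fun n => ?_)).trans (csInf_singleton p.1.1)
  rw [Set.mem_singleton_iff]
  constructor
  · rintro ⟨i, rfl, e', he', hie, -, e, ⟨hep, hv⟩, hee⟩
    obtain ⟨v, hv⟩ := hee.symm.exists_smul_ne_zero hep.idem hv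
    by_contra hne
    apply hv
    have hi : h.idx p ≠ i := fun h1 => hne (congrArg Fin.val h1).symm
    refine h.topData.val_injective p ?_
    refine (h.topData.val_smul p e' v).trans ?_
    rw [← hie, h.topData.π_mul, h.π_proj_of_ne p hi, zero_mul, zero_mul]
    exact (map_zero (h.topData.val p)).symm
  · rintro rfl
    exact ⟨h.idx p, rfl, h.σ p (f p.1.2), h.topData.idem p, h.proj_mul_σ p _, h.σ_mul_proj p _,
      h.σ p (f p.1.2), h.topData.isPrimitiveFor_topModule p, h.σ p (f p.1.2), h.σ p (f p.1.2),
      (h.topData.idem p).symm, (h.topData.idem p).symm⟩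

/-! ### The idempotent order, standard modules and quasi-heredity -/

lemma idemLE_iff {x y : Label (cR c)} :
    idemLE (proj (cR c)) h.topData.simple x y ↔ x = y ∨ y.1.1 < x.1.1 := by
  rw [idemLE, h.idemLevel_simple, h.idemLevel_simple]

/-- The hypothesis says that f times the coefficient of m at the index of y is radical, so the image
lies one step lower in the annihilator chain. -/
lemma σ_f_apply_mem (y : Label (cR c)) {m : AuslanderModule (cR c)}
    (hm : f y.1.2 * h.θ (h.idx y) (h.one_le_idx y) m = 0) :
    h.σ y (f y.1.2) m ∈ annPow (cR c) (y.1.1 - 1) := by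
  obtain ⟨r, hr, hmr⟩ := exists_eq_op_smul_gen (h.cGe_idem _) (m (h.idx y))
  rw [h.σ_apply y _ hmr, h.block.c_mul_f]
  refine op_smul_mem_annPow_of_mem ?_ ?_
  · have := g_mem_annPow (c := cR c) (h.idx y)
    rwa [Nat.sub_add_cancel y.2.1]
  · rw [← h.proj_eq_zero, map_mul, h.proj_coe]
    rwa [h.θ_apply _ hmr, ← h.tau_cGe, ← map_mul, hr] at hm

lemma θ_mul_f {x : Label (cR c)} {m : AuslanderModule (cR c)}
    (hm : m ∈ annFix (cR c) x.1.1 (f x.1.2)) {i : Fin (nilLength R + 1)} (hi : 1 ≤ (i : ℕ)) :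
    h.θ i hi m * f x.1.2 = h.θ i hi m := by
  have := h.θ_op_smul hi (f x.1.2 : R) m
  rw [hm.2, h.proj_coe] at this
  exact this.symm

lemma c_mul_θ {x : Label (cR c)} {m : AuslanderModule (cR c)}
    (hm : m ∈ annFix (cR c) x.1.1 (f x.1.2)) {i : Fin (nilLength R + 1)} (hi : 1 ≤ (i : ℕ)) :
    c x.1.2 * h.θ i hi m = h.θ i hi m := by
  rw [h.block.central, ← h.θ_mul_f hm hi, mul_assoc, h.block.f_mul_c]

omit h in
/-- The standard modules. -/
def _root_.ADR.standard (c f : Λ₀ → S) (x : Label (cR c)) : ModuleCat.{u} (ADRAlgebra (cR c)) :=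
  subquot (annFix (cR c) x.1.1 (f x.1.2)) (annFix (cR c) (x.1.1 - 1) (f x.1.2))

/-- The map from the standard module to its simple top, on representatives. -/
def toTop (x : Label (cR c)) : annFix (cR c) x.1.1 (f x.1.2) →ₗ[ADRAlgebra (cR c)]
    h.topData.TopModule x where
  toFun m := h.topData.ofS x (h.θ (h.idx x) (h.one_le_idx x) m) (h.θ_mul_f m.2 _)
  map_add' m m' := h.topData.val_injective x (by
    rw [map_add, h.topData.val_ofS, h.topData.val_ofS, h.topData.val_ofS, ← map_add]
    rfl)
  map_smul' α m := h.topData.val_injective x (by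
    rw [RingHom.id_apply, h.topData.val_smul, h.topData.val_ofS, h.topData.val_ofS]
    change h.θ _ _ (α (m : AuslanderModule (cR c))) = _
    rw [h.θ_apply_apply (h.one_le_idx x) α m.2.1, π_apply, h.block.central, mul_assoc,
      h.c_mul_θ m.2])

lemma val_toTop (x : Label (cR c)) (m : annFix (cR c) x.1.1 (f x.1.2)) :
    h.topData.val x (h.toTop x m) = h.θ (h.idx x) (h.one_le_idx x) m := rfl

lemma op_smul_g_mem_annFix (x : Label (cR c)) {s : S} (hs : s * f x.1.2 = s) :
    MulOpposite.op (s : R) • g (cR c) (h.idx x) ∈ annFix (cR c) x.1.1 (f x.1.2) :=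
  ⟨op_smul_mem_annPow (g_mem_annPow (h.idx x)) _, by
    change MulOpposite.op (f x.1.2 : R) • MulOpposite.op (s : R) • g (cR c) (h.idx x) = _
    rw [smul_smul, ← MulOpposite.op_mul, ← Subalgebra.coe_mul, hs]⟩

lemma toTop_surjective (x : Label (cR c)) : Function.Surjective (h.toTop x) := by
  intro v
  refine ⟨⟨_, h.op_smul_g_mem_annFix x (h.topData.val_mul_f x v)⟩, h.topData.val_injective x ?_⟩
  rw [h.val_toTop, h.θ_op_smul, h.θ_g, h.proj_coe, ← h.topData.c_mul_val, ← mul_assoc,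
    h.cGeS_central, h.c_mul_cGeS]

lemma toTop_eq_zero (x : Label (cR c)) (m : annFix (cR c) x.1.1 (f x.1.2))
    (hm : (m : AuslanderModule (cR c)) ∈ annFix (cR c) (x.1.1 - 1) (f x.1.2)) :
    h.toTop x m = 0 := by
  refine h.topData.val_injective x ?_
  rw [h.val_toTop, map_zero]
  refine h.θ_eq_zero_of_mem_annPow (h.one_le_idx x) (j := x.1.1 - 1) ?_ hm.1
  have := x.2.1
  change x.1.1 - 1 < x.1.1
  omega

/-- For a smaller index j the image lies in g_j R, which is killed by J^j. For equal indices and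
different blocks, orthogonality of the c's makes the relevant coefficient radical. -/
lemma σ_f_apply_mem_annFix {x y : Label (cR c)} (hxy : y ≠ x) (hle : y.1.1 ≤ x.1.1)
    {m : AuslanderModule (cR c)} (hm : m ∈ annFix (cR c) x.1.1 (f x.1.2)) :
    h.σ y (f y.1.2) m ∈ annFix (cR c) (x.1.1 - 1) (f x.1.2) := by
  refine ⟨?_, ((annFix (cR c) x.1.1 (f x.1.2)).smul_mem (h.σ y (f y.1.2)) hm).2⟩
  change h.σ y (f y.1.2) m ∈ annPow (cR c) (x.1.1 - 1)
  rcases hle.lt_or_eq with hlt | heq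
  · obtain ⟨r, hr, hmr⟩ := exists_eq_op_smul_gen (h.cGe_idem _) (m (h.idx y))
    rw [h.σ_apply y _ hmr]
    exact op_smul_mem_annPow (annPow_mono (Nat.le_sub_one_of_lt hlt) (g_mem_annPow (h.idx y))) _
  · rw [← heq]
    refine h.σ_f_apply_mem y ?_
    have hne : y.1.2 ≠ x.1.2 := fun he => hxy (Subtype.ext (Prod.ext heq he))
    rw [← h.c_mul_θ hm, ← mul_assoc, ← h.block.f_mul_c, mul_assoc (f y.1.2),
      h.complete.ortho hne, mul_zero, zero_mul]

lemma σ_f_apply_mem_annFix_of_toTop {x : Label (cR c)} (m : annFix (cR c) x.1.1 (f x.1.2))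
    (hm : h.toTop x m = 0) :
    h.σ x (f x.1.2) m ∈ annFix (cR c) (x.1.1 - 1) (f x.1.2) := by
  refine ⟨h.σ_f_apply_mem x ?_, ((annFix (cR c) x.1.1 (f x.1.2)).smul_mem (h.σ x (f x.1.2)) m.2).2⟩
  rw [← h.val_toTop x m, hm, map_zero, mul_zero]

lemma isPrimitiveFor_σ_f (x : Label (cR c)) :
    IsPrimitiveFor (h.σ x (f x.1.2)) (h.topData.simple x) :=
  h.topData.isPrimitiveFor_topModule x

lemma op_cGe_smul {x : Label (cR c)} {m : AuslanderModule (cR c)}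
    (hm : m ∈ annFix (cR c) x.1.1 (f x.1.2)) :
    MulOpposite.op (cGe (cR c) (h.idx x)) • m = m := by
  have : (f x.1.2 : R) * cGe (cR c) (h.idx x) = f x.1.2 := by
    rw [← coe_cGeS, ← Subalgebra.coe_mul, ← h.block.f_mul_c, mul_assoc, h.c_mul_cGeS]
  calc MulOpposite.op (cGe (cR c) (h.idx x)) • m
      = MulOpposite.op (cGe (cR c) (h.idx x)) • MulOpposite.op (f x.1.2 : R) • m := by rw [hm.2]
    _ = m := by rw [smul_smul, ← MulOpposite.op_mul, this, hm.2]

lemma mul_σ_f_apply (x : Label (cR c)) (a : ADRAlgebra (cR c)) :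
    (a * h.σ x (f x.1.2)) (MulOpposite.op (f x.1.2 : R) • g (cR c) (h.idx x)) =
      MulOpposite.op (f x.1.2 : R) • a (g (cR c) (h.idx x)) := by
  rw [Module.End.mul_apply, map_smul, h.σ_g, smul_smul, ← MulOpposite.op_mul,
    ← Subalgebra.coe_mul, h.block.c_mul_f, h.block.idem, map_smul]

lemma mul_σ_f_eq_zero {x : Label (cR c)} {a : ADRAlgebra (cR c)}
    (ha : (a * h.σ x (f x.1.2)) (MulOpposite.op (f x.1.2 : R) • g (cR c) (h.idx x)) = 0) :
    a * h.σ x (f x.1.2) = 0 := by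
  refine hom_ext_g h.cGe_idem fun i => ?_
  rw [Module.End.mul_apply]
  rcases eq_or_ne i (h.idx x) with rfl | hi
  · rw [h.mul_σ_f_apply] at ha
    rw [h.σ_g, h.block.c_mul_f, map_smul, ha]
    rfl
  · rw [h.σ_g_of_ne x _ hi, map_zero]
    rfl

/-- Together with `mul_σ_f_eq_zero`: evaluation at g_i f identifies the left ideal of the primitive
idempotent of (i, λ) with level i of the chain `annFix`. -/
lemma exists_mul_σ_f_apply_eq {x : Label (cR c)} {m : AuslanderModule (cR c)}
    (hm : m ∈ annFix (cR c) x.1.1 (f x.1.2)) : ∃ a : ADRAlgebra (cR c),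
      (a * h.σ x (f x.1.2)) (MulOpposite.op (f x.1.2 : R) • g (cR c) (h.idx x)) = m := by
  have hm1 : m ∈ annPow (cR c) (h.idx x) := hm.1
  refine ⟨homAt (h.idx x) m hm1, ?_⟩
  rw [h.mul_σ_f_apply, homAt_g, h.op_cGe_smul hm, hm.2]

theorem isQuasiHereditary (hN : IsNoetherian (ADRAlgebra (cR c)) (AuslanderModule (cR c)))
    (hA : IsArtinian (ADRAlgebra (cR c)) (AuslanderModule (cR c))) :
    IsQuasiHereditary h.topData.simple (idemLE (proj (cR c)) h.topData.simple) (standard c f) where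
  simples := h.topData.isSimpleLabelling
  refl x := Or.inl rfl
  trans x y z hxy hyz := by
    rw [h.idemLE_iff] at *
    rcases hxy with rfl | hxy
    · exact hyz
    · rcases hyz with rfl | hyz
      · exact Or.inr hxy
      · exact Or.inr (hyz.trans hxy)
  antisymm x y hxy hyx := by
    rw [h.idemLE_iff] at *
    rcases hxy with rfl | hxy
    · rfl
    · rcases hyx with rfl | hyx
      · rfl
      · omega
  mult_zero x y hxy := by
    rw [h.idemLE_iff] at hxy
    push Not at hxy
    exact hasMultiplicity_subquot_zero hN hA _ _ (L := h.topData.TopModule y)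
      (fun m hm => h.σ_f_apply_mem_annFix hxy.1 hxy.2 hm) (h.topData.σ_f_smul_ne_zero y)
  mult_one x := hasMultiplicity_subquot_one hN hA _ _ (L := h.topData.TopModule x)
    (h.topData.isSimpleModule_topModule x) (h.toTop x) (h.toTop_eq_zero x) (h.toTop_surjective x)
    (fun m hm => h.σ_f_apply_mem_annFix_of_toTop m hm) (h.topData.σ_f_smul_ne_zero x)
  cover x := by
    obtain ⟨φ, hφ, d, F, hF, h0, h1, hsec⟩ := exists_filtered_cover_of_span (h.σ x (f x.1.2))
      (MulOpposite.op (f x.1.2 : R) • g (cR c) (h.idx x)) (fun a ha => h.mul_σ_f_eq_zero ha)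
      (D := fun j => annFix (cR c) j (f x.1.2)) (annFix_mono _) (annFix_zero _) (i := x.1.1)
      (h.op_smul_g_mem_annFix x (h.block.idem _)) (fun m hm => h.exists_mul_σ_f_apply_eq hm)
    refine ⟨h.σ x (f x.1.2), h.isPrimitiveFor_σ_f x, φ, hφ, d, F, hF, h0, h1, fun i hi => ?_⟩
    obtain ⟨j, hj, e⟩ := hsec i hi
    have hx := x.2.2
    -- The section between levels j and j + 1 is the standard module of (j + 1, λ); it lies above
    -- (i, λ) in the order because j + 1 < i.
    refine ⟨⟨(j + 1, x.1.2), Nat.succ_pos j, by dsimp only; omega⟩, ⟨?_, ?_⟩, e⟩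
    · rw [h.idemLE_iff]
      exact Or.inr hj
    · intro he
      have := congrArg (fun y : Label (cR c) => y.1.1) he
      dsimp only at this
      omega

end Splitting

/-! ### The Borel subalgebra and its grading -/

/-- The corestriction of an additive map to a subalgebra. -/
def corestrict {k A S : Type*} [Field k] [Ring A] [Algebra k A] [Ring S] (σ : S →+ A)
    (B : Subalgebra k A) (hB : ∀ s, σ s ∈ B) : S →+ B where
  toFun s := ⟨σ s, hB s⟩
  map_zero' := Subtype.ext (map_zero σ)
  map_add' s t := Subtype.ext (map_add σ s t)

/-- A subalgebra containing all the lifts σ x s has the same blocks as quotients, so its simple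
modules carry the same labels as those of A. -/
lemma TopData.restrict {k A S X : Type*} [Field k] [Ring A] [Algebra k A] [Ring S] {c f : X → S}
    {π : X → A →+ S} {σ : X → S →+ A} (h : TopData c f π σ) (B : Subalgebra k A)
    (hB : ∀ x s, σ x s ∈ B) : TopData c f (fun x => (π x).comp B.val.toAddMonoidHom)
      (fun x => corestrict (σ x) B (hB x)) where
  block := h.block
  π_mul x a b := h.π_mul x a b
  π_one := h.π_one
  σ_mul x s t := Subtype.ext (h.σ_mul x s t)
  π_σ := h.π_σ
  π_σ_ne := h.π_σ_ne
  one_mem := by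
    have h1 : (B.val.toAddMonoidHom 1 : A) ∈ (AddSubmonoid.closure (Set.range fun x =>
        corestrict (σ x) B (hB x) (c x))).map B.val.toAddMonoidHom := by
      rw [AddMonoidHom.map_mclosure, ← Set.range_comp]
      exact h.one_mem
    obtain ⟨b, hb, hb1⟩ := h1
    have hb2 : b = 1 := Subtype.val_injective hb1
    rwa [hb2] at hb
  nil a ha := by
    obtain ⟨n, hn⟩ := h.nil a ha
    exact ⟨n, Subtype.ext hn⟩

lemma projective_of_surjective {k A Q : Type*} [Field k] [Ring A] [Algebra k A] (B : Subalgebra k A)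
    (H : Subalgebra k B) [Ring Q] [IsSemisimpleRing Q] (φ : Q →+* H) (hφ : Function.Surjective φ) :
    Module.Projective H B := by
  have := RingHom.isSemisimpleRing_of_surjective φ hφ
  exact Module.projective_of_isSemisimpleRing _ _

section Proj

variable {R : Type u} [Ring R] {Λ₀ : Type w} [Fintype Λ₀] (c : Λ₀ → R)

lemma completeOrthogonalIdempotents_proj : CompleteOrthogonalIdempotents (proj c) where
  idem i := LinearMap.ext fun m => by
    rw [Module.End.mul_apply, proj_apply, proj_apply, Pi.single_eq_same]
  ortho i j hij := LinearMap.ext fun m => by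
    change proj c i (proj c j m) = 0
    rw [proj_apply, proj_apply, Pi.single_eq_of_ne hij, Pi.single_zero]
  complete := LinearMap.ext fun m => by
    rw [LinearMap.sum_apply, Module.End.one_apply]
    exact Finset.univ_sum_single m

variable {c}

lemma eq_sum_proj (α : ADRAlgebra c) : α = ∑ i, ∑ j, proj c i * α * proj c j := by
  simp only [← Finset.mul_sum, ← Finset.sum_mul, (completeOrthogonalIdempotents_proj c).complete,
    one_mul, mul_one]

lemma proj_mul_mul_proj_g (α : ADRAlgebra c) (i j : Fin (nilLength R + 1)) :
    (proj c i * α * proj c j) (g c j) = Pi.single i (α (g c j) i) := by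
  rw [Module.End.mul_apply, proj_g, Module.End.mul_apply, proj_apply]

lemma proj_mul_mul_proj_g_of_ne (α : ADRAlgebra c) {i j l : Fin (nilLength R + 1)} (hl : l ≠ j) :
    (proj c i * α * proj c j) (g c l) = 0 := by
  rw [Module.End.mul_apply, proj_g_of_ne hl, map_zero]

end Proj

namespace Splitting

variable {k : Type v} {R : Type u} [Field k] [Ring R] [Algebra k R] {S : Subalgebra k R}
  {τ : R →+* S} {Λ₀ : Type w} [Fintype Λ₀] {c f : Λ₀ → S} (h : Splitting S τ c f)

section Scalars

omit h

lemma smul_op_smul_gen {c : Λ₀ → R} (i : ℕ) (t : k) (r : R) :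
    t • (MulOpposite.op r • gen c i) = MulOpposite.op (r * algebraMap k R t) • gen c i := by
  rw [← Algebra.commutes, ← Algebra.smul_def]
  apply Subtype.ext
  rw [coe_op_smul_gen, mul_smul_comm]
  rfl

lemma smul_apply_g {c : Λ₀ → R} (t : k) (α : ADRAlgebra c) (i j : Fin (nilLength R + 1)) :
    (t • α) (g c j) i = t • (α (g c j) i) := rfl

end Scalars

/-- The multiples of the `i`-th generator by elements of `S`. -/
def genS (c : Λ₀ → S) (i : ℕ) : AddSubgroup (auslanderSummand (cR c) i) where
  carrier := {y | ∃ s : S, y = MulOpposite.op (s : R) • gen (cR c) i}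
  add_mem' := by
    rintro _ _ ⟨r, rfl⟩ ⟨s, rfl⟩
    exact ⟨r + s, by rw [Subalgebra.coe_add, MulOpposite.op_add, add_smul]⟩
  zero_mem' := ⟨0, by rw [ZeroMemClass.coe_zero, MulOpposite.op_zero, zero_smul]⟩
  neg_mem' := by
    rintro _ ⟨r, rfl⟩
    exact ⟨-r, by rw [NegMemClass.coe_neg, MulOpposite.op_neg, neg_smul]⟩

omit h in
lemma op_smul_mem_genS {i : ℕ} {y : auslanderSummand (cR c) i} (hy : y ∈ genS c i) (s : S) :
    MulOpposite.op (s : R) • y ∈ genS c i := by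
  obtain ⟨t, rfl⟩ := hy
  exact ⟨t * s, by rw [smul_smul, ← MulOpposite.op_mul, Subalgebra.coe_mul]⟩

omit h in
lemma op_smul_g_apply_mem_genS (i j : Fin (nilLength R + 1)) (s : S) :
    (MulOpposite.op (s : R) • g (cR c) j) i ∈ genS c i := by
  rw [op_smul_g]
  rcases eq_or_ne i j with rfl | hij
  · rw [Pi.single_eq_same]
    exact ⟨s, rfl⟩
  · rw [Pi.single_eq_of_ne hij]
    exact zero_mem _

section
include h

lemma exists_of_mem_genS {i : ℕ} {y : auslanderSummand (cR c) i} (hy : y ∈ genS c i) :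
    ∃ s : S, cGeS c i * s = s ∧ y = MulOpposite.op (s : R) • gen (cR c) i := by
  obtain ⟨s, rfl⟩ := hy
  refine ⟨cGeS c i * s, by rw [← mul_assoc, h.cGeS_idem], Subtype.ext ?_⟩
  rw [coe_op_smul_gen, coe_op_smul_gen, Subalgebra.coe_mul, coe_cGeS, ← mul_assoc, h.cGe_idem]

lemma exists_eq_sum_g_of_mem_genS {m : AuslanderModule (cR c)}
    (hm : ∀ i : Fin (nilLength R + 1), m i ∈ genS c i) :
    ∃ s : Fin (nilLength R + 1) → S, (∀ i : Fin (nilLength R + 1), cGeS c i * s i = s i) ∧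
      (∀ i, m i = MulOpposite.op (s i : R) • gen (cR c) i) ∧
        m = ∑ i, MulOpposite.op (s i : R) • g (cR c) i := by
  choose s hs hms using fun i : Fin (nilLength R + 1) => h.exists_of_mem_genS (hm i)
  exact ⟨s, hs, hms, sum_g m _ hms⟩

/-- This is S ∩ J = 0 read modulo J^i, which is legitimate for i ≥ 1; for i = 0 the whole summand is
zero. -/
lemma eq_zero_of_mem_genS_of_mem_radS {i : ℕ} {y : auslanderSummand (cR c) i} (hy : y ∈ genS c i)
    (hr : y ∈ radS (cR c) i 1) : y = 0 := by
  rcases Nat.eq_zero_or_pos i with rfl | hi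
  · exact single_zero_index y
  obtain ⟨s, hs, rfl⟩ := h.exists_of_mem_genS hy
  obtain ⟨r, hr, he⟩ := hr
  have h1 := congrArg Subtype.val he
  rw [coe_op_smul_gen, coe_op_smul_gen, ← sub_eq_zero, ← map_sub, mkQ_eq_zero_iff, ← coe_cGeS,
    ← Subalgebra.coe_mul, hs] at h1
  have h2 := (h.proj_eq_zero _).2 (mem_jacobson_pow_one.1 (mem_jacobson_pow_of_le hi h1))
  rw [map_sub, h.proj_coe, map_mul, (h.proj_eq_zero r).2 (mem_jacobson_pow_one.1 hr), mul_zero,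
    sub_zero] at h2
  rw [h2, ZeroMemClass.coe_zero, MulOpposite.op_zero, zero_smul]

/-- The exact Borel subalgebra: the endomorphisms whose components map generators to `S`-multiples
of generators. -/
def borel : Subalgebra k (ADRAlgebra (cR c)) where
  carrier := {α | ∀ i j : Fin (nilLength R + 1), α (g (cR c) j) i ∈ genS c i}
  mul_mem' := by
    intro α β hα hβ i j
    obtain ⟨s, -, -, hs⟩ := h.exists_eq_sum_g_of_mem_genS fun i : Fin (nilLength R + 1) => hβ i j
    rw [Module.End.mul_apply, hs, map_sum, Finset.sum_apply]
    refine sum_mem fun l _ => ?_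
    rw [map_smul]
    exact op_smul_mem_genS (hα i l) _
  add_mem' := fun hα hβ i j => add_mem (hα i j) (hβ i j)
  algebraMap_mem' := fun t i j => by
    rw [Algebra.algebraMap_eq_smul_one, smul_apply_g, Module.End.one_apply]
    rcases eq_or_ne i j with rfl | hij
    · rw [g, Pi.single_eq_same, ← one_smul Rᵐᵒᵖ (gen (cR c) i), ← MulOpposite.op_one,
        smul_op_smul_gen]
      exact ⟨algebraMap k S t, by rw [one_mul]; rfl⟩
    · rw [g, Pi.single_eq_of_ne hij, smul_zero]
      exact zero_mem _

lemma coe_borel : (h.borel : Set (ADRAlgebra (cR c))) = borelSet (cR c) (S : Set R) := by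
  refine Set.ext fun α => forall_congr' fun i => forall_congr' fun j => ?_
  constructor
  · rintro ⟨s, hs⟩
    exact ⟨s, s.2, congrArg Subtype.val hs⟩
  · rintro ⟨s, hs, hα⟩
    exact ⟨⟨s, hs⟩, Subtype.ext hα⟩

lemma homAt_mem_borel {i : Fin (nilLength R + 1)} {m : AuslanderModule (cR c)}
    (hm : m ∈ annPow (cR c) i) (hS : ∀ l : Fin (nilLength R + 1), m l ∈ genS c l) :
    homAt i m hm ∈ h.borel := by
  intro l j
  rcases eq_or_ne j i with rfl | hj
  · rw [homAt_g, ← coe_cGeS]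
    exact op_smul_mem_genS (hS l) _
  · rw [homAt_g_of_ne hj]
    exact zero_mem _

lemma σ_mem_borel (x : Label (cR c)) (s : S) : h.σ x s ∈ h.borel :=
  h.homAt_mem_borel _ fun l => op_smul_g_apply_mem_genS l _ _

/-- Triangularity of B: for j < i the generator g_j goes to a radical multiple of g_i, and an
S-multiple that is radical vanishes. -/
lemma apply_g_eq_zero_of_lt {α : ADRAlgebra (cR c)} (hα : α ∈ h.borel)
    {i j : Fin (nilLength R + 1)} (hij : j < i) : α (g (cR c) j) i = 0 :=
  h.eq_zero_of_mem_genS_of_mem_radS (hα i j)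
    (h.apply_mem_radS_of_mem_annPow hij (apply_mem_annPow (g_mem_annPow j) α))

lemma proj_mem_borel (i : Fin (nilLength R + 1)) : proj (cR c) i ∈ h.borel := by
  intro l j
  rcases eq_or_ne j i with rfl | hj
  · rw [proj_g]
    have := op_smul_g_apply_mem_genS (c := c) l j 1
    rwa [OneMemClass.coe_one, MulOpposite.op_one, one_smul] at this
  · rw [proj_g_of_ne hj]
    exact zero_mem _

end

section Grading

/-- The endomorphisms all of whose components belong to given subspaces. -/
def entrySubmodule {c : Λ₀ → R} (N : ∀ i : Fin (nilLength R + 1), Fin (nilLength R + 1) →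
    AddSubgroup (auslanderSummand c i)) (hN : ∀ i j (t : k), ∀ y ∈ N i j, t • y ∈ N i j) :
    Submodule k (ADRAlgebra c) where
  carrier := {α | ∀ i j, α (g c j) i ∈ N i j}
  add_mem' := fun ha hb i j => (N i j).add_mem (ha i j) (hb i j)
  zero_mem' := fun i j => (N i j).zero_mem
  smul_mem' := fun t α hα i j => by
    rw [smul_apply_g]
    exact hN i j t _ (hα i j)

omit h in
lemma proj_mul_mul_proj_mem_gradedPart {c : Λ₀ → R} (α : ADRAlgebra c)
    (i j : Fin (nilLength R + 1)) :
    proj c i * α * proj c j ∈ gradedPart k (proj c) ((j : ℤ) - i) :=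
  Submodule.mem_iSup_of_mem i (Submodule.mem_iSup_of_mem j (Submodule.mem_iSup_of_mem rfl
    (Submodule.subset_span ⟨α, rfl⟩)))

omit h in
lemma apply_eq_zero_of_mem_gradedPart {c : Λ₀ → R} {d : ℤ} {α : ADRAlgebra c}
    (hα : α ∈ gradedPart k (proj c) d) {i j : Fin (nilLength R + 1)} (hij : (j : ℤ) - i ≠ d) :
    α (g c j) i = 0 := by
  classical
  have key : gradedPart k (proj c) d ≤ entrySubmodule (k := k)
      (fun i j => if (j : ℤ) - i = d then ⊤ else ⊥) (fun i j t y hy => by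
        split_ifs at hy ⊢
        · trivial
        · rw [AddSubgroup.mem_bot] at hy ⊢
          rw [hy, smul_zero]) := by
    refine iSup_le fun i' => iSup_le fun j' => iSup_le fun hd => Submodule.span_le.2 ?_
    rintro _ ⟨a, rfl⟩ i j
    rcases eq_or_ne j j' with rfl | hj
    · rw [proj_mul_mul_proj_g]
      rcases eq_or_ne i i' with rfl | hi
      · change _ ∈ ite _ _ _
        rw [if_pos hd]
        trivial
      · rw [Pi.single_eq_of_ne hi]
        exact zero_mem _
    · rw [proj_mul_mul_proj_g_of_ne _ hj]
      exact zero_mem _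
  have : α (g c j) i ∈ ite _ _ _ := key hα i j
  rwa [if_neg hij, AddSubgroup.mem_bot] at this

include h

lemma isNGraded : IsNGraded (proj (cR c)) h.borel where
  idem_mem := h.proj_mem_borel
  graded := by
    apply le_antisymm
    · exact iSup_le fun d => inf_le_left
    · intro β hβ
      rw [eq_sum_proj β]
      refine sum_mem fun i _ => sum_mem fun j _ => ?_
      refine Submodule.mem_iSup_of_mem ((j : ℤ) - i) ⟨?_, proj_mul_mul_proj_mem_gradedPart β i j⟩
      exact h.borel.mul_mem (h.borel.mul_mem (h.proj_mem_borel i) hβ) (h.proj_mem_borel j)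
  nonneg d hd := by
    rw [eq_bot_iff]
    rintro β ⟨hβ, hβd⟩
    refine hom_ext_g h.cGe_idem fun j => funext fun i => ?_
    by_cases hij : (j : ℤ) - i = d
    · exact h.apply_g_eq_zero_of_lt hβ (Fin.lt_def.2 (by omega))
    · exact apply_eq_zero_of_mem_gradedPart hβd hij

/-- An element of B writes the image of a generator as an S-combination of generators g_l. A map of
negative degree has a component from l to i only if l < i, and then its value on g_l is radical. -/
lemma apply_mem_radS_of_mem_negPart_mul {α : ADRAlgebra (cR c)}
    (hα : α ∈ negPart k (proj (cR c)) * Subalgebra.toSubmodule h.borel)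
    (i j : Fin (nilLength R + 1)) : α (g (cR c) j) i ∈ radS (cR c) i 1 := by
  classical
  have hneg : negPart k (proj (cR c)) ≤ entrySubmodule (k := k)
      (fun i j => if (j : ℕ) < i then ⊤ else ⊥) (fun i j t y hy => by
        split_ifs at hy ⊢
        · trivial
        · rw [AddSubgroup.mem_bot] at hy ⊢
          rw [hy, smul_zero]) := by
    refine iSup_le fun d => iSup_le fun hd ν hν i j => ?_
    change ν (g (cR c) j) i ∈ ite _ _ _
    split_ifs with hij
    · trivial
    · exact apply_eq_zero_of_mem_gradedPart hν (by omega)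
  have key : negPart k (proj (cR c)) * Subalgebra.toSubmodule h.borel ≤ entrySubmodule (k := k)
      (fun i _ => radS (cR c) i 1) (fun i j t y hy => by
        obtain ⟨r, hr, rfl⟩ := hy
        rw [smul_op_smul_gen]
        refine ⟨_, ?_, rfl⟩
        rw [mem_jacobson_pow_one] at hr ⊢
        exact Ideal.mul_mem_right _ _ hr) := by
    refine Submodule.mul_le.2 fun ν hν β hβ i j => ?_
    obtain ⟨s, -, -, hs⟩ := h.exists_eq_sum_g_of_mem_genS fun i : Fin (nilLength R + 1) => hβ i j
    rw [Module.End.mul_apply, hs, map_sum, Finset.sum_apply]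
    refine sum_mem fun l _ => ?_
    rw [map_smul, Pi.smul_apply]
    refine op_smul_mem_radS (b := 0) ?_ (mem_jacobson_pow_zero _)
    have h1 : ν (g (cR c) l) i ∈ ite _ _ _ := hneg hν i l
    split_ifs at h1 with hl
    · exact h.apply_mem_radS_of_mem_annPow hl (apply_mem_annPow (g_mem_annPow l) ν)
    · rw [(AddSubgroup.mem_bot).1 h1]
      exact zero_mem _
  exact key hα i j

lemma op_cGe_smul_g (j : Fin (nilLength R + 1)) :
    MulOpposite.op (cGe (cR c) j) • g (cR c) j = g (cR c) j := by
  rw [op_smul_g, g]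
  congr 1
  apply Subtype.ext
  rw [coe_op_smul_gen, h.cGe_idem]
  rfl

lemma cGe_mul_cGe {i j : ℕ} (hij : i ≤ j) :
    cGe (cR c) i * cGe (cR c) j = cGe (cR c) j := by
  rw [← coe_cGeS, ← coe_cGeS, ← Subalgebra.coe_mul, h.cGeS_mul_cGeS hij]

omit [Field k] [Algebra k R] h in
lemma gradedPart_le_negPart {K A : Type*} [Field K] [Ring A] [Algebra K A] {m : ℕ} {ε : Fin m → A}
    {d : ℤ} (hd : d < 0) : gradedPart K ε d ≤ negPart K ε :=
  le_iSup_of_le d (le_iSup_of_le hd le_rfl)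

lemma entry_mem_sup {α : ADRAlgebra (cR c)} (i j : Fin (nilLength R + 1)) :
    proj (cR c) i * α * proj (cR c) j ∈ Subalgebra.toSubmodule h.borel ⊔
      negPart k (proj (cR c)) * Subalgebra.toSubmodule h.borel := by
  set γ := proj (cR c) i * α * proj (cR c) j with hγ
  rcases lt_or_ge j i with hij | hij
  · refine Submodule.mem_sup_right ?_
    have h1 := Submodule.mul_mem_mul (gradedPart_le_negPart (d := (j : ℤ) - i) (by
      have := Fin.lt_def.1 hij
      omega) (proj_mul_mul_proj_mem_gradedPart (k := k) α i j))
      (show (1 : ADRAlgebra (cR c)) ∈ Subalgebra.toSubmodule h.borel from one_mem h.borel)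
    rwa [mul_one] at h1
  rcases Nat.eq_zero_or_pos (i : ℕ) with hi | hi
  · have : γ = 0 := by
      refine hom_ext_g h.cGe_idem fun l => ?_
      obtain rfl : i = 0 := Fin.ext hi
      rcases eq_or_ne l j with rfl | hl
      · rw [hγ, proj_mul_mul_proj_g, show α (g (cR c) l) 0 = 0 from single_zero_index _,
          Pi.single_zero]
        rfl
      · rw [hγ, proj_mul_mul_proj_g_of_ne _ hl]
        rfl
    rw [this]
    exact zero_mem _
  obtain ⟨r, hr, hαr⟩ := exists_eq_op_smul_gen (h.cGe_idem i) (α (g (cR c) j) i)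
  have hαg : ∀ a : R, MulOpposite.op a • g (cR c) i ∈ annPow (cR c) j := fun a =>
    annPow_mono (Fin.le_def.1 hij) (op_smul_mem_annPow (g_mem_annPow i) a)
  have hγg : γ (g (cR c) j) = MulOpposite.op r • g (cR c) i := by
    rw [hγ, proj_mul_mul_proj_g, op_smul_g, hαr]
  have hJ : r - τ r ∈ Ring.jacobson R := sub_coe_proj_mem h.proj_coe h.proj_eq_zero r
  -- Since g_i (r - τ r) is killed by J^(i-1), the radical part of the entry factors as g_j ↦
  -- g_(i-1), which lies in B, followed by g_(i-1) ↦ g_i (r - τ r), which has degree -1. The other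
  -- part, with coefficient τ r, lies in B.
  let l : Fin (nilLength R + 1) := ⟨i - 1, by have := i.2; omega⟩
  have hl : (l : ℕ) + 1 = i := Nat.sub_add_cancel hi
  have hlj : (l : ℕ) ≤ j := by
    have := Fin.le_def.1 hij
    omega
  have hm : MulOpposite.op (r - τ r : R) • g (cR c) i ∈ annPow (cR c) l := by
    refine op_smul_mem_annPow_of_mem ?_ hJ
    rw [hl]
    exact g_mem_annPow i
  have hgl : g (cR c) l ∈ annPow (cR c) j := annPow_mono hlj (g_mem_annPow l)
  have hγt : ∀ t, t ≠ j → γ (g (cR c) t) = 0 := fun t ht => proj_mul_mul_proj_g_of_ne _ ht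
  clear_value γ
  have hdec : γ = homAt j (MulOpposite.op (τ r : R) • g (cR c) i) (hαg _) +
      (proj (cR c) i * homAt l _ hm * proj (cR c) l) * homAt j _ hgl := by
    refine hom_ext_g h.cGe_idem fun t => ?_
    rw [LinearMap.add_apply, Module.End.mul_apply]
    rcases eq_or_ne t j with rfl | ht
    · rw [homAt_g, homAt_g, map_smul, proj_mul_mul_proj_g, homAt_g]
      have h1 : (Pi.single i ((MulOpposite.op (cGe (cR c) l) • MulOpposite.op (r - τ r : R) •
          g (cR c) i) i) : AuslanderModule (cR c)) = MulOpposite.op (cGe (cR c) l) •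
            MulOpposite.op (r - τ r : R) • g (cR c) i := by
        rw [smul_smul, ← MulOpposite.op_mul, op_smul_g, Pi.single_eq_same]
      rw [h1, smul_smul _ (MulOpposite.op (cGe (cR c) l)), ← MulOpposite.op_mul,
        h.cGe_mul_cGe hlj, ← smul_add, ← add_smul, ← MulOpposite.op_add, add_sub_cancel, ← hγg,
        ← map_smul, h.op_cGe_smul_g]
    · rw [homAt_g_of_ne ht, homAt_g_of_ne ht, map_zero, add_zero, hγt t ht]
  rw [hdec]
  refine add_mem (Submodule.mem_sup_left ?_) (Submodule.mem_sup_right (Submodule.mul_mem_mul ?_ ?_))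
  · exact h.homAt_mem_borel _ fun t => op_smul_g_apply_mem_genS t i _
  · exact gradedPart_le_negPart (d := (l : ℤ) - i) (by omega)
      (proj_mul_mul_proj_mem_gradedPart _ i l)
  · refine h.homAt_mem_borel _ fun t => ?_
    have := op_smul_g_apply_mem_genS (c := c) t l 1
    rwa [OneMemClass.coe_one, MulOpposite.op_one, one_smul] at this

lemma isCompl_borel : IsCompl (Subalgebra.toSubmodule h.borel)
    (negPart k (proj (cR c)) * Subalgebra.toSubmodule h.borel) := by
  constructor
  · rw [Submodule.disjoint_def]
    intro α hα hα'
    refine hom_ext_g h.cGe_idem fun j => funext fun i => ?_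
    exact h.eq_zero_of_mem_genS_of_mem_radS (hα i j) (h.apply_mem_radS_of_mem_negPart_mul hα' i j)
  · rw [codisjoint_iff, eq_top_iff]
    rintro α -
    rw [eq_sum_proj α]
    exact sum_mem fun i _ => sum_mem fun j _ => h.entry_mem_sup i j

omit h in
/-- The diagonal endomorphism with given entries in `S`. -/
def diag (s : Fin (nilLength R + 1) → S) : ADRAlgebra (cR c) :=
  ∑ i, homAt i (MulOpposite.op (s i : R) • g (cR c) i) (op_smul_mem_annPow (g_mem_annPow i) _)

lemma diag_g (s : Fin (nilLength R + 1) → S) (i : Fin (nilLength R + 1)) :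
    diag s (g (cR c) i) = MulOpposite.op (s i : R) • g (cR c) i := by
  rw [diag, LinearMap.sum_apply, Finset.sum_eq_single i]
  · rw [homAt_g, smul_smul, ← MulOpposite.op_mul, ← coe_cGeS, ← Subalgebra.coe_mul,
      ← h.cGeS_central, Subalgebra.coe_mul, coe_cGeS, MulOpposite.op_mul, mul_smul,
      h.op_cGe_smul_g]
  · exact fun j _ hj => homAt_g_of_ne hj.symm _ _
  · simp

lemma diag_mem_borel (s : Fin (nilLength R + 1) → S) : diag s ∈ h.borel := by
  intro i j
  rw [h.diag_g]
  exact op_smul_g_apply_mem_genS i j _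

lemma proj_mul_diag (s : Fin (nilLength R + 1) → S) (i : Fin (nilLength R + 1)) :
    proj (cR c) i * diag s = diag s * proj (cR c) i := by
  refine hom_ext_g h.cGe_idem fun j => ?_
  rw [Module.End.mul_apply, Module.End.mul_apply, h.diag_g, map_smul]
  rcases eq_or_ne j i with rfl | hj
  · rw [proj_g, h.diag_g]
  · rw [proj_g_of_ne hj, map_zero, smul_zero]

/-- The diagonal endomorphisms make up the part of degree zero of the Borel subalgebra. -/
def diagHom : (Fin (nilLength R + 1) → S) →+* degZero (proj (cR c)) h.borel where
  toFun s := ⟨⟨diag s, h.diag_mem_borel s⟩, by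
    rintro _ ⟨i, rfl⟩
    exact h.proj_mul_diag s i⟩
  map_one' := Subtype.ext (Subtype.ext (hom_ext_g h.cGe_idem fun i => by
    change diag 1 (g (cR c) i) = g (cR c) i
    rw [h.diag_g, Pi.one_apply, OneMemClass.coe_one, MulOpposite.op_one, one_smul]))
  map_mul' s t := Subtype.ext (Subtype.ext (hom_ext_g h.cGe_idem fun i => by
    change diag (s * t) (g (cR c) i) = diag s (diag t (g (cR c) i))
    rw [h.diag_g, h.diag_g, map_smul, h.diag_g, smul_smul, ← MulOpposite.op_mul, Pi.mul_apply,
      Subalgebra.coe_mul]))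
  map_zero' := Subtype.ext (Subtype.ext (hom_ext_g h.cGe_idem fun i => by
    change diag 0 (g (cR c) i) = 0
    rw [h.diag_g, Pi.zero_apply, ZeroMemClass.coe_zero, MulOpposite.op_zero, zero_smul]))
  map_add' s t := Subtype.ext (Subtype.ext (hom_ext_g h.cGe_idem fun i => by
    change diag (s + t) (g (cR c) i) = diag s (g (cR c) i) + diag t (g (cR c) i)
    rw [h.diag_g, h.diag_g, h.diag_g, Pi.add_apply, Subalgebra.coe_add, MulOpposite.op_add,
      add_smul]))

/-- Commuting with the projections forces β g_j into the j-th summand, where it is an S-multiple of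
g_j. -/
lemma diagHom_surjective : Function.Surjective h.diagHom := by
  rintro ⟨⟨β, hβ⟩, hcomm⟩
  have hβg : ∀ j, β (g (cR c) j) = Pi.single j (β (g (cR c) j) j) := by
    intro j
    have h1 : proj (cR c) j * β = β * proj (cR c) j := hcomm _ ⟨j, rfl⟩
    have h2 := LinearMap.congr_fun h1 (g (cR c) j)
    rw [Module.End.mul_apply, Module.End.mul_apply, proj_g, proj_apply] at h2
    exact h2.symm
  choose s hs using fun j => hβ j j
  refine ⟨s, Subtype.ext (Subtype.ext (hom_ext_g h.cGe_idem fun j => ?_))⟩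
  change diag s (g (cR c) j) = β (g (cR c) j)
  rw [h.diag_g, hβg, hs, op_smul_g]

lemma projective_degZero [IsSemisimpleRing S] :
    Module.Projective (degZero (proj (cR c)) h.borel) h.borel := by
  exact projective_of_surjective h.borel _ h.diagHom h.diagHom_surjective

end Grading

end Splitting

/-! ### A finite dual basis over the Borel subalgebra -/

section Filtered

lemma exists_dualBasis (Q M : Type*) [Ring Q] [AddCommGroup M] [Module Q M] [Module.Finite Q M]
    [Module.Projective Q M] :
    ∃ (n : ℕ) (w : Fin n → M) (φ : Fin n → M →ₗ[Q] Q), ∀ m, m = ∑ t, φ t m • w t := by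
  obtain ⟨n, p, hp⟩ := Module.Finite.exists_fin' Q M
  obtain ⟨s, hs⟩ := Module.projective_lifting_property p LinearMap.id hp
  refine ⟨n, fun t => p (Pi.single t 1), fun t => LinearMap.proj t ∘ₗ s, fun m => ?_⟩
  have h1 : p (s m) = m := LinearMap.congr_fun hs m
  conv_lhs => rw [← h1, ← Finset.univ_sum_single (s m), map_sum]
  refine Finset.sum_congr rfl fun t _ => ?_
  rw [← map_smul, ← Pi.single_smul, smul_eq_mul, mul_one]
  rfl

/-- A dual basis adapted to a finite chain of submodules, over a semisimple ring. -/
lemma exists_filtered_dualBasis {Q M : Type*} [Ring Q] [IsSemisimpleRing Q] [AddCommGroup M]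
    [Module Q M] [Module.Finite Q M] (F : ℕ → Submodule Q M) (hF : Monotone F) (h0 : F 0 = ⊥)
    (d : ℕ → Q) (hd : ∀ n q, d n * q = q * d n) (hdd : ∀ n, d n * d n = d n)
    (hdF : ∀ n, ∀ m ∈ F (n + 1), m - d (n + 1) • m ∈ F n) (n : ℕ) :
    ∃ (N : ℕ) (l : Fin N → ℕ) (w : Fin N → M) (φ : Fin N → M →ₗ[Q] Q),
      (∀ t, l t < n) ∧ (∀ t, w t ∈ F (l t + 1)) ∧ (∀ t, d (l t + 1) • w t = w t) ∧
      (∀ t, ∀ m ∈ F (l t), φ t m = 0) ∧ ∀ m ∈ F n, m = ∑ t, φ t m • w t := by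
  induction n with
  | zero =>
    refine ⟨0, Fin.elim0, Fin.elim0, Fin.elim0, fun t => t.elim0, fun t => t.elim0,
      fun t => t.elim0, fun t => t.elim0, fun m hm => ?_⟩
    rw [h0, Submodule.mem_bot] at hm
    rw [hm, Finset.univ_eq_empty, Finset.sum_empty]
  | succ n ih =>
    obtain ⟨N, l, w, φ, hl, hw, hdw, hφ, hsum⟩ := ih
    have := Module.projective_of_isSemisimpleRing Q M
    obtain ⟨N', w', ψ, hψ⟩ := exists_dualBasis Q M
    obtain ⟨C, hC⟩ := exists_isCompl (F n)
    obtain ⟨D, hD⟩ := exists_isCompl (F (n + 1))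
    -- p has kernel F n and changes vectors only by elements of F n; e projects onto F (n + 1). For
    -- m in F (n + 1) the inductive basis expands m - p m, and p m = d (n + 1) • p m is expanded in
    -- the new vectors d (n + 1) • e (w' t).
    let p := C.projection (F n) hC.symm
    let e := (F (n + 1)).projection D hD
    have hp0 : ∀ m ∈ F n, p m = 0 := fun m hm => (Submodule.projection_apply_eq_zero_iff hC.symm).2 hm
    have hpm : ∀ m, m - p m ∈ F n := by
      intro m
      rw [← Submodule.projection_apply_eq_zero_iff hC.symm, map_sub]
      change p m - p (p m) = 0
      rw [sub_eq_zero]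
      exact (Submodule.projection_apply_of_mem_left hC.symm
        (Submodule.projection_apply_mem hC.symm m)).symm
    have hpF : ∀ m ∈ F (n + 1), p m ∈ F (n + 1) := by
      intro m hm
      have := sub_mem hm (hF (Nat.le_succ n) (hpm m))
      rwa [sub_sub_cancel] at this
    have hpd : ∀ m ∈ F (n + 1), p m = d (n + 1) • p m := by
      intro m hm
      have := hp0 _ (hdF n m hm)
      rwa [map_sub, map_smul, sub_eq_zero] at this
    have hpsum : ∀ m ∈ F (n + 1), p m = ∑ t, ψ t (p m) • d (n + 1) • e (w' t) := by
      intro m hm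
      have h1 : e (p m) = p m := Submodule.projection_apply_of_mem_left hD (hpF m hm)
      have h2 := congrArg e (hψ (p m))
      rw [h1, map_sum] at h2
      conv_lhs => rw [hpd m hm, h2, Finset.smul_sum]
      refine Finset.sum_congr rfl fun t _ => ?_
      rw [map_smul, smul_smul, smul_smul, hd]
    refine ⟨N + N', Fin.append l (fun _ => n), Fin.append w (fun t => d (n + 1) • e (w' t)),
      Fin.append (fun t => φ t ∘ₗ (LinearMap.id - p)) (fun t => ψ t ∘ₗ p), ?_, ?_, ?_, ?_, ?_⟩
    · intro t
      refine Fin.addCases (fun t => ?_) (fun t => ?_) t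
      · rw [Fin.append_left]; exact (hl t).trans (Nat.lt_succ_self n)
      · rw [Fin.append_right]; exact Nat.lt_succ_self n
    · intro t
      refine Fin.addCases (fun t => ?_) (fun t => ?_) t
      · rw [Fin.append_left, Fin.append_left]; exact hw t
      · rw [Fin.append_right, Fin.append_right]
        exact Submodule.smul_mem _ _ (Submodule.projection_apply_mem hD _)
    · intro t
      refine Fin.addCases (fun t => ?_) (fun t => ?_) t
      · rw [Fin.append_left, Fin.append_left]; exact hdw t
      · rw [Fin.append_right, Fin.append_right, smul_smul, hdd]
    · intro t
      refine Fin.addCases (fun t => ?_) (fun t => ?_) t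
      · rw [Fin.append_left, Fin.append_left]
        intro m hm
        rw [LinearMap.comp_apply, LinearMap.sub_apply, LinearMap.id_apply,
          hp0 m (hF (hl t).le hm), sub_zero]
        exact hφ t m hm
      · rw [Fin.append_right, Fin.append_right]
        intro m hm
        rw [LinearMap.comp_apply, hp0 m hm, map_zero]
    · intro m hm
      rw [Fin.sum_univ_add]
      simp only [Fin.append_left, Fin.append_right, LinearMap.comp_apply, LinearMap.sub_apply,
        LinearMap.id_apply]
      rw [← hsum _ (hpm m), ← hpsum m hm, sub_add_cancel]

end Filtered

namespace Splitting

variable {k : Type v} {R : Type u} [Field k] [Ring R] [Algebra k R] {S : Subalgebra k R}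
  {τ : R →+* S} {Λ₀ : Type w} [Fintype Λ₀] {c f : Λ₀ → S} (h : Splitting S τ c f)
include h

/-- 1 - c_{≥n+1} is the sum of the c λ with ℓ(λ) ≤ n, and these satisfy c λ J^n = 0. -/
lemma sub_op_cGe_smul_mem (n : ℕ) (m : AuslanderModule (cR c)) :
    m - MulOpposite.op (cGe (cR c) (n + 1)) • m ∈ annPow (cR c) n := by
  classical
  intro r hr
  have h1 : (1 - cGe (cR c) (n + 1)) * r = 0 := by
    have h2 : (1 : R) = ∑ x, cR c x := by
      have := congrArg Subtype.val h.complete.complete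
      rw [AddSubmonoidClass.coe_finsetSum] at this
      exact this.symm
    rw [h2, cGe, ← Finset.sum_filter_add_sum_filter_not Finset.univ
      (fun x => n + 1 ≤ len (cR c) x) (cR c)]
    convert_to (∑ x ∈ Finset.univ.filter (fun x => ¬ n + 1 ≤ len (cR c) x), cR c x) * r = 0
    · congr 1
      convert add_sub_cancel_left _ _
    rw [Finset.sum_mul]
    refine Finset.sum_eq_zero fun x hx => (h.len_le_iff x n).1 ?_ r hr
    have := (Finset.mem_filter.1 hx).2
    omega
  rw [smul_sub, smul_smul, ← MulOpposite.op_mul, ← sub_smul, ← MulOpposite.op_sub,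
    show r - cGe (cR c) (n + 1) * r = (1 - cGe (cR c) (n + 1)) * r by rw [sub_mul, one_mul], h1,
    MulOpposite.op_zero, zero_smul]

lemma annPow_eq_top {n : ℕ} (hn : nilLength R ≤ n) (m : AuslanderModule (cR c)) :
    m ∈ annPow (cR c) n := by
  intro r hr
  have h1 := mem_jacobson_pow_of_le hn hr
  rw [h.jacobson_pow_nilLength, Ideal.mem_bot] at h1
  rw [h1, MulOpposite.op_zero, zero_smul]

omit h in
/-- The direct sum as a right module over the complement of the radical. -/
abbrev moduleS (c : Λ₀ → R) (S : Subalgebra k R) : Module Sᵐᵒᵖ (AuslanderModule c) :=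
  Module.compHom (AuslanderModule c) S.val.toRingHom.op

/-- The annihilator chain consists of right S-modules, and c_{≥n+1} acts as the identity on its
section between n and n + 1. This is the input for a dual basis adapted to the chain. -/
lemma exists_coordinates [IsSemisimpleRing S] [Module.Finite k R] :
    ∃ (N : ℕ) (l : Fin N → Fin (nilLength R + 1)) (w : Fin N → AuslanderModule (cR c))
      (φ : Fin N → AuslanderModule (cR c) →+ S),
      (∀ t, w t ∈ annPow (cR c) (l t)) ∧
      (∀ t, MulOpposite.op (cGe (cR c) (l t)) • w t = w t) ∧
      (∀ t (s : S) m, φ t (MulOpposite.op (s : R) • m) = φ t m * s) ∧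
      (∀ t j, j < (l t : ℕ) → ∀ m ∈ annPow (cR c) j, φ t m = 0) ∧
      ∀ m, m = ∑ t, MulOpposite.op (φ t m : R) • w t := by
  let := moduleS (cR c) S
  have hsm : ∀ (s : Sᵐᵒᵖ) (m : AuslanderModule (cR c)),
      s • m = MulOpposite.op ((s.unop : S) : R) • m := fun s m => rfl
  have : IsScalarTower k Sᵐᵒᵖ (AuslanderModule (cR c)) := ⟨fun t s m => by
    rw [hsm, hsm, MulOpposite.unop_smul, Subalgebra.coe_smul, MulOpposite.op_smul, smul_assoc]⟩
  have : Module.Finite k (AuslanderModule (cR c)) := by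
    have : ∀ i : Fin (nilLength R + 1), Module.Finite k (auslanderSummand (cR c) i) := fun i =>
      Module.Finite.of_injective ((auslanderSummand (cR c) i).restrictScalars k).subtype
        Subtype.val_injective
    infer_instance
  have : Module.Finite Sᵐᵒᵖ (AuslanderModule (cR c)) :=
    Module.Finite.of_restrictScalars_finite k Sᵐᵒᵖ (AuslanderModule (cR c))
  let F : ℕ → Submodule Sᵐᵒᵖ (AuslanderModule (cR c)) := fun n =>
    { carrier := annPow (cR c) n
      add_mem' := fun ha hb => add_mem ha hb
      zero_mem' := zero_mem _
      smul_mem' := fun s m hm => op_smul_mem_annPow hm _ }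
  obtain ⟨N, l, w, φ, hl, hw, hdw, hφ, hsum⟩ := exists_filtered_dualBasis F
    (fun a b hab => annPow_mono (c := cR c) hab)
    (by
      refine (Submodule.eq_bot_iff _).2 fun m hm => ?_
      have h1 : m ∈ annPow (cR c) 0 := hm
      rwa [annPow_zero] at h1)
    (fun n => MulOpposite.op (cGeS c n))
    (fun n q => MulOpposite.unop_injective (h.cGeS_central n q.unop).symm)
    (fun n => MulOpposite.unop_injective (h.cGeS_idem n))
    (fun n m _ => by
      have := h.sub_op_cGe_smul_mem n m
      rw [← coe_cGeS] at this
      exact this) (nilLength R)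
  -- `exists_filtered_dualBasis` puts w t into level l t + 1, hence the shift; index 0 is not used.
  refine ⟨N, fun t => ⟨l t + 1, Nat.succ_lt_succ (hl t)⟩, w,
    fun t => MulOpposite.opAddEquiv.symm.toAddMonoidHom.comp (φ t).toAddMonoidHom, hw, fun t => ?_,
    fun t s m => ?_, fun t j hj m hm => ?_, fun m => ?_⟩
  · have := hdw t
    rw [hsm, MulOpposite.unop_op, coe_cGeS] at this
    exact this
  · exact congrArg MulOpposite.unop ((φ t).map_smul (MulOpposite.op s) m)
  · exact congrArg MulOpposite.unop (hφ t m (annPow_mono (Nat.le_of_lt_succ hj) hm))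
  · exact hsum m (h.annPow_eq_top le_rfl m)

/-- The coordinate map with values in the Borel subalgebra belonging to a coordinate of the
module. -/
def coordMap (l : Fin (nilLength R + 1)) (φ : AuslanderModule (cR c) →+ S)
    (hφS : ∀ (s : S) m, φ (MulOpposite.op (s : R) • m) = φ m * s)
    (hφ : ∀ j, j < (l : ℕ) → ∀ m ∈ annPow (cR c) j, φ m = 0) :
    ADRAlgebra (cR c) →+ h.borel :=
  -- The value at g_j must be killed by J^j. This is automatic for l ≤ j; for j < l the coordinate
  -- vanishes, as α g_j is killed by J^j.
  have hmem : ∀ (α : ADRAlgebra (cR c)) (j : Fin (nilLength R + 1)),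
      MulOpposite.op (φ (α (g (cR c) j)) : R) • g (cR c) l ∈ annPow (cR c) j := fun α j => by
    rcases lt_or_ge (j : ℕ) l with hj | hj
    · rw [hφ j hj _ (apply_mem_annPow (g_mem_annPow j) α), ZeroMemClass.coe_zero,
        MulOpposite.op_zero, zero_smul]
      exact zero_mem _
    · exact annPow_mono hj (op_smul_mem_annPow (g_mem_annPow l) _)
  have hg : ∀ α j, (∑ i, homAt i _ (hmem α i)) (g (cR c) j) =
      MulOpposite.op (φ (α (g (cR c) j)) : R) • g (cR c) l := fun α j => by
    rw [LinearMap.sum_apply, Finset.sum_eq_single j]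
    · rw [homAt_g, smul_smul, ← MulOpposite.op_mul, ← coe_cGeS, ← Subalgebra.coe_mul, ← hφS,
        ← map_smul, coe_cGeS, h.op_cGe_smul_g]
    · exact fun i _ hi => homAt_g_of_ne hi.symm _ _
    · simp
  { toFun := fun α => ⟨∑ i, homAt i _ (hmem α i), fun i j => by
      rw [hg]
      exact op_smul_g_apply_mem_genS i l _⟩
    map_zero' := Subtype.ext (hom_ext_g h.cGe_idem fun j => (hg 0 j).trans (by
      rw [LinearMap.zero_apply, map_zero, ZeroMemClass.coe_zero, MulOpposite.op_zero, zero_smul]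
      rfl))
    map_add' := fun α β => Subtype.ext (hom_ext_g h.cGe_idem fun j => (hg _ j).trans (by
      refine Eq.trans ?_ (congrArg₂ (· + ·) (hg α j) (hg β j)).symm
      rw [LinearMap.add_apply, map_add, Subalgebra.coe_add, MulOpposite.op_add, add_smul])) }

lemma coordMap_g (l : Fin (nilLength R + 1)) (φ : AuslanderModule (cR c) →+ S)
    (hφS : ∀ (s : S) m, φ (MulOpposite.op (s : R) • m) = φ m * s)
    (hφ : ∀ j, j < (l : ℕ) → ∀ m ∈ annPow (cR c) j, φ m = 0) (α : ADRAlgebra (cR c))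
    (j : Fin (nilLength R + 1)) : (h.coordMap l φ hφS hφ α : ADRAlgebra (cR c)) (g (cR c) j) =
      MulOpposite.op (φ (α (g (cR c) j)) : R) • g (cR c) l := by
  change (∑ i, homAt i _ _) (g (cR c) j) = _
  rw [LinearMap.sum_apply, Finset.sum_eq_single j]
  · rw [homAt_g, smul_smul, ← MulOpposite.op_mul, ← coe_cGeS, ← Subalgebra.coe_mul, ← hφS,
      ← map_smul, coe_cGeS, h.op_cGe_smul_g]
  · exact fun i _ hi => homAt_g_of_ne hi.symm _ _
  · simp

/-- The coordinates m = Σ w_t φ_t(m) are transported to A: a_t sends the generator of index l t to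
w_t, and Φ_t(α) sends g_j to that generator times φ_t(α g_j). Both axioms are checked on generators.
-/
theorem exists_dualBasis_borel [IsSemisimpleRing S] [Module.Finite k R] :
    ∃ (N : ℕ) (a : Fin N → ADRAlgebra (cR c)) (Φ : Fin N → ADRAlgebra (cR c) →+ h.borel),
      DualBasis h.borel a Φ := by
  obtain ⟨N, l, w, φ, hw, hdw, hφS, hφ, hsum⟩ := h.exists_coordinates
  refine ⟨N, fun t => homAt (l t) (w t) (hw t),
    fun t => h.coordMap (l t) (φ t) (hφS t) (hφ t), ?_, ?_⟩
  · intro t α b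
    refine Subtype.ext (hom_ext_g h.cGe_idem fun j => ?_)
    obtain ⟨s, -, -, hs⟩ := h.exists_eq_sum_g_of_mem_genS fun i => b.2 i j
    rw [h.coordMap_g, Subalgebra.coe_mul, Module.End.mul_apply, Module.End.mul_apply, hs]
    simp only [map_sum, map_smul, hφS, h.coordMap_g, AddSubmonoidClass.coe_finsetSum,
      Finset.op_sum, Finset.sum_smul, Subalgebra.coe_mul, MulOpposite.op_mul, mul_smul]
  · intro α
    refine hom_ext_g h.cGe_idem fun j => ?_
    rw [LinearMap.sum_apply]
    conv_rhs => rw [hsum (α (g (cR c) j))]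
    refine Finset.sum_congr rfl fun t _ => ?_
    rw [Module.End.mul_apply, h.coordMap_g, map_smul, homAt_g, hdw]

end Splitting

/-! ### Induced simple modules and a criterion for exact Borel subalgebras -/

section Induction

variable {k : Type v} [Field k] {A : Type u} [Ring A] [Algebra k A] (B : Subalgebra k A)
  {M : Type u} [AddCommGroup M] [Module A M] {N : Type u} [AddCommGroup N] [Module B N]

/-- The map `A ⊗ N → V / U` belonging to a map `N → V` that is `B`-linear modulo `U`. -/
def indMapAux {V U : Submodule A M} (ψ : N →+ M) (hV : ∀ n, ψ n ∈ V) :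
    A ⊗[ℤ] N →ₗ[A] subquot V U :=
  TensorProduct.AlgebraTensorModule.lift
    { toFun := fun α =>
        { toFun := fun n => subquotMk U (α • ψ n) (V.smul_mem α (hV n))
          map_add' := fun n n' => by
            rw [← subquotMk_add]
            congr 1
            rw [map_add, smul_add]
          map_smul' := fun t n => by
            rw [RingHom.id_apply]
            change (U.submoduleOf V).mkQ _ = t • (U.submoduleOf V).mkQ _
            rw [← map_zsmul]
            congr 1
            apply Subtype.ext
            change α • ψ (t • n) = t • (α • ψ n)
            rw [map_zsmul, smul_comm] }
      map_add' := fun α β => LinearMap.ext fun n => by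
        change subquotMk U _ _ = subquotMk U _ _ + subquotMk U _ _
        rw [← subquotMk_add]
        congr 1
        rw [add_smul]
      map_smul' := fun a α => LinearMap.ext fun n => by
        change subquotMk U _ _ = a • subquotMk U _ _
        rw [smul_subquotMk]
        congr 1
        rw [smul_eq_mul, mul_smul] }

/-- An induced module generated by a single vector is identified with a subquotient. -/
theorem nonempty_ind_equiv_subquot {V U : Submodule A M} (ψ : N →+ M) (hV : ∀ n, ψ n ∈ V)
    (hB : ∀ (b : B) n, (b : A) • ψ n - ψ (b • n) ∈ U) (v : N) (hv : ∀ n : N, ∃ b : B, n = b • v)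
    (hsurj : ∀ m ∈ V, ∃ α : A, α • ψ v = m)
    (hinj : ∀ α : A, α • ψ v ∈ U → (balanced B N).mkQ (α ⊗ₜ[ℤ] v) = 0) :
    Nonempty (Ind B N ≃ₗ[A] subquot V U) := by
  have hbal : balanced B N ≤ LinearMap.ker (indMapAux (U := U) ψ hV) := by
    rw [balanced, Submodule.span_le]
    rintro _ ⟨α, b, n, rfl⟩
    rw [SetLike.mem_coe, LinearMap.mem_ker, map_sub]
    change (U.submoduleOf V).mkQ _ - (U.submoduleOf V).mkQ _ = 0
    rw [← map_sub, Submodule.mkQ_apply, Submodule.Quotient.mk_eq_zero]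
    change (α * (b : A)) • ψ n - α • ψ (b • n) ∈ U
    rw [mul_smul, ← smul_sub]
    exact U.smul_mem α (hB b n)
  let Ψ : Ind B N →ₗ[A] subquot V U := (balanced B N).liftQ (indMapAux ψ hV) hbal
  have hΨ : ∀ (α : A) (n : N), Ψ ((balanced B N).mkQ (α ⊗ₜ[ℤ] n)) =
      subquotMk U (α • ψ n) (V.smul_mem α (hV n)) := fun α n => rfl
  -- As N is generated by v, every element of the induced module is a single tensor with v.
  have hgen : ∀ x : Ind B N, ∃ α : A, x = (balanced B N).mkQ (α ⊗ₜ[ℤ] v) := by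
    intro x
    induction x using DualBasis.ind_induction with
    | tmul α n =>
      obtain ⟨b, rfl⟩ := hv n
      exact ⟨α * b, (Ind.mk_mul_tmul α b v).symm⟩
    | add x y hx hy =>
      obtain ⟨α, rfl⟩ := hx
      obtain ⟨β, rfl⟩ := hy
      exact ⟨α + β, by rw [TensorProduct.add_tmul, map_add]⟩
  refine ⟨LinearEquiv.ofBijective Ψ ⟨?_, ?_⟩⟩
  · rw [← LinearMap.ker_eq_bot, LinearMap.ker_eq_bot']
    intro x hx
    obtain ⟨α, rfl⟩ := hgen x
    rw [hΨ, subquotMk_eq_zero_iff] at hx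
    exact hinj α hx
  · intro y
    obtain ⟨m, hm, rfl⟩ := exists_eq_subquotMk y
    obtain ⟨α, rfl⟩ := hsurj m hm
    exact ⟨_, hΨ α v⟩

/-- An element of the radical of a left ideal `B e` annihilates the vectors fixed by `e` in simple
modules. -/
lemma smul_eq_zero_of_mem_jacobson {B : Type*} [Ring B] {e : B} {L : Type*} [AddCommGroup L]
    [Module B L] [IsSimpleModule B L] (v : L) {b : (Ideal.span {e} : Ideal B)}
    (hb : b ∈ Module.jacobson B (Ideal.span {e} : Ideal B)) : (b : B) • v = 0 := by
  have := Module.le_comap_jacobson ((LinearMap.toSpanSingleton B L v).domRestrict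
    (Ideal.span {e} : Ideal B)) hb
  rwa [IsSimpleModule.jacobson_eq_bot] at this

section

variable {k : Type v} [Field k] {A S : Type u} [Ring A] [Algebra k A] [Ring S] {X : Type w}
  {c f : X → S} {π : X → A →+ S} {σ : X → S →+ A} (h : TopData c f π σ) (B : Subalgebra k A)
  (hσ : ∀ x s, σ x s ∈ B)

include h in
/-- A criterion for `A ⊗_B L` to be a given subquotient, where `B` is a subalgebra containing lifts
of the simple factors and `L` is a simple `B`-module. -/
lemma TopData.nonempty_ind_equiv {M : Type u} [AddCommGroup M] [Module A M] (x : X) (ψ : S →+ M)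
    {V U : Submodule A M} (hV : ∀ s, s * f x = s → ψ s ∈ V)
    (hB : ∀ b ∈ B, ∀ s, s * f x = s → b • ψ s - ψ (π x b * s) ∈ U)
    (hsurj : ∀ m ∈ V, ∃ α : A, α • ψ (f x) = m)
    (hfac : ∀ α : A, α • ψ (f x) ∈ U →
      ∃ ν : A, ∃ β ∈ B, α * σ x (f x) = ν * β ∧ π x β * f x = 0) :
    Nonempty (Ind B ((h.restrict B hσ).TopModule x) ≃ₗ[A] subquot V U) := by
  set hr := h.restrict B hσ
  let v := hr.ofS x (f x) (h.f_mul_f x)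
  refine nonempty_ind_equiv_subquot B (ψ.comp (hr.val x)) (fun n => hV _ (hr.val_mul_f x n))
    (fun b n => ?_) v (fun n => ⟨⟨σ x (hr.val x n), hσ x _⟩, ?_⟩) hsurj fun α hα => ?_
  · rw [AddMonoidHom.comp_apply, AddMonoidHom.comp_apply, hr.val_smul]
    exact hB b b.2 _ (hr.val_mul_f x n)
  · refine hr.val_injective x ?_
    rw [hr.val_smul, hr.val_ofS]
    change _ = π x (σ x (hr.val x n)) * f x
    rw [h.π_σ, mul_assoc, hr.val_mul_f]
    exact (hr.c_mul_val x n).symm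
  -- Since σ x (f x) fixes v, one has α ⊗ v = α σ x (f x) ⊗ v = ν β ⊗ v = ν ⊗ β v = 0.
  · obtain ⟨ν, β, hβ, hdec, h0⟩ := hfac α hα
    have h1 : v = (⟨σ x (f x), hσ x _⟩ : B) • v := by
      refine hr.val_injective x ?_
      rw [hr.val_smul, hr.val_ofS]
      change f x = π x (σ x (f x)) * f x
      rw [h.π_σ_f, h.block.idem]
    have h2 : (⟨β, hβ⟩ : B) • v = 0 := by
      refine hr.val_injective x ?_
      rw [hr.val_smul, hr.val_ofS, map_zero]
      exact h0
    rw [h1, ← Ind.mk_mul_tmul]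
    change (balanced B _).mkQ ((α * σ x (f x)) ⊗ₜ[ℤ] v) = 0
    rw [hdec, Ind.mk_mul_tmul ν ⟨β, hβ⟩ v, h2, TensorProduct.tmul_zero, map_zero]

include h in
/-- The multiplicity condition on the radicals of the projective covers of simple `B`-modules. -/
lemma TopData.hasMultiplicity_jacobson_zero (hN : IsNoetherianRing B) (hA : IsArtinianRing B)
    (x y : X) (hxy : ∀ b ∈ B, b * σ x (f x) = b → π x b * f x = 0 → σ y (f y) * b = 0) :
    HasMultiplicity B (Module.jacobson B (Ideal.span {(⟨σ x (f x), hσ x _⟩ : B)} : Ideal B))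
      ((h.restrict B hσ).TopModule y) 0 := by
  set hr := h.restrict B hσ
  refine hasMultiplicity_zero (e := (⟨σ y (f y), hσ y _⟩ : B)) (fun b => ?_)
    (hr.σ_f_smul_ne_zero y)
  obtain ⟨b, hb⟩ := b
  have h0 := congrArg (hr.val x) (smul_eq_zero_of_mem_jacobson
    (hr.ofS x (f x) (h.f_mul_f x)) hb)
  rw [hr.val_smul, map_zero, hr.val_ofS] at h0
  obtain ⟨a, ha⟩ := Ideal.mem_span_singleton'.1 b.2
  refine Subtype.ext (Subtype.ext (Subtype.ext (hxy (b : B) (b : B).2 ?_ h0)))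
  have h1 : ((a : A) * σ x (f x)) = (b : B) := congrArg Subtype.val ha
  rw [← h1, mul_assoc, h.idem x]

include h hσ in
/-- A criterion for a subalgebra to be an exact Borel subalgebra. -/
theorem TopData.isExactBorel {M : Type u} [AddCommGroup M] [Module A M] (ψ : X → S →+ M)
    (V U : X → Submodule A M) (le : X → X → Prop)
    (hV : ∀ x s, s * f x = s → ψ x s ∈ V x)
    (hB : ∀ x, ∀ b ∈ B, ∀ s, s * f x = s → b • ψ x s - ψ x (π x b * s) ∈ U x)
    (hsurj : ∀ x, ∀ m ∈ V x, ∃ α : A, α • ψ x (f x) = m)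
    (hfac : ∀ x, ∀ α : A, α • ψ x (f x) ∈ U x →
      ∃ ν : A, ∃ β ∈ B, α * σ x (f x) = ν * β ∧ π x β * f x = 0)
    (hjac : ∀ x y, ¬ Strict le x y →
      ∀ b ∈ B, b * σ x (f x) = b → π x b * f x = 0 → σ y (f y) * b = 0)
    (hN : IsNoetherianRing B) (hA : IsArtinianRing B) (hex : IndExact B) :
    IsExactBorel B le fun x => subquot (V x) (U x) :=
  ⟨(h.restrict B hσ).simple, (h.restrict B hσ).isSimpleLabelling, fun x =>
    ⟨_, (h.restrict B hσ).isPrimitiveFor_topModule x, fun y hy =>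
      h.hasMultiplicity_jacobson_zero B hσ hN hA x y (hjac x y hy)⟩, hex,
    fun x => h.nonempty_ind_equiv B hσ x (ψ x) (hV x) (hB x) (hsurj x) (hfac x)⟩

end

end Induction

/-! ### The exact Borel property -/

namespace Splitting

variable {k : Type v} {R : Type u} [Field k] [Ring R] [Algebra k R] {S : Subalgebra k R}
  {τ : R →+* S} {Λ₀ : Type w} [Fintype Λ₀] {c f : Λ₀ → S} (h : Splitting S τ c f)
include h

/-- Let i be the index of x. The component of β g_i at i multiplies v by π x β; components at
smaller indices are killed by J^(i-1), and those at larger indices vanish by triangularity. -/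
lemma borel_apply_g_sub_mem {β : ADRAlgebra (cR c)} (hβ : β ∈ h.borel) (x : Label (cR c)) {v : S}
    (hv : v * f x.1.2 = v) :
    β (MulOpposite.op (v : R) • g (cR c) (h.idx x)) -
      MulOpposite.op ((h.π x β * v : S) : R) • g (cR c) (h.idx x) ∈
        annFix (cR c) (x.1.1 - 1) (f x.1.2) := by
  refine ⟨?_, ?_⟩
  · change _ ∈ annPow (cR c) (x.1.1 - 1)
    have hcv : c x.1.2 * v = v := by
      rw [h.block.central, ← hv, mul_assoc, h.block.f_mul_c]
    obtain ⟨s, hs, hms, hsum⟩ := h.exists_eq_sum_g_of_mem_genS fun i => hβ i (h.idx x)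
    have h1 : h.π x β * v = s (h.idx x) * v := by
      rw [π_apply, h.θ_apply _ (hms (h.idx x)), h.proj_coe, hs, h.block.central, mul_assoc, hcv]
    rw [h1, map_smul, hsum, ← Finset.add_sum_erase _ _ (Finset.mem_univ (h.idx x)), smul_add,
      smul_smul, ← MulOpposite.op_mul, ← Subalgebra.coe_mul, add_sub_cancel_left, Finset.smul_sum]
    refine sum_mem fun i hi => ?_
    rcases lt_or_gt_of_ne (Finset.ne_of_mem_erase hi) with hlt | hlt
    · refine op_smul_mem_annPow (op_smul_mem_annPow (annPow_mono ?_ (g_mem_annPow i)) _) _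
      exact Nat.le_sub_one_of_lt (Fin.lt_def.1 hlt)
    · have h2 : MulOpposite.op (s i : R) • g (cR c) i = 0 := by
        rw [op_smul_g, ← hms, h.apply_g_eq_zero_of_lt hβ hlt, Pi.single_zero]
      rw [h2, smul_zero]
      exact zero_mem _
  · change MulOpposite.op (f x.1.2 : R) • _ = _
    rw [smul_sub, ← map_smul, smul_smul, smul_smul, ← MulOpposite.op_mul, ← MulOpposite.op_mul,
      ← Subalgebra.coe_mul, ← Subalgebra.coe_mul, mul_assoc, hv]

/-- The multiples of the generator of a label by elements of `S`. -/
def genMul (x : Label (cR c)) : S →+ AuslanderModule (cR c) where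
  toFun s := MulOpposite.op (s : R) • g (cR c) (h.idx x)
  map_zero' := by rw [ZeroMemClass.coe_zero, MulOpposite.op_zero, zero_smul]
  map_add' v w := by rw [Subalgebra.coe_add, MulOpposite.op_add, add_smul]

/-- β sends g_i to g_(i-1), and ν sends g_(i-1) to the image of g_i f under α, which is allowed
because that image is killed by J^(i-1). As g_(i-1) is itself killed by J^(i-1), π x β is zero. -/
lemma exists_factorization (x : Label (cR c)) {α : ADRAlgebra (cR c)}
    (hα : α (MulOpposite.op (f x.1.2 : R) • g (cR c) (h.idx x)) ∈
      annFix (cR c) (x.1.1 - 1) (f x.1.2)) :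
    ∃ ν, ∃ β ∈ h.borel, α * h.σ x (f x.1.2) = ν * β ∧ h.π x β * f x.1.2 = 0 := by
  let l : Fin (nilLength R + 1) := ⟨x.1.1 - 1, by have := (h.idx x).2; change x.1.1 < _ at this; omega⟩
  have hli : (l : ℕ) ≤ h.idx x := Nat.sub_le _ _
  have hlx : (l : ℕ) < h.idx x := Nat.sub_lt x.2.1 Nat.one_pos
  have hfix := h.op_cGe_smul (annFix_mono _ (Nat.sub_le _ _) hα)
  have hαg : α (MulOpposite.op (f x.1.2 : R) • g (cR c) (h.idx x)) =
    MulOpposite.op (f x.1.2 : R) • α (g (cR c) (h.idx x)) := map_smul _ _ _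
  generalize α (MulOpposite.op (f x.1.2 : R) • g (cR c) (h.idx x)) = m at hα hfix hαg
  have hm1 : m ∈ annPow (cR c) l := hα.1
  have hgl : g (cR c) l ∈ annPow (cR c) (h.idx x) := annPow_mono hli (g_mem_annPow l)
  refine ⟨homAt l m hm1, homAt (h.idx x) (g (cR c) l) hgl, h.homAt_mem_borel _ fun t => ?_, ?_, ?_⟩
  · have := op_smul_g_apply_mem_genS (c := c) t l 1
    rwa [OneMemClass.coe_one, MulOpposite.op_one, one_smul] at this
  · refine hom_ext_g h.cGe_idem fun t => ?_
    rw [Module.End.mul_apply, Module.End.mul_apply]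
    rcases eq_or_ne t (h.idx x) with rfl | ht
    · rw [h.σ_g, h.block.c_mul_f, homAt_g, map_smul, map_smul, homAt_g, smul_smul,
        ← MulOpposite.op_mul, h.cGe_mul_cGe hli, hfix, hαg]
    · rw [h.σ_g_of_ne x _ ht, homAt_g_of_ne ht, map_zero, map_zero]
  · rw [π_apply, homAt_g, h.θ_op_smul,
      h.θ_eq_zero_of_mem_annPow (h.one_le_idx x) hlx (g_mem_annPow l), zero_mul, mul_zero, zero_mul]

/-- The image of the generator of x under b has no component at a larger index, by triangularity. At
the index of x its component has S-coefficient π x b * f, which is zero by hypothesis. So σ y (f y),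
which only reads the component at the index of y, kills b. -/
lemma σ_f_mul_eq_zero {x y : Label (cR c)} (hxy : x.1.1 ≤ y.1.1) {b : ADRAlgebra (cR c)}
    (hbB : b ∈ h.borel) (hbe : b * h.σ x (f x.1.2) = b) (hbv : h.π x b * f x.1.2 = 0) :
    h.σ y (f y.1.2) * b = 0 := by
  refine hom_ext_g h.cGe_idem fun j => ?_
  rw [Module.End.mul_apply, LinearMap.zero_apply]
  rcases eq_or_ne j (h.idx x) with rfl | hj
  · rcases eq_or_lt_of_le (show h.idx x ≤ h.idx y from hxy) with hxy | hxy
    · have hbf : MulOpposite.op (f x.1.2 : R) • b (g (cR c) (h.idx x)) = b (g (cR c) (h.idx x)) := by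
        conv_rhs => rw [← hbe, Module.End.mul_apply, h.σ_g, h.block.c_mul_f, map_smul]
      obtain ⟨s, hs, hms⟩ := h.exists_of_mem_genS (hbB (h.idx x) (h.idx x))
      have h1 : h.θ (h.idx x) (h.one_le_idx x) (b (g (cR c) (h.idx x))) = s := by
        rw [h.θ_apply _ hms, h.proj_coe, hs]
      have h2 : s * f x.1.2 = s := by
        have := h.θ_op_smul (h.one_le_idx x) (f x.1.2 : R) (b (g (cR c) (h.idx x)))
        rw [hbf, h1, h.proj_coe] at this
        exact this.symm
      have h3 : s = 0 := by
        rw [π_apply, h1, h.block.central, mul_assoc, h.block.c_mul_f, h2] at hbv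
        exact hbv
      rw [h3, ZeroMemClass.coe_zero, MulOpposite.op_zero, zero_smul] at hms
      rw [h.σ_apply (r := 0) y _ (by rw [← hxy, hms, MulOpposite.op_zero, zero_smul]), mul_zero,
        MulOpposite.op_zero, zero_smul]
    · rw [h.σ_apply (r := 0) y _ (by
        rw [h.apply_g_eq_zero_of_lt hbB hxy, MulOpposite.op_zero, zero_smul]), mul_zero,
        MulOpposite.op_zero, zero_smul]
  · rw [← hbe, Module.End.mul_apply, h.σ_g_of_ne x _ hj, map_zero, map_zero]

theorem isExactBorel [IsSemisimpleRing S] [Module.Finite k R] (hN : IsNoetherianRing h.borel)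
    (hA : IsArtinianRing h.borel) :
    IsExactBorel h.borel (idemLE (proj (cR c)) h.topData.simple) (standard c f) := by
  obtain ⟨N, a, Φ, hΦ⟩ := h.exists_dualBasis_borel
  refine h.topData.isExactBorel h.borel h.σ_mem_borel h.genMul _ _ _
    (fun x s hs => h.op_smul_g_mem_annFix x hs)
    (fun x b hb s hs => h.borel_apply_g_sub_mem hb x hs)
    (fun x m hm => ?_) (fun x α hα => h.exists_factorization x hα)
    (fun x y hxy b hb hbe hbv => h.σ_f_mul_eq_zero ?_ hb hbe hbv) hN hA hΦ.indExact
  · obtain ⟨a, ha⟩ := h.exists_mul_σ_f_apply_eq hm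
    exact ⟨_, ha⟩
  · by_contra! hlt
    refine hxy ⟨(h.idemLE_iff).2 (Or.inr hlt), ?_⟩
    rintro rfl
    exact lt_irrefl _ hlt

end Splitting

/-! ### Fitting's lemma and the characterisation of the summands M^i -/

section Retracts

variable {Q : Type*} [Ring Q] {N Y : Type*} [AddCommGroup N] [Module Q N] [AddCommGroup Y]
  [Module Q Y]

lemma isComplemented_range_of_retract {s : N →ₗ[Q] Y} {r : Y →ₗ[Q] N} (h : r ∘ₗ s = LinearMap.id) :
    IsComplemented (LinearMap.range s) := by
  have hrs : ∀ x, r (s x) = x := LinearMap.congr_fun h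
  refine ⟨LinearMap.ker r, ?_, ?_⟩
  · rw [Submodule.disjoint_def]
    rintro _ ⟨x, rfl⟩ hx
    rw [LinearMap.mem_ker, hrs] at hx
    rw [hx, map_zero]
  · rw [codisjoint_iff, eq_top_iff]
    rintro y -
    refine Submodule.mem_sup.2 ⟨s (r y), ⟨_, rfl⟩, y - s (r y), ?_, add_sub_cancel _ _⟩
    rw [LinearMap.mem_ker, map_sub, hrs, sub_self]

lemma nonempty_equiv_range_of_retract {s : N →ₗ[Q] Y} {r : Y →ₗ[Q] N}
    (h : r ∘ₗ s = LinearMap.id) : Nonempty (N ≃ₗ[Q] LinearMap.range s) :=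
  ⟨LinearEquiv.ofInjective s (Function.LeftInverse.injective (LinearMap.congr_fun h))⟩

/-- If an endomorphism of a module of finite length factors through a module sharing no direct
summand with it, then it is nilpotent. -/
lemma isNilpotent_comp_of_noCommonSummand [IsArtinian Q N] [IsNoetherian Q N]
    (H : ∀ (D : Submodule Q N) (D' : Submodule Q Y), IsComplemented D → IsComplemented D' →
      D ≠ ⊥ → IsEmpty (D ≃ₗ[Q] D')) (p : Y →ₗ[Q] N) (ι : N →ₗ[Q] Y) :
    IsNilpotent (p ∘ₗ ι : Module.End Q N) := by
  set w : Module.End Q N := p ∘ₗ ι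
  by_contra hw
  -- By Fitting's lemma N is the direct sum of the kernel and the image of a high power v of w. On
  -- the image, v w is injective, hence bijective, so this nonzero summand of N is also a retract of
  -- Y.
  obtain ⟨m, hm⟩ := Filter.eventually_atTop.1 w.eventually_isCompl_ker_pow_range_pow
  set v : Module.End Q N := w ^ (m + 1)
  have hcompl : IsCompl (LinearMap.ker v) (LinearMap.range v) := hm (m + 1) (Nat.le_succ m)
  have hD : LinearMap.range v ≠ ⊥ := fun h0 => hw ⟨m + 1, LinearMap.range_eq_bot.1 h0⟩
  let s : LinearMap.range v →ₗ[Q] Y := ι ∘ₗ (LinearMap.range v).subtype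
  let t : Y →ₗ[Q] LinearMap.range v := v.rangeRestrict ∘ₗ p
  have hts : ∀ d, ((t (s d) : LinearMap.range v) : N) = v (w d) := fun d => rfl
  have hinj : Function.Injective (t ∘ₗ s) := by
    rw [← LinearMap.ker_eq_bot, LinearMap.ker_eq_bot']
    intro d hd
    have h1 : v (w d) = 0 := by
      rw [← hts]
      exact congrArg Subtype.val hd
    have h2 : v (v d) = 0 := by
      have h3 : v * v = w ^ m * (v * w) := by
        rw [← pow_succ, ← pow_add, ← pow_add]
        congr 1
        omega
      rw [← Module.End.mul_apply, h3, Module.End.mul_apply, Module.End.mul_apply, h1, map_zero]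
    have hdis := Submodule.disjoint_def.1 hcompl.disjoint
    exact Subtype.ext (hdis _ (hdis _ h2 ⟨_, rfl⟩) d.2)
  let e := LinearEquiv.ofBijective (t ∘ₗ s) (IsArtinian.bijective_of_injective_endomorphism _ hinj)
  have hret : (e.symm.toLinearMap ∘ₗ t) ∘ₗ s = LinearMap.id :=
    LinearMap.ext fun d => e.symm_apply_apply d
  obtain ⟨φ⟩ := nonempty_equiv_range_of_retract hret
  exact (H _ _ ⟨_, hcompl.symm⟩ (isComplemented_range_of_retract hret) hD).false φ

/-- Nilpotent contributions to a retraction can be removed. -/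
lemma exists_retraction {I : Type*} {ι : N →ₗ[Q] Y} {e : Y →ₗ[Q] Y} {e' : I → Y →ₗ[Q] Y}
    (s : Finset I) (H : ∀ i ∈ s, ∀ q : Y →ₗ[Q] N, IsNilpotent (q ∘ₗ e' i ∘ₗ ι : Module.End Q N))
    (q : Y →ₗ[Q] N) (hq : q ∘ₗ e ∘ₗ ι + ∑ i ∈ s, q ∘ₗ e' i ∘ₗ ι = LinearMap.id) :
    ∃ q' : Y →ₗ[Q] N, q' ∘ₗ e ∘ₗ ι = LinearMap.id := by
  classical
  induction s using Finset.induction_on generalizing q with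
  | empty => exact ⟨q, by rwa [Finset.sum_empty, add_zero] at hq⟩
  | insert a s ha ih =>
    -- The term at a is nilpotent, so the remaining terms sum to a unit of End N; composing q with
    -- its inverse restores the identity with one term fewer.
    have hu : IsUnit (1 - q ∘ₗ e' a ∘ₗ ι : Module.End Q N) :=
      (H a (Finset.mem_insert_self a s) q).isUnit_one_sub
    obtain ⟨u, hu⟩ := hu
    refine ih (fun i hi => H i (Finset.mem_insert_of_mem hi))
      ((↑u⁻¹ : Module.End Q N) ∘ₗ q) ?_
    rw [Finset.sum_insert ha, add_left_comm] at hq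
    have h1 : q ∘ₗ e ∘ₗ ι + ∑ i ∈ s, q ∘ₗ e' i ∘ₗ ι = (u : Module.End Q N) := by
      rw [hu, eq_sub_iff_add_eq']
      exact hq
    have h2 := congrArg (fun x : Module.End Q N => (↑u⁻¹ : Module.End Q N) * x) h1
    simp only [Units.inv_mul, mul_add, Finset.mul_sum] at h2
    exact h2

end Retracts

section Cyc

variable {R : Type u} [Ring R]

lemma mem_cyc {e : R} {i : ℕ} {y : R ⧸ radPow R i} :
    y ∈ cyc e i ↔ ∃ r, y = (radPow R i).mkQ (e * r) := by
  rw [cyc, Submodule.mem_span_singleton]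
  constructor
  · rintro ⟨a, rfl⟩
    exact ⟨a.unop, rfl⟩
  · rintro ⟨r, rfl⟩
    exact ⟨MulOpposite.op r, rfl⟩

lemma isCompl_cyc {e : R} (he : e * e = e) (i : ℕ) : IsCompl (cyc e i) (cyc (1 - e) i) := by
  constructor
  · rw [Submodule.disjoint_def]
    intro y hy hy'
    obtain ⟨r, rfl⟩ := mem_cyc.1 hy
    obtain ⟨s, hs⟩ := mem_cyc.1 hy'
    rw [← sub_eq_zero, ← map_sub, mkQ_eq_zero_iff] at hs
    have := Ideal.mul_mem_left _ e hs
    rw [mul_sub, ← mul_assoc, ← mul_assoc, mul_sub, mul_one, he, sub_self, zero_mul, sub_zero]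
      at this
    exact mkQ_eq_zero_iff.2 this
  · rw [codisjoint_iff, eq_top_iff]
    rintro y -
    obtain ⟨r, rfl⟩ := (radPow R i).mkQ_surjective y
    refine Submodule.mem_sup.2 ⟨_, mem_cyc.2 ⟨r, rfl⟩, _, mem_cyc.2 ⟨r, rfl⟩, ?_⟩
    rw [← map_add, ← add_mul, add_sub_cancel, one_mul]

/-- Left multiplication by an element `e`, as a map `R / J^i → R / J^j`. -/
def leftMul (i j : ℕ) (e : R) (he : ∀ r ∈ Ring.jacobson R ^ i, e * r ∈ Ring.jacobson R ^ j) :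
    (R ⧸ radPow R i) →ₗ[Rᵐᵒᵖ] R ⧸ radPow R j :=
  (radPow R i).mapQ (radPow R j)
    { toFun := fun r => e * r
      map_add' := mul_add e
      map_smul' := fun a r => (mul_assoc e r a.unop).symm }
    he

lemma leftMul_mkQ (i j : ℕ) (e : R) (he : ∀ r ∈ Ring.jacobson R ^ i, e * r ∈ Ring.jacobson R ^ j)
    (r : R) : leftMul i j e he ((radPow R i).mkQ r) = (radPow R j).mkQ (e * r) := rfl

end Cyc

namespace Splitting

variable {k : Type v} {R : Type u} [Field k] [Ring R] [Algebra k R] {S : Subalgebra k R}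
  {τ : R →+* S} {Λ₀ : Type w} [Fintype Λ₀] {c f : Λ₀ → S} (h : Splitting S τ c f)
include h

/-- A summand of M^i isomorphic to one of M^j is killed by J^j, so the projection onto it multiplies
the generator by some r in J. By idempotence it also equals its own multiple by every power of r, so
it vanishes. -/
lemma noCommonSummand {i j : ℕ} (hij : j < i) :
    NoCommonSummand R (auslanderSummand (cR c) i) (auslanderSummand (cR c) j) := by
  intro D D' hD _ hne
  refine ⟨fun φ => hne ?_⟩
  obtain ⟨C, hC⟩ := hD
  let p := D.projection C hC
  have hpD : ∀ y, p y ∈ D := Submodule.projection_apply_mem hC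
  have hkill : ∀ d ∈ D, ∀ a ∈ Ring.jacobson R ^ j, MulOpposite.op a • d = 0 := by
    intro d hd a ha
    have h1 : MulOpposite.op a • (φ ⟨d, hd⟩) = 0 := by
      obtain ⟨⟨y, hy⟩, hy'⟩ := φ ⟨d, hd⟩
      apply Subtype.ext
      apply Subtype.ext
      obtain ⟨r, rfl⟩ := mem_cyc.1 hy
      exact mkQ_eq_zero_iff.2 (Ideal.mul_mem_left _ _ ha)
    rw [← map_smul, LinearEquiv.map_eq_zero_iff] at h1
    exact congrArg Subtype.val h1
  obtain ⟨r, hr, hpr⟩ := exists_eq_op_smul_gen (h.cGe_idem i) (p (gen (cR c) i))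
  have hrJ : r ∈ Ring.jacobson R := h.mem_jacobson_of_mul_mem hij hr fun a ha => by
    rw [← op_smul_gen_eq_zero_iff (c := cR c) (by rw [← mul_assoc, hr]), MulOpposite.op_mul,
      mul_smul, ← hpr]
    exact hkill _ (hpD _) a ha
  have hpow : ∀ n : ℕ, p (gen (cR c) i) = MulOpposite.op (r ^ n) • p (gen (cR c) i) := by
    intro n
    induction n with
    | zero => rw [pow_zero, MulOpposite.op_one, one_smul]
    | succ n ih =>
      have h1 : p (p (gen (cR c) i)) = p (gen (cR c) i) :=
        Submodule.projection_apply_of_mem_left hC (hpD _)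
      have h2 : MulOpposite.op r • p (gen (cR c) i) = p (gen (cR c) i) := by
        conv_rhs => rw [← h1, hpr, map_smul]
      rw [pow_succ', MulOpposite.op_mul, mul_smul, h2]
      exact ih
  have h0 : p (gen (cR c) i) = 0 := by
    have h1 := Ideal.pow_mem_pow hrJ (nilLength R)
    rw [h.jacobson_pow_nilLength, Ideal.mem_bot] at h1
    rw [hpow (nilLength R), h1, MulOpposite.op_zero, zero_smul]
  rw [Submodule.eq_bot_iff]
  intro d hd
  obtain ⟨a, -, rfl⟩ := exists_eq_op_smul_gen (h.cGe_idem i) d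
  rw [← Submodule.projection_apply_of_mem_left hC hd]
  change p _ = 0
  rw [map_smul, h0, smul_zero]

/-- For j = ℓ(x) one has c x J^j = 0, so left multiplication by c x on R / J^i factors through M^j,
with which N has no common summand. -/
lemma isNilpotent_of_noCommonSummand [IsArtinian Rᵐᵒᵖ R] [IsNoetherian Rᵐᵒᵖ R] {i : ℕ} {x : Λ₀}
    (hx : len (cR c) x < i) {N : Submodule Rᵐᵒᵖ (R ⧸ radPow R i)}
    (hN : NoCommonSummand R N (auslanderSummand (cR c) (len (cR c) x)))
    (q : (R ⧸ radPow R i) →ₗ[Rᵐᵒᵖ] N) :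
    IsNilpotent (q ∘ₗ leftMul i i (cR c x) (fun _ hr => Ideal.mul_mem_left _ _ hr) ∘ₗ N.subtype :
      Module.End Rᵐᵒᵖ N) := by
  set j := len (cR c) x
  let b : auslanderSummand (cR c) j →ₗ[Rᵐᵒᵖ] R ⧸ radPow R i :=
    leftMul j i (cR c x) (fun r hr => by
      rw [(h.len_le_iff x j).1 le_rfl r hr]
      exact zero_mem _) ∘ₗ (auslanderSummand (cR c) j).subtype
  let a : (R ⧸ radPow R i) →ₗ[Rᵐᵒᵖ] auslanderSummand (cR c) j :=
    (leftMul i j (cR c x) fun r hr => mem_jacobson_pow_of_le hx.le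
      (Ideal.mul_mem_left _ _ hr)).codRestrict _ fun y => by
        obtain ⟨r, rfl⟩ := (radPow R i).mkQ_surjective y
        rw [leftMul_mkQ]
        refine mem_cyc.2 ⟨cR c x * r, ?_⟩
        rw [← mul_assoc, ← coe_cGeS, ← Subalgebra.coe_mul, h.cGeS_central,
          h.c_mul_cGeS_of_le le_rfl]
  have hab : leftMul i i (cR c x) (fun _ hr => Ideal.mul_mem_left _ _ hr) = b ∘ₗ a := by
    refine LinearMap.ext fun y => ?_
    obtain ⟨r, rfl⟩ := (radPow R i).mkQ_surjective y
    rw [leftMul_mkQ]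
    change _ = (radPow R i).mkQ (cR c x * (cR c x * r))
    rw [← mul_assoc, h.coe_c_mul_c]
  rw [hab]
  exact isNilpotent_comp_of_noCommonSummand hN (q ∘ₗ b) (a ∘ₗ N.subtype)

/-- For maximality, write 1 = c_{≥i} + Σ c x over ℓ(x) < i, acting on R / J^i. The terms c x
contribute only nilpotent endomorphisms of N and can be dropped from a retraction onto N, so N is a
retract of the image of c_{≥i}, which is M^i. -/
theorem isAuslanderFamily [IsArtinian Rᵐᵒᵖ R] [IsNoetherian Rᵐᵒᵖ R] :
    IsAuslanderFamily R (auslanderSummand (cR c)) where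
  summand i _ := ⟨_, isCompl_cyc (h.cGe_idem i) i⟩
  new i j _ hij := h.noCommonSummand hij
  largest i hi N hNc hN := by
    classical
    obtain ⟨C, hC⟩ := hNc
    have hJ : ∀ e : R, ∀ r ∈ Ring.jacobson R ^ i, e * r ∈ Ring.jacobson R ^ i :=
      fun e r hr => Ideal.mul_mem_left _ _ hr
    have hone : cGe (cR c) i + ∑ x ∈ Finset.univ.filter (fun x => ¬ i ≤ len (cR c) x), cR c x =
        1 := by
      have := congrArg Subtype.val h.complete.complete
      rw [AddSubmonoidClass.coe_finsetSum] at this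
      refine Eq.trans ?_ this
      rw [cGe, ← Finset.sum_filter_add_sum_filter_not Finset.univ
        (fun x => i ≤ len (cR c) x) (fun x => (c x : R))]
    obtain ⟨q, hq⟩ := exists_retraction (ι := N.subtype) (e := leftMul i i (cGe (cR c) i) (hJ _))
      (e' := fun x => leftMul i i (cR c x) (hJ _))
      (Finset.univ.filter fun x => ¬ i ≤ len (cR c) x)
      (fun x hx q => by
        have hx' : len (cR c) x < i := not_le.1 (Finset.mem_filter.1 hx).2
        exact h.isNilpotent_of_noCommonSummand hx' (hN _ (h.one_le_len x) hx') q)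
      (N.projectionOnto C hC) (by
        refine LinearMap.ext fun y => ?_
        simp only [LinearMap.add_apply, LinearMap.sum_apply, LinearMap.comp_apply]
        rw [← map_sum, ← map_add, LinearMap.id_apply]
        conv_rhs => rw [← Submodule.projectionOnto_apply_left hC y]
        congr 1
        obtain ⟨r, hr⟩ := (radPow R i).mkQ_surjective (y : R ⧸ radPow R i)
        rw [Submodule.subtype_apply, ← hr]
        simp only [leftMul_mkQ]
        rw [← map_sum, ← map_add, ← Finset.sum_mul, ← add_mul, hone, one_mul])
    let s : N →ₗ[Rᵐᵒᵖ] auslanderSummand (cR c) i :=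
      (leftMul i i (cGe (cR c) i) (hJ _) ∘ₗ N.subtype).codRestrict _ fun y => by
        obtain ⟨r, hr⟩ := (radPow R i).mkQ_surjective (y : R ⧸ radPow R i)
        rw [LinearMap.comp_apply, Submodule.subtype_apply, ← hr, leftMul_mkQ]
        exact mem_cyc.2 ⟨r, rfl⟩
    have hs : (q ∘ₗ (auslanderSummand (cR c) i).subtype) ∘ₗ s = LinearMap.id := hq
    exact ⟨LinearMap.range s, isComplemented_range_of_retract hs,
      nonempty_equiv_range_of_retract hs⟩

end Splitting

/-! ### Finiteness over the base field and assembly of the theorem -/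

lemma finite_end (k : Type*) [Field k] (Q M : Type*) [Ring Q] [AddCommGroup M] [Module Q M]
    [Module k M] [SMulCommClass Q k M] [LinearMap.CompatibleSMul M M k Q] [Module.Finite k M] :
    Module.Finite k (Module.End Q M) :=
  Module.Finite.of_injective (LinearMap.restrictScalarsₗ k Q M M k)
    (LinearMap.restrictScalars_injective k)

lemma isNoetherian_and_isArtinian_of_tower (k : Type*) [Field k] (A M : Type*) [Ring A]
    [AddCommGroup M] [Algebra k A] [Module A M] [Module k M] [IsScalarTower k A M]
    [Module.Finite k M] : IsNoetherian A M ∧ IsArtinian A M :=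
  ⟨isNoetherian_of_tower k inferInstance, isArtinian_of_tower k inferInstance⟩

lemma isNoetherianRing_and_isArtinianRing_of_finite (k : Type*) [Field k] (A : Type*) [Ring A]
    [Algebra k A] [Module.Finite k A] (B : Subalgebra k A) :
    IsNoetherianRing B ∧ IsArtinianRing B :=
  have : Module.Finite k B := Module.Finite.of_injective B.val.toLinearMap Subtype.val_injective
  isNoetherian_and_isArtinian_of_tower k B B

lemma finite_auslanderModule (k : Type*) [Field k] {R : Type u} [Ring R] [Algebra k R]
    [Module.Finite k R] {Λ₀ : Type w} [Fintype Λ₀] (c : Λ₀ → R) :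
    Module.Finite k (AuslanderModule c) := by
  have : ∀ i : Fin (nilLength R + 1), Module.Finite k (auslanderSummand c i) := fun i =>
    Module.Finite.of_injective ((auslanderSummand c i).restrictScalars k).subtype
      Subtype.val_injective
  infer_instance

end ADR

end

theorem theoremA (k : Type v) [Field k] (R : Type u) [Ring R] [Algebra k R] [Module.Finite k R]
    {Λ₀ : Type w} [Fintype Λ₀] (T : Λ₀ → ModuleCat.{u} Rᵐᵒᵖ)
    (hT : ADR.IsSimpleLabelling Rᵐᵒᵖ T) :
    (PerfectField k → ∃ S : Subalgebra k R, ADR.IsWedderburnComplement S) ∧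
    ∀ S : Subalgebra k R, ADR.IsWedderburnComplement S →
      ∃ c : Λ₀ → R, ADR.IsTopDecomposition T c ∧
        (∀ x, c x ∈ S) ∧ (∀ x, ∀ s ∈ S, c x * s = s * c x) ∧
        ADR.IsAuslanderFamily R (ADR.auslanderSummand c) ∧
        ∃ L : ADR.Label c → ModuleCat.{u} (ADR.ADRAlgebra c),
          ADR.IsSimpleLabelling (ADR.ADRAlgebra c) L ∧
          ADR.MatchesLabels c L ∧
          (∀ p : ADR.Label c, ADR.idemLevel (ADR.proj c) (L p) = p.1.1) ∧
          ∃ Δ : ADR.Label c → ModuleCat.{u} (ADR.ADRAlgebra c),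
            ADR.IsQuasiHereditary L (ADR.idemLE (ADR.proj c) L) Δ ∧
            ∃ B : Subalgebra k (ADR.ADRAlgebra c),
              (B : Set (ADR.ADRAlgebra c)) = ADR.borelSet c (S : Set R) ∧
              ADR.IsGradedPreBorelic (ADR.proj c) B ∧
              ADR.IsExactBorel B (ADR.idemLE (ADR.proj c) L) Δ := by
  refine ⟨fun _ => ADR.exists_isWedderburnComplement k R, fun S hS => ?_⟩
  obtain ⟨τ, c, f, h, hf⟩ := ADR.exists_splitting S hS hT
  have := hS.semisimple
  have hR := ADR.isNoetherian_and_isArtinian_of_tower k Rᵐᵒᵖ R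
  have := hR.1
  have := hR.2
  have := ADR.finite_auslanderModule k (fun x => (c x : R))
  have hM := ADR.isNoetherian_and_isArtinian_of_tower k (ADR.ADRAlgebra fun x => (c x : R))
    (ADR.AuslanderModule fun x => (c x : R))
  have hE := ADR.finite_end k Rᵐᵒᵖ (ADR.AuslanderModule fun x => (c x : R))
  have hB := ADR.isNoetherianRing_and_isArtinianRing_of_finite k
    (ADR.ADRAlgebra fun x => (c x : R)) h.borel
  obtain ⟨_, _, _, hΦ⟩ := h.exists_dualBasis_borel
  exact ⟨fun x => c x, h.isTopDecomposition hT hf, fun x => (c x).2,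
    fun x s hs => congrArg Subtype.val (h.block.central x ⟨s, hs⟩), h.isAuslanderFamily,
    h.topData.simple, h.topData.isSimpleLabelling, h.matchesLabels, h.idemLevel_simple,
    ADR.standard c f, h.isQuasiHereditary hM.1 hM.2, h.borel, h.coe_borel,
    ⟨ADR.completeOrthogonalIdempotents_proj _, h.isNGraded, h.isCompl_borel, hΦ.projective,
      h.projective_degZero⟩, h.isExactBorel hB.1 hB.2⟩
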